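/- Let $q\in\mathbb C^\times$, $m=N+1\ge 1$, $f(u,v)=\frac{qu-q^{-1}v}{u-v}$, $g(u,v)=\frac{q-q^{-1}}{u-v}$, and let $$R(u,v)=f(u,v)\sum_{i}E_{ii}\otimes E_{ii}+\sum_{i<j}(E_{ii}\otimes E_{jj}+E_{jj}\otimes E_{ii})+\sum_{i<j}g(u,v)\,(u\,E_{ij}\otimes E_{ji}+v\,E_{ji}\otimes E_{ij})$$ be the $R$-matrix of the vector representation of $U_q(\widehat{\mathfrak{gl}}_m)$. A function of one or two families of variables denotes the product (double product) over the families; empty products are $1$. *Models.* Let $D\subseteq\mathbb C$ be a set of spectral parameters. For $l=1,2$ let $T^{(l)}(u)$ be an $m\times m$ matrix of linear operators on a complex vector space $\mathcal H^{(l)}$ satisfying $$R(u,v)(T(u)\otimes 1)(1\otimes T(v))=(1\otimes T(v))(T(u)\otimes 1)R(u,v)\qquad(u\neq v\in D),$$ with a dual pseudovacuum $\langle 0|^{(l)}\in(\mathcal H^{(l)})^*$ such that, for $u\in D$, $\langle0|^{(l)}T^{(l)}_{ii}(u)=\lambda^{(l)}_i(u)\langle 0|^{(l)}$ and $\langle0|^{(l)}T^{(l)}_{ij}(u)=0$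 for $i<j$. Put $\alpha^{(l)}_\nu=\lambda_\nu^{(l)}/\lambda_{\nu+1}^{(l)}$. The composite model is $T(u)=T^{(2)}(u)T^{(1)}(u)$ on $\mathcal H^{(1)}\otimes\mathcal H^{(2)}$, i.e. $T_{ij}(u)=\sum_kT^{(2)}_{ik}(u)T^{(1)}_{kj}(u)$, with $\langle0|=\langle0|^{(1)}\otimes\langle0|^{(2)}$ and $\lambda_i=\lambda_i^{(1)}\lambda_i^{(2)}$. *Bethe vectors.* For a monodromy matrix $T$ on $\mathcal H$ with pseudovacuum $|0\rangle$ and vacuum eigenvalues $\lambda_i$, and families $\bar t=(\bar t^1,\dots,\bar t^N)$, $\bar t^\nu=(t^\nu_1,\dots,t^\nu_{r_\nu})$, the Bethe vector $\mathbb B_q(\bar t|T)$ is defined by the nested algebraic Bethe ansatz: it is $|0\rangle$ for $m=1$, and for $m\ge2$ $$\mathbb B_q(\bar t|T)=\frac{1}{\lambda_2(\bar t^1)f(\bar t^2,\bar t^1)}\sum_{k_1,\dots,k_{r_1}=2}^{m}T_{1,k_1}(t^1_1)\cdots T_{1,k_{r_1}}(t^1_{r_1})\,\bigl[\mathbb B_q(\bar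 t^2,\dots,\bar t^N|\widetilde T)\bigr]_{k_1,\dots,k_{r_1}}$$ (with $\bar t^{2}=\emptyset$ if $N=1$), where $\widetilde T(u)=(T_{ij}(u))_{i,j=2}^m\,\mathsf r_{0,r_1}(u,t^1_{r_1})\cdots\mathsf r_{0,1}(u,t^1_1)$ acts in $\mathcal H\otimes(\mathbb C^{m-1})^{\otimes r_1}$, $\mathsf r$ is the $R$-matrix for $m-1$ with indices $2,\dots,m$ ($0$ labels the auxiliary space, $l$ the $l$-th tensor factor), its pseudovacuum is $|0\rangle\otimes \mathsf e_2^{\otimes r_1}$, and its vacuum eigenvalues are $\lambda_2(u)f(u,\bar t^1),\lambda_3(u),\dots,\lambda_m(u)$. *Dual Bethe vectors* are obtained through the antimorphism $\Psi:T_{ab}(u)\mapsto\widetilde T_{ba}(u^{-1})$ from $U_q$ to $U_{q^{-1}}$: $\mathbb C_q(\bar s|T)\in\mathcal H^*$ is the Bethe vector $\mathbb B_{q^{-1}}(\bar s^{-1}|T^\Psi)$ of the matrix $T^\Psi_{ab}(u)=\bigl(T_{ba}(u^{-1})\bigr)^*$ of operators on $\mathcal H^*$, with pseudovacuum $\langle0|$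 and vacuum eigenvalues $\lambda_i(u^{-1})$. *Theorem.* Let $\bar s=(\bar s^1,\dots,\bar s^N)$ be families of nonzero Bethe parameters in $D$ in generic position: all parameters (of all families) are pairwise distinct, $f(s^\nu_a,s^\nu_b)\ne0$ for $a\neq b$, $f(s^{\nu+1}_a,s^\nu_b)\neq0$, and $\lambda^{(l)}_{\nu+1}(s^\nu_a)\ne0$ for $l=1,2$. Then $$\mathbb C_q(\bar s|T)=\sum\frac{\prod_{\nu=1}^{N}\alpha^{(1)}_\nu(\bar s^\nu_{\rm ii})\,f(\bar s^\nu_{\rm i},\bar s^\nu_{\rm ii})}{\prod_{\nu=1}^{N-1}f(\bar s^{\nu+1}_{\rm i},\bar s^\nu_{\rm ii})}\;\mathbb C_q(\bar s_{\rm ii}|T^{(2)})\otimes\mathbb C_q(\bar s_{\rm i}|T^{(1)}),$$ where the sum is over all partitions of every family $\bar s^\nu$ into two disjoint (possibly empty) subfamilies $\bar s^\nu_{\rm i}$, $\bar s^\nu_{\rm ii}$, and the tensor product of functionals is the one on $\mathcal H^{(1)}\otimes\mathcal H^{(2)}$ in which $\mathbb C_q(\,\cdot\,|T^{(l)})$ acts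 on $\mathcal H^{(l)}$. -/

import Mathlib

open scoped Kronecker TensorProduct

universe u

namespace QAffine

noncomputable section

/-- The rational function `f(u,v) = (q u - q⁻¹ v) / (u - v)`. -/
def fFun (q u v : ℂ) : ℂ := (q * u - q⁻¹ * v) / (u - v)

/-- The rational function `g(u,v) = (q - q⁻¹) / (u - v)`. -/
def gFun (q u v : ℂ) : ℂ := (q - q⁻¹) / (u - v)

/-- Double product `f(x̄, ȳ)` over two families of variables (empty products are `1`). -/
def fProd (q : ℂ) (x y : List ℂ) : ℂ := (x.map fun a => (y.map fun b => fFun q a b).prod).prod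

/-- Product `h(x̄)` of a scalar function over a family of variables. -/
def prodOver (h : ℂ → ℂ) (x : List ℂ) : ℂ := (x.map h).prod

/-- The `R`-matrix of the vector representation of `U_q(gl_m^)`, acting in `ℂ^m ⊗ ℂ^m`. -/
def RMatrix (q : ℂ) (m : ℕ) (u v : ℂ) : Matrix (Fin m × Fin m) (Fin m × Fin m) ℂ :=
  fFun q u v • (∑ i : Fin m, Matrix.single i i (1 : ℂ) ⊗ₖ Matrix.single i i (1 : ℂ))
  + (∑ i : Fin m, ∑ j ∈ Finset.Ioi i,
      (Matrix.single i i (1 : ℂ) ⊗ₖ Matrix.single j j (1 : ℂ)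
        + Matrix.single j j (1 : ℂ) ⊗ₖ Matrix.single i i (1 : ℂ)))
  + (∑ i : Fin m, ∑ j ∈ Finset.Ioi i,
      gFun q u v • (u • (Matrix.single i j (1 : ℂ) ⊗ₖ Matrix.single j i (1 : ℂ))
        + v • (Matrix.single j i (1 : ℂ) ⊗ₖ Matrix.single i j (1 : ℂ))))

/-- `m × m` matrices with operator entries, depending on a spectral parameter. -/
abbrev OpMatrix (m : ℕ) (H : Type u) [AddCommGroup H] [Module ℂ H] : Type u :=
  ℂ → Matrix (Fin m) (Fin m) (Module.End ℂ H)

section Space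

variable {H : Type u} [AddCommGroup H] [Module ℂ H]

/-- The `RTT`-relation
`R(u,v) (T(u) ⊗ 1) (1 ⊗ T(v)) = (1 ⊗ T(v)) (T(u) ⊗ 1) R(u,v)` at all distinct points `u`, `v` of the
set `D` of spectral parameters under consideration. -/
def SatisfiesRTT (q : ℂ) {m : ℕ} (D : Set ℂ) (T : OpMatrix m H) : Prop :=
  ∀ u ∈ D, ∀ v ∈ D, u ≠ v →
    (RMatrix q m u v).map (algebraMap ℂ (Module.End ℂ H))
        * (T u ⊗ₖ (1 : Matrix (Fin m) (Fin m) (Module.End ℂ H)))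
        * ((1 : Matrix (Fin m) (Fin m) (Module.End ℂ H)) ⊗ₖ T v)
      = ((1 : Matrix (Fin m) (Fin m) (Module.End ℂ H)) ⊗ₖ T v)
        * (T u ⊗ₖ (1 : Matrix (Fin m) (Fin m) (Module.End ℂ H)))
        * (RMatrix q m u v).map (algebraMap ℂ (Module.End ℂ H))

/-- `w = ⟨0|` is a dual pseudovacuum with vacuum eigenvalues `lam i`:
`⟨0| T_{ii}(u) = λ_i(u) ⟨0|`, and `⟨0| T_{ij}(u) = 0` for `i < j`. -/
structure IsDualVacuum {m : ℕ} (D : Set ℂ) (T : OpMatrix m H) (lam : Fin m → ℂ → ℂ)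
    (w : Module.Dual ℂ H) : Prop where
  diag : ∀ u ∈ D, ∀ i, w ∘ₗ T u i i = lam i u • w
  upper : ∀ u ∈ D, ∀ i j, i < j → w ∘ₗ T u i j = 0

/-! ### Bethe vectors via the nested algebraic Bethe ansatz

The space `H ⊗ (ℂ^n)^{⊗ r}` is realised as the space of families of components
`(Fin r → Fin n) → H`. -/

/-- The operator in `H ⊗ (ℂ^n)^{⊗ r}` acting as the scalar matrix `M` in the `l`-th copy of `ℂ^n`
and as the identity elsewhere. -/
def siteOp (H : Type u) [AddCommGroup H] [Module ℂ H] {n r : ℕ} (l : Fin r)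
    (M : Matrix (Fin n) (Fin n) ℂ) : Module.End ℂ ((Fin r → Fin n) → H) where
  toFun ψ k := ∑ c : Fin n, M (k l) c • ψ (Function.update k l c)
  map_add' ψ χ := by
    funext k
    simp [smul_add, Finset.sum_add_distrib]
  map_smul' a ψ := by
    funext k
    simp [Finset.smul_sum, smul_comm a]

/-- `R_{0,l}(u,v)`, as a matrix in the auxiliary space `0` whose entries act in the `l`-th copy of
`ℂ^n` in `H ⊗ (ℂ^n)^{⊗ r}`. -/
def siteR (q : ℂ) (H : Type u) [AddCommGroup H] [Module ℂ H] {n r : ℕ} (l : Fin r) (u v : ℂ) :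
    Matrix (Fin n) (Fin n) (Module.End ℂ ((Fin r → Fin n) → H)) :=
  Matrix.of fun i j => siteOp H l (Matrix.of fun a b => RMatrix q n u v (i, a) (j, b))

/-- The nested monodromy matrix `D(u) R_{0,r}(u,t_r) ⋯ R_{0,1}(u,t_1)` acting in
`H ⊗ (ℂ^n)^{⊗ r}`, where `D(u)` is `T(u)` with its first row and first column removed. -/
def nestedMonodromy (q : ℂ) {n : ℕ} (T : OpMatrix (n + 1) H) (t : List ℂ) :
    OpMatrix n ((Fin t.length → Fin n) → H) := fun u =>
  (Matrix.of fun i j : Fin n => (T u i.succ j.succ).compLeft (Fin t.length → Fin n))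
    * ((List.ofFn fun l : Fin t.length => siteR q H l u (t.get l)).reverse).prod

/-- The vacuum eigenvalues of the nested monodromy matrix: `λ_2(u) f(u, t̄), λ_3(u), λ_4(u), …`. -/
def nestedEigen (q : ℂ) {n : ℕ} (lam : Fin (n + 2) → ℂ → ℂ) (t : List ℂ) :
    Fin (n + 1) → ℂ → ℂ := fun i u =>
  if i = 0 then lam 1 u * fProd q [u] t else lam i.succ u

/-- The pseudovacuum `|0⟩ ⊗ (e_1 ⊗ ⋯ ⊗ e_1)` of the nested monodromy matrix. -/
def nestedVac {n : ℕ} (r : ℕ) (v : H) : (Fin r → Fin (n + 1)) → H := Pi.single (fun _ => 0) v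

/-- The first member of a sequence of families of Bethe parameters (empty if there is none). -/
def headFamily : {n : ℕ} → (Fin n → List ℂ) → List ℂ
  | 0, _ => []
  | _ + 1, t => t 0

/-- The (off-shell) Bethe vector `𝔹(t̄ | T)` of a `U_q(gl_{N+1}^)` monodromy matrix `T` with
pseudovacuum `v` and vacuum eigenvalues `lam`, built by the nested algebraic Bethe ansatz:
`𝔹(t̄ | T) = (λ_2(t̄¹) f(t̄²,t̄¹))⁻¹ ∑_{k_1,…,k_r} T_{1,k_1}(t¹_1) ⋯ T_{1,k_r}(t¹_r) 𝔹'_{k_1,…,k_r}`,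
where `𝔹' ∈ H ⊗ (ℂ^N)^{⊗ r}` is the Bethe vector with parameters `t̄², …, t̄^N` of the nested
monodromy matrix. For `N = 0` it is the pseudovacuum. -/
def betheVector (q : ℂ) : (N : ℕ) → {H : Type u} → [AddCommGroup H] → [Module ℂ H] →
    OpMatrix (N + 1) H → (Fin (N + 1) → ℂ → ℂ) → H → (Fin N → List ℂ) → H
  | 0, _, _, _, _, _, v, _ => v
  | N + 1, _, _, _, T, lam, v, t =>
    (prodOver (lam 1) (t 0) * fProd q (headFamily fun ν : Fin N => t ν.succ) (t 0))⁻¹ •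
      ∑ k : Fin (t 0).length → Fin (N + 1),
        (List.ofFn fun l => T ((t 0).get l) 0 (k l).succ).prod
          (betheVector q N (nestedMonodromy q T (t 0)) (nestedEigen q lam (t 0))
            (nestedVac (t 0).length v) (fun ν => t ν.succ) k)

/-! ### Dual Bethe vectors -/

/-- The image of `T` under the antimorphism `Ψ : T_{ab}(u) ↦ T̃_{ba}(u⁻¹)`: the monodromy matrix
`T̃_{ab}(u) = (T_{ba}(u⁻¹))*` of a `U_{q⁻¹}` model acting in the dual space. -/
def psiMonodromy {m : ℕ} (T : OpMatrix m H) : OpMatrix m (Module.Dual ℂ H) := fun u =>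
  Matrix.of fun a b => Module.Dual.transpose (R := ℂ) (T u⁻¹ b a)

/-- The dual Bethe vector `ℂ_q(s̄ | T) = Ψ(𝔹_{q⁻¹}(s̄⁻¹))`, an element of the dual space. -/
def dualBetheVector (q : ℂ) {N : ℕ} (T : OpMatrix (N + 1) H) (lam : Fin (N + 1) → ℂ → ℂ)
    (w : Module.Dual ℂ H) (s : Fin N → List ℂ) : Module.Dual ℂ H :=
  betheVector q⁻¹ N (psiMonodromy T) (fun i u => lam i u⁻¹) w (fun ν => (s ν).map fun x => x⁻¹)

end Space

/-! ### Composite models -/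

/-- The total monodromy matrix `T(u) = T⁽²⁾(u) T⁽¹⁾(u)` acting in `H₁ ⊗ H₂`, that is
`T_{ij}(u) = ∑_k T⁽¹⁾_{kj}(u) ⊗ T⁽²⁾_{ik}(u)`. -/
def compositeMonodromy {H₁ H₂ : Type u} [AddCommGroup H₁] [Module ℂ H₁] [AddCommGroup H₂]
    [Module ℂ H₂] {m : ℕ} (T₁ : OpMatrix m H₁) (T₂ : OpMatrix m H₂) : OpMatrix m (H₁ ⊗[ℂ] H₂) :=
  fun u => (T₂ u).map (fun A => TensorProduct.map LinearMap.id A)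
    * (T₁ u).map (fun A => TensorProduct.map A LinearMap.id)

/-- The tensor product of two functionals, `(φ ⊗ ψ)(x ⊗ y) = φ(x) ψ(y)`. -/
def dualTensor {H₁ H₂ : Type u} [AddCommGroup H₁] [Module ℂ H₁] [AddCommGroup H₂]
    [Module ℂ H₂] (φ : Module.Dual ℂ H₁) (ψ : Module.Dual ℂ H₂) : Module.Dual ℂ (H₁ ⊗[ℂ] H₂) :=
  TensorProduct.dualDistrib ℂ H₁ H₂ (φ ⊗ₜ[ℂ] ψ)

/-- The subfamily of `s^ν` with positions in `I ν`, for every colour `ν`. -/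
def subFamily {N : ℕ} {r : Fin N → ℕ} (s : (ν : Fin N) → Fin (r ν) → ℂ)
    (I : (ν : Fin N) → Finset (Fin (r ν))) : Fin N → List ℂ := fun ν =>
  ((I ν).sort (· ≤ ·)).map (s ν)

/-- The coefficient of the term of the coproduct formula with subsets `s̄_i = si`, `s̄_ii = sii`:
`∏_{ν=1}^{N} α_ν(s̄^ν_ii) f(s̄^ν_i, s̄^ν_ii) / ∏_{ν=1}^{N-1} f(s̄^{ν+1}_i, s̄^ν_ii)`,
where `α_ν(u) = λ_ν(u) / λ_{ν+1}(u)`. -/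
def coproductCoeff (q : ℂ) {N : ℕ} (lam : Fin (N + 1) → ℂ → ℂ) (si sii : Fin N → List ℂ) : ℂ :=
  (∏ ν : Fin N,
      prodOver (fun u => lam ν.castSucc u / lam ν.succ u) (sii ν) * fProd q (si ν) (sii ν))
    / ∏ ν : Fin (N - 1), fProd q (si ⟨ν + 1, by omega⟩) (sii ⟨ν, by omega⟩)

end

end QAffine

/-! Transposition together with `u ↦ u⁻¹` turns dual Bethe vectors for `q` into ordinary ones for
`q⁻¹`. The transposed composite matrix is a product `S₁(u) S₂(u)` of two matrices whose entries
commute with each other and which both satisfy the exchange relation (`ExchRel.antihom`,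
`psiMonodromy_composite`). What remains is the coproduct formula for ordinary Bethe vectors,
`betheVector_bilinear`, proved by induction on the rank. It is stated for a bilinear map `μ` into
the space where `S₁`, `S₂` act: the dual of a tensor product need not be the tensor product of the
duals, and the nested spaces are function spaces on words of letters.

For the inductive step, the first-level creation operators form a matrix element of `W(S₁) W(S₂)`,
where `W(S)` applies `S(τ_a)` at each site `a` of a tensor power of `ℂ^{n+1}`, the outgoing word
being constantly `0`. Between the two factors one inserts the resolution of the identity `∑_I
merge_I P_I separate_I = 1` (`sum_merge_separate`), where `P_I` projects onto words whose nonzero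
letters sit exactly at `I`. The exchange relations carry the reorderings `merge_I` and `separate_I`
through `W(S₁)` and `W(S₂)`. At the sites in `I`, `S₁` then creates and `S₂` acts by its lower
block; at the others, `S₁` acts by its corner entry and `S₂` creates. This is the sum over
partitions of the first family (`creation_composite`).

The resolution of the identity comes from `separate_I merge_J` being the identity for `I = J` and
zero for `I ≠ J` between the relevant words. The first is triangularity; the second compares
eigenvalues of an operator built from the `R`-matrix alone, at a spectral parameter that makes one
eigenvalue vanish and not the other.

The reordering followed by the lower block of `S₂` at `I` intertwines the nested monodromy of the
composite model with the product of the nested monodromies of `S₁` (sites in `I`) and `S₂` (the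
other sites), which is again composite (`wordMonodromy_siteMonodromy`, `betheVector_intertwine`), so
the induction applies. The lower block of `S₁ S₂` is not the product of the lower blocks, but the
two agree on vectors killed by the first column of `S₁`. That property survives only at parameters
not used so far, so it is propagated by the parameter-tracking functoriality `betheVector_rel`.
Collecting the scalars is `coproductCoeff_step`. -/

namespace QAffine

noncomputable section

/-! ### The R-matrix in components and the Yang–Baxter equation -/

/-- The off-diagonal weight of the `R`-matrix. -/
def swapCoeff (q u v : ℂ) {n : ℕ} (i k : Fin n) : ℂ := gFun q u v * if i < k then u else v

theorem single_kronecker_single_apply {n : ℕ} (a b c d i j k l : Fin n) :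
    (Matrix.single a b (1 : ℂ) ⊗ₖ Matrix.single c d (1 : ℂ)) (i, k) (j, l)
      = if a = i ∧ b = j ∧ c = k ∧ d = l then 1 else 0 := by
  simp only [Matrix.kroneckerMap_apply, Matrix.single_apply]
  grind

theorem sum_Ioi_eq_of_unique {n : ℕ} (F : Fin n → Fin n → ℂ) (x y : Fin n)
    (h : ∀ a b, ¬ (a = x ∧ b = y) → F a b = 0) :
    ∑ a : Fin n, ∑ b ∈ Finset.Ioi a, F a b = if x < y then F x y else 0 := by
  rw [Finset.sum_eq_single x (fun a _ ha => Finset.sum_eq_zero fun b _ => h _ _ fun h => ha h.1)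
    (by simp)]
  split_ifs with hxy
  · exact Finset.sum_eq_single y (fun b _ hb => h _ _ fun h => hb h.2) (by simp [hxy])
  · refine Finset.sum_eq_zero fun b hb => h _ _ ?_
    rintro ⟨-, rfl⟩
    exact hxy (Finset.mem_Ioi.1 hb)

/-- Letter conservation: a nonzero entry either keeps the pair of letters or exchanges it. The
triangularity arguments below rest on this. -/
theorem RMatrix_apply (q : ℂ) {n : ℕ} (u v : ℂ) (i k j l : Fin n) :
    RMatrix q n u v (i, k) (j, l) =
      if i = k then (if j = i ∧ l = k then fFun q u v else 0)
      else if j = i ∧ l = k then 1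
      else if j = k ∧ l = i then swapCoeff q u v i k else 0 := by
  simp only [RMatrix, Matrix.add_apply, Matrix.smul_apply, Matrix.sum_apply, smul_eq_mul,
    Finset.sum_add_distrib, mul_add, single_kronecker_single_apply, swapCoeff]
  rw [Finset.sum_eq_single i (fun b _ hb => if_neg fun h => hb h.1) (by simp),
    sum_Ioi_eq_of_unique _ i k fun a b h => if_neg (by tauto),
    sum_Ioi_eq_of_unique _ k i fun a b h => if_neg (by tauto),
    sum_Ioi_eq_of_unique _ i k fun a b h => by rw [if_neg (by tauto)]; simp,
    sum_Ioi_eq_of_unique _ k i fun a b h => by rw [if_neg (by tauto)]; simp]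
  rcases lt_trichotomy i k with h | h | h
  · simp only [h, h.ne, h.ne', h.asymm, if_true, if_false, false_and, and_false]
    grind
  · subst h
    simp only [lt_irrefl, if_true, if_false]
    grind
  · simp only [h, h.ne, h.ne', h.asymm, if_true, if_false, false_and, and_false]
    grind

/-- The `R`-matrix acting on functions of two indices. -/
def exch (q u v : ℂ) {n : ℕ} {M : Type*} [AddCommGroup M] [Module ℂ M]
    (F : Fin n → Fin n → M) (i k : Fin n) : M :=
  if i = k then fFun q u v • F i k else F i k + swapCoeff q u v i k • F k i

/-- The Yang–Baxter equation. As `R` only permutes letters, with weights depending on their relative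
order, it reduces to one rational identity in each coefficient for every ordering of `i`, `j`, `k`.
Distinctness of the parameters keeps the denominators nonzero. -/
theorem exch_ybe {q : ℂ} (hq : q ≠ 0) {u v w : ℂ} (huv : u ≠ v) (huw : u ≠ w) (hvw : v ≠ w)
    {n : ℕ} {M : Type*} [AddCommGroup M] [Module ℂ M] (F : Fin n → Fin n → Fin n → M)
    (i j k : Fin n) :
    exch q u v (fun x y => exch q u w (fun x z => exch q v w (fun y z => F x y z) y z) x k) i j
      = exch q v w (fun y z => exch q u w (fun x z => exch q u v (fun x y => F x y z) x y) i z)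
          j k := by
  have h1 := sub_ne_zero.2 huv
  have h2 := sub_ne_zero.2 huw
  have h3 := sub_ne_zero.2 hvw
  have e : ∀ a b : Fin n, a < b → a ≠ b ∧ b ≠ a ∧ ¬ b < a := fun a b h =>
    ⟨h.ne, h.ne', h.asymm⟩
  rcases lt_trichotomy i j with hij | hij | hij <;> rcases lt_trichotomy j k with hjk | hjk | hjk <;>
  rcases lt_trichotomy i k with hik | hik | hik <;>
  first
  | (exfalso; omega)
  | (try subst hij
     try subst hjk
     try subst hik
     try have := e _ _ hij
     try have := e _ _ hjk
     try have := e _ _ hik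
     simp only [exch, swapCoeff, *, if_true, if_false, lt_irrefl]
     simp only [fFun, gFun]
     match_scalars <;> field_simp <;> ring)

section Exch

variable {M : Type*} [AddCommGroup M] [Module ℂ M] {M' : Type*} [AddCommGroup M'] [Module ℂ M']
  {n : ℕ}

theorem exch_eq_sum (q u v : ℂ) (F : Fin n → Fin n → M) (i k : Fin n) :
    exch q u v F i k = ∑ j, ∑ l, RMatrix q n u v (i, k) (j, l) • F j l := by
  rw [← Fintype.sum_prod_type' (f := fun j l => RMatrix q n u v (i, k) (j, l) • F j l)]
  by_cases h : i = k
  · subst h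
    rw [Finset.sum_eq_single (i, i)]
    · simp [exch, RMatrix_apply]
    · rintro ⟨j, l⟩ - hne
      rw [RMatrix_apply, if_pos rfl, if_neg fun h => hne (Prod.ext h.1 h.2), zero_smul]
    · simp
  · rw [← Finset.sum_subset (Finset.subset_univ {(i, k), (k, i)}), Finset.sum_pair]
    · simp [exch, RMatrix_apply, h, Ne.symm h]
    · simp [h]
    · rintro ⟨j, l⟩ - hne
      simp only [Finset.mem_insert, Finset.mem_singleton, Prod.mk.injEq, not_or] at hne
      rw [RMatrix_apply, if_neg h, if_neg hne.1, if_neg hne.2, zero_smul]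

theorem map_exch (L : M →ₗ[ℂ] M') (q u v : ℂ) (F : Fin n → Fin n → M) (i k : Fin n) :
    L (exch q u v F i k) = exch q u v (fun x y => L (F x y)) i k := by
  unfold exch
  split_ifs <;> simp

theorem exch_apply {X : Type*} (q u v : ℂ) (F : Fin n → Fin n → X → M) (i k : Fin n) (c : X) :
    exch q u v F i k c = exch q u v (fun x y => F x y c) i k := by
  unfold exch
  split_ifs <;> simp

theorem exch_sum {κ : Type*} (s : Finset κ) (q u v : ℂ) (F : κ → Fin n → Fin n → M) (i k : Fin n) :
    exch q u v (fun x y => ∑ a ∈ s, F a x y) i k = ∑ a ∈ s, exch q u v (F a) i k := by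
  unfold exch
  split_ifs <;> simp [Finset.smul_sum, Finset.sum_add_distrib]

end Exch

/-! ### Exchange relations between matrices of operators -/

section Pair

variable {H : Type*} [AddCommGroup H] [Module ℂ H] {n : ℕ}

/-- The exchange relation `R(u,v) A₁ B₂ = B₂ A₁ R(u,v)` for two matrices of operators. -/
def ExchRel (q u v : ℂ) (A B : Matrix (Fin n) (Fin n) (Module.End ℂ H)) : Prop :=
  ∀ (F : Fin n → Fin n → H) (i k : Fin n),
    exch q u v (fun x y => ∑ x', A x x' (∑ y', B y y' (F x' y'))) i k
      = ∑ y', B k y' (∑ x', A i x' (exch q u v F x' y'))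

theorem exchRel_iff_components (q u v : ℂ) (A B : Matrix (Fin n) (Fin n) (Module.End ℂ H)) :
    ExchRel q u v A B ↔ ∀ i k j l,
      ∑ x, ∑ y, RMatrix q n u v (i, k) (x, y) • (A x j * B y l)
        = ∑ x, ∑ y, RMatrix q n u v (x, y) (j, l) • (B k y * A i x) := by
  constructor
  · intro h i k j l
    ext w
    -- Testing on a delta function at `(j, l)` extracts a single component of the relation.
    have := h (fun x y => if x = j then if y = l then w else 0 else 0) i k
    simp only [exch_eq_sum, map_sum, apply_ite (A _ _), apply_ite (B _ _), map_zero, map_smul,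
      smul_ite, smul_zero, Finset.sum_ite_eq', Finset.mem_univ, if_true,
      Finset.sum_ite_irrel, Finset.sum_const_zero] at this
    simp only [LinearMap.sum_apply, LinearMap.smul_apply, Module.End.mul_apply]
    rw [this, Finset.sum_comm]
  · intro h F i k
    have key : ∀ j l, (∑ x, ∑ y, RMatrix q n u v (i, k) (x, y) • (A x j * B y l)) (F j l)
        = (∑ x, ∑ y, RMatrix q n u v (x, y) (j, l) • (B k y * A i x)) (F j l) := by
      intro j l
      rw [h]
    simp only [LinearMap.sum_apply, LinearMap.smul_apply, Module.End.mul_apply] at key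
    simp only [exch_eq_sum, map_sum, map_smul, Finset.smul_sum]
    calc _ = ∑ j, ∑ l, ∑ x, ∑ y, RMatrix q n u v (i, k) (x, y) • (A x j) ((B y l) (F j l)) := by
          rw [Finset.sum_congr rfl fun x _ => Finset.sum_comm, Finset.sum_comm]
          refine Finset.sum_congr rfl fun j _ => ?_
          rw [Finset.sum_congr rfl fun x _ => Finset.sum_comm, Finset.sum_comm]
      _ = ∑ j, ∑ l, ∑ y, ∑ x, RMatrix q n u v (x, y) (j, l) • (B k y) ((A i x) (F j l)) := by
          refine Finset.sum_congr rfl fun j _ => Finset.sum_congr rfl fun l _ => ?_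
          rw [key, Finset.sum_comm]
      _ = _ := by
          rw [Finset.sum_congr rfl fun j _ => Finset.sum_comm, Finset.sum_comm]
          refine Finset.sum_congr rfl fun y _ => ?_
          rw [Finset.sum_congr rfl fun j _ => Finset.sum_comm, Finset.sum_comm]

theorem kronecker_one_mul_one_kronecker {R : Type*} [Ring R] (A B : Matrix (Fin n) (Fin n) R)
    (i k j l : Fin n) :
    ((A ⊗ₖ (1 : Matrix (Fin n) (Fin n) R)) * ((1 : Matrix (Fin n) (Fin n) R) ⊗ₖ B)) (i, k) (j, l)
      = A i j * B k l := by
  simp [Matrix.mul_apply, Fintype.sum_prod_type, Matrix.one_apply, Finset.sum_ite_irrel]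

theorem one_kronecker_mul_kronecker_one {R : Type*} [Ring R] (A B : Matrix (Fin n) (Fin n) R)
    (i k j l : Fin n) :
    (((1 : Matrix (Fin n) (Fin n) R) ⊗ₖ B) * (A ⊗ₖ (1 : Matrix (Fin n) (Fin n) R))) (i, k) (j, l)
      = B k l * A i j := by
  simp [Matrix.mul_apply, Fintype.sum_prod_type, Matrix.one_apply, Finset.sum_ite_irrel]

theorem satisfiesRTT_iff (q : ℂ) (D : Set ℂ) (T : OpMatrix n H) :
    SatisfiesRTT q D T ↔ ∀ u ∈ D, ∀ v ∈ D, u ≠ v → ExchRel q u v (T u) (T v) := by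
  unfold SatisfiesRTT
  refine forall₅_congr fun u _ v _ _ => ?_
  rw [exchRel_iff_components, Matrix.mul_assoc, ← Matrix.ext_iff]
  simp only [Prod.forall]
  refine forall₄_congr fun i k j l => ?_
  rw [Matrix.mul_apply, Matrix.mul_apply, Fintype.sum_prod_type, Fintype.sum_prod_type]
  simp only [kronecker_one_mul_one_kronecker, one_kronecker_mul_kronecker_one, Matrix.map_apply,
    ← Algebra.smul_def, ← Algebra.commutes]

/-- The coproduct of the exchange algebra: the mixed commutations regroup `A A' B B'` as `(A B)(A'
B')`, after which `R` crosses the two pairs one at a time. -/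
theorem ExchRel.mul {q u v : ℂ} {A A' B B' : Matrix (Fin n) (Fin n) (Module.End ℂ H)}
    (h : ExchRel q u v A B) (h' : ExchRel q u v A' B')
    (hAB : ∀ i j k l, Commute (A' i j) (B k l)) (hAB' : ∀ i j k l, Commute (A i j) (B' k l)) :
    ExchRel q u v (A * A') (B * B') := by
  have hc : ∀ (P Q : Matrix (Fin n) (Fin n) (Module.End ℂ H)),
      (∀ i j k l, Commute (P i j) (Q k l)) → ∀ (F : Fin n → Fin n → H) i k,
      ∑ x, P i x (∑ y, Q k y (F x y)) = ∑ y, Q k y (∑ x, P i x (F x y)) := by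
    intro P Q hPQ F i k
    simp only [map_sum]
    rw [Finset.sum_comm]
    exact Finset.sum_congr rfl fun y _ => Finset.sum_congr rfl fun x _ =>
      LinearMap.congr_fun (hPQ i x k y) _
  have hm : ∀ (P Q : Matrix (Fin n) (Fin n) (Module.End ℂ H)) (F : Fin n → H) i,
      ∑ x, (P * Q) i x (F x) = ∑ y, P i y (∑ x, Q y x (F x)) := by
    intro P Q F i
    simp only [Matrix.mul_apply, LinearMap.sum_apply, Module.End.mul_apply, map_sum]
    rw [Finset.sum_comm]
  intro F i k
  calc _ = exch q u v (fun x y => ∑ x', A x x' (∑ y', B y y' (∑ x'', A' x' x''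
            (∑ y'', B' y' y'' (F x'' y''))))) i k := by
        congr 1
        funext x y
        rw [hm]
        refine Finset.sum_congr rfl fun x' _ => congrArg _ ?_
        simp only [hm]
        exact hc A' B hAB (fun x y => ∑ z, B' y z (F x z)) x' y
    _ = _ := by
        rw [h fun x' y' => ∑ x'', A' x' x'' (∑ y'', B' y' y'' (F x'' y'')), hm]
        refine Finset.sum_congr rfl fun y _ => congrArg _ ?_
        simp only [hm, h' F]
        exact hc A B' hAB' (fun x z => ∑ x', A' x x' (exch q u v F x' z)) i y

end Pair

/-! ### Operators on tensor powers with labelled sites -/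

section Words

open Function (update)

variable {ι : Type*} [DecidableEq ι] {n : ℕ} {H : Type*} [AddCommGroup H] [Module ℂ H]

/-- The matrix `R(u,v)` acting in the sites `a`, `b` of a tensor power of `ℂ^n`. -/
def braid (q : ℂ) (a b : ι) (u v : ℂ) : Module.End ℂ ((ι → Fin n) → H) where
  toFun φ c := exch q u v (fun x y => φ (update (update c a x) b y)) (c a) (c b)
  map_add' φ ψ := by
    funext c
    simp only [exch_eq_sum, Pi.add_apply, smul_add, Finset.sum_add_distrib]
  map_smul' r φ := by
    funext c
    simp only [exch_eq_sum, Pi.smul_apply, RingHom.id_apply, Finset.smul_sum, smul_comm r]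

theorem braid_apply (q : ℂ) (a b : ι) (u v : ℂ) (φ : (ι → Fin n) → H) (c : ι → Fin n) :
    braid q a b u v φ c
      = exch q u v (fun x y => φ (update (update c a x) b y)) (c a) (c b) := rfl

/-- A matrix with operator entries, acting in the site `a` of a tensor power of `ℂ^n`. -/
def siteAct (a : ι) (A : Matrix (Fin n) (Fin n) (Module.End ℂ H)) :
    Module.End ℂ ((ι → Fin n) → H) where
  toFun φ c := ∑ x, A (c a) x (φ (update c a x))
  map_add' φ ψ := by
    funext c
    simp [Finset.sum_add_distrib]
  map_smul' r φ := by
    funext c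
    simp [Finset.smul_sum]

theorem siteAct_apply (a : ι) (A : Matrix (Fin n) (Fin n) (Module.End ℂ H))
    (φ : (ι → Fin n) → H) (c : ι → Fin n) :
    siteAct a A φ c = ∑ x, A (c a) x (φ (update c a x)) := rfl

/-- The matrix `R_{0,a}(u,v)`: its entries in the auxiliary space `0` act in the site `a`. -/
def wordR (q : ℂ) (H : Type*) [AddCommGroup H] [Module ℂ H] (a : ι) (u v : ℂ) :
    Matrix (Fin n) (Fin n) (Module.End ℂ ((ι → Fin n) → H)) :=
  Matrix.of fun i j =>
    { toFun := fun φ c => ∑ x : Fin n, RMatrix q n u v (i, c a) (j, x) • φ (update c a x)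
      map_add' := fun φ ψ => by
        funext c
        simp [smul_add, Finset.sum_add_distrib]
      map_smul' := fun r φ => by
        funext c
        simp [Finset.smul_sum, smul_comm r] }

theorem wordR_apply (q : ℂ) (a : ι) (u v : ℂ) (i j : Fin n) (φ : (ι → Fin n) → H)
    (c : ι → Fin n) :
    wordR q H a u v i j φ c = ∑ x : Fin n, RMatrix q n u v (i, c a) (j, x) • φ (update c a x) :=
  rfl

theorem sum_wordR_apply (q : ℂ) (a : ι) (u v : ℂ) (Φ : Fin n → (ι → Fin n) → H) (i : Fin n)
    (c : ι → Fin n) :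
    (∑ j, wordR q H a u v i j (Φ j)) c
      = exch q u v (fun x y => Φ x (update c a y)) i (c a) := by
  simp only [Finset.sum_apply, wordR_apply, exch_eq_sum]

theorem matrix_end_ext {X : Type*} [AddCommGroup X] [Module ℂ X]
    {A B : Matrix (Fin n) (Fin n) (Module.End ℂ X)}
    (h : ∀ (Φ : Fin n → X) i, ∑ j, A i j (Φ j) = ∑ j, B i j (Φ j)) : A = B := by
  ext i j x
  simpa [Pi.single_apply, apply_ite] using h (Pi.single j x) i

theorem sum_mul_apply {X : Type*} [AddCommGroup X] [Module ℂ X]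
    (A B : Matrix (Fin n) (Fin n) (Module.End ℂ X)) (Φ : Fin n → X) (i : Fin n) :
    ∑ j, (A * B) i j (Φ j) = ∑ k, A i k (∑ j, B k j (Φ j)) := by
  simp only [Matrix.mul_apply, LinearMap.sum_apply, Module.End.mul_apply, map_sum]
  rw [Finset.sum_comm]

theorem sum_scalar_apply {X : Type*} [AddCommGroup X] [Module ℂ X]
    (P : Module.End ℂ X) (Φ : Fin n → X) (i : Fin n) :
    ∑ j, Matrix.scalar (Fin n) P i j (Φ j) = P (Φ i) := by
  rw [Finset.sum_eq_single i] <;> simp +contextual [eq_comm]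

theorem scalar_mul_comm {X : Type*} [AddCommGroup X] [Module ℂ X]
    (P : Module.End ℂ X) (A : Matrix (Fin n) (Fin n) (Module.End ℂ X))
    (h : ∀ i j, Commute P (A i j)) :
    Matrix.scalar (Fin n) P * A = A * Matrix.scalar (Fin n) P := by
  ext1 i j
  simpa using (h i j).eq

theorem scalar_mul_apply {X : Type*} [AddCommGroup X] [Module ℂ X]
    (P : Module.End ℂ X) (A : Matrix (Fin n) (Fin n) (Module.End ℂ X)) (i j : Fin n) :
    (Matrix.scalar (Fin n) P * A) i j = P * A i j := by
  simp

theorem mul_scalar_apply {X : Type*} [AddCommGroup X] [Module ℂ X]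
    (P : Module.End ℂ X) (A : Matrix (Fin n) (Fin n) (Module.End ℂ X)) (i j : Fin n) :
    (A * Matrix.scalar (Fin n) P) i j = A i j * P := by
  simp

/-- Yang–Baxter with one auxiliary space and two sites: it will permit reordering the sites of a
nested monodromy. -/
theorem braid_mul_wordR {q : ℂ} (hq : q ≠ 0) {a b : ι} (hab : a ≠ b) {u v w : ℂ} (huv : u ≠ v)
    (huw : u ≠ w) (hvw : v ≠ w) :
    Matrix.scalar (Fin n) (braid q a b v w) * (wordR q H b u w * wordR q H a u v)
      = wordR q H a u v * wordR q H b u w * Matrix.scalar (Fin n) (braid q a b v w) := by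
  refine matrix_end_ext fun Φ i => ?_
  funext c
  rw [Matrix.mul_assoc]
  simp only [sum_mul_apply, sum_scalar_apply]
  rw [braid_apply, sum_wordR_apply]
  simp only [sum_wordR_apply]
  have := exch_ybe hq huv huw hvw (fun x y z => Φ x (update (update c a y) b z)) i (c a) (c b)
  simp only [braid_apply, Function.update_self, Function.update_idem, Function.update_of_ne hab,
    Function.update_of_ne hab.symm, Function.update_comm hab.symm] at this ⊢
  exact this.symm

/-- Yang–Baxter with two auxiliary spaces and one site: the `R`-matrix is itself a model of the
exchange algebra. -/
theorem exchRel_wordR {q : ℂ} (hq : q ≠ 0) (a : ι) {u v w : ℂ} (huv : u ≠ v)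
    (huw : u ≠ w) (hvw : v ≠ w) :
    ExchRel q u v (wordR (n := n) q H a u w) (wordR q H a v w) := by
  intro F i k
  funext c
  rw [exch_apply]
  simp only [sum_wordR_apply, exch_apply, Function.update_idem, Function.update_self]
  exact exch_ybe hq huv huw hvw (fun x y z => F x y (update c a z)) i k (c a)

/-- The entrywise extension of a matrix of operators on `H` to functions with values in `H`. -/
def compLeftMatrix (κ : Type*) (A : Matrix (Fin n) (Fin n) (Module.End ℂ H)) :
    Matrix (Fin n) (Fin n) (Module.End ℂ (κ → H)) :=
  Matrix.of fun i j => (A i j).compLeft κ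

theorem compLeftMatrix_apply (κ : Type*) (A : Matrix (Fin n) (Fin n) (Module.End ℂ H)) (i j : Fin n)
    (φ : κ → H) (c : κ) : compLeftMatrix κ A i j φ c = A i j (φ c) := rfl

theorem compLeftMatrix_mul (κ : Type*) (A B : Matrix (Fin n) (Fin n) (Module.End ℂ H)) :
    compLeftMatrix κ (A * B) = compLeftMatrix κ A * compLeftMatrix κ B := by
  ext i j φ c
  simp only [compLeftMatrix_apply, Matrix.mul_apply, LinearMap.sum_apply, Finset.sum_apply,
    Module.End.mul_apply]

theorem ExchRel.compLeft {q u v : ℂ} {A B : Matrix (Fin n) (Fin n) (Module.End ℂ H)}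
    (h : ExchRel q u v A B) (κ : Type*) :
    ExchRel q u v (compLeftMatrix κ A) (compLeftMatrix κ B) := by
  intro F i k
  funext c
  rw [exch_apply]
  simp only [Finset.sum_apply, compLeftMatrix_apply, exch_apply]
  exact h (fun x y => F x y c) i k

/-- The exchange relation with its second tensor leg realised as the site `a` and its first as the
matrix index. -/
theorem siteAct_mul_wordR {q u v : ℂ} {A B : Matrix (Fin n) (Fin n) (Module.End ℂ H)}
    (h : ExchRel q u v A B) (a : ι) :
    Matrix.scalar (Fin n) (siteAct a B) * (compLeftMatrix _ A * wordR q H a u v)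
      = wordR q H a u v * (compLeftMatrix _ A * Matrix.scalar (Fin n) (siteAct a B)) := by
  refine matrix_end_ext fun Φ i => ?_
  funext c
  simp only [sum_mul_apply, sum_scalar_apply]
  rw [sum_wordR_apply, siteAct_apply]
  have := h (fun x y => Φ x (update c a y)) i (c a)
  simp only [Finset.sum_apply, compLeftMatrix_apply, siteAct_apply, Function.update_self,
    Function.update_idem] at this ⊢
  rw [this]
  refine Finset.sum_congr rfl fun x _ => congrArg _ (Finset.sum_congr rfl fun j _ => ?_)
  have := sum_wordR_apply q a u v Φ j (update c a x)
  rw [Finset.sum_apply] at this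
  rw [this]
  simp only [Function.update_self, Function.update_idem]

/-- The exchange relation with both tensor legs realised as sites. -/
theorem braid_siteAct {q u v : ℂ} {A B : Matrix (Fin n) (Fin n) (Module.End ℂ H)}
    (h : ExchRel q u v A B) {a b : ι} (hab : a ≠ b) :
    braid q a b u v * (siteAct a A * siteAct b B)
      = siteAct b B * siteAct a A * braid q a b u v := by
  ext1 φ
  funext c
  have := h (fun x y => φ (update (update c a x) b y)) (c a) (c b)
  simp only [Module.End.mul_apply, braid_apply, siteAct_apply, Function.update_self,
    Function.update_idem, Function.update_of_ne hab, Function.update_comm hab.symm] at this ⊢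
  exact this

theorem siteAct_comm {A B : Matrix (Fin n) (Fin n) (Module.End ℂ H)} {a b : ι} (hab : a ≠ b)
    (h : ∀ i j k l, Commute (A i j) (B k l)) : Commute (siteAct a A) (siteAct b B) := by
  ext1 φ
  funext c
  simp only [Module.End.mul_apply, siteAct_apply, map_sum, Function.update_of_ne hab,
    Function.update_of_ne hab.symm, Function.update_comm hab.symm]
  rw [Finset.sum_comm]
  exact Finset.sum_congr rfl fun x _ => Finset.sum_congr rfl fun y _ =>
    LinearMap.congr_fun (h _ _ _ _) _

theorem siteAct_mul (a : ι) (A B : Matrix (Fin n) (Fin n) (Module.End ℂ H)) :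
    siteAct a (A * B) = siteAct a A * siteAct a B := by
  ext1 φ
  funext c
  simp only [Module.End.mul_apply, siteAct_apply, sum_mul_apply, Function.update_self,
    Function.update_idem]

theorem braid_comm_siteAct (q u v : ℂ) (A : Matrix (Fin n) (Fin n) (Module.End ℂ H)) {a b d : ι}
    (hda : d ≠ a) (hdb : d ≠ b) : Commute (braid q a b u v) (siteAct d A) := by
  ext1 φ
  funext c
  simp only [Module.End.mul_apply, siteAct_apply, braid_apply, map_exch, ← exch_sum,
    Function.update_of_ne hda, Function.update_of_ne hdb, Function.update_of_ne hda.symm,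
    Function.update_of_ne hdb.symm]
  simp only [Function.update_comm hda, Function.update_comm hdb]

theorem wordR_comm_wordR (q u v u' v' : ℂ) {a b : ι} (hab : a ≠ b) (i j k l : Fin n) :
    Commute (wordR q H a u v i j) (wordR q H b u' v' k l) := by
  ext1 φ
  funext c
  simp only [Module.End.mul_apply, wordR_apply, Finset.smul_sum, Function.update_of_ne hab,
    Function.update_of_ne hab.symm, Function.update_comm hab.symm]
  rw [Finset.sum_comm]
  exact Finset.sum_congr rfl fun x _ => Finset.sum_congr rfl fun y _ => smul_comm _ _ _

theorem siteAct_comm_wordR (q u v : ℂ) (A : Matrix (Fin n) (Fin n) (Module.End ℂ H)) {a b : ι}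
    (hab : a ≠ b) (i j : Fin n) : Commute (siteAct a A) (wordR q H b u v i j) := by
  ext1 φ
  funext c
  simp only [Module.End.mul_apply, wordR_apply, siteAct_apply, Finset.smul_sum, map_sum, map_smul,
    Function.update_of_ne hab, Function.update_of_ne hab.symm, Function.update_comm hab.symm]
  rw [Finset.sum_comm]

theorem braid_comm_wordR (q u v u' v' : ℂ) {a b d : ι} (hda : d ≠ a) (hdb : d ≠ b)
    (i j : Fin n) : Commute (braid q a b u v) (wordR q H d u' v' i j) := by
  ext1 φ
  funext c
  simp only [Module.End.mul_apply, wordR_apply, braid_apply, exch_eq_sum, Finset.smul_sum,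
    Function.update_of_ne hda, Function.update_of_ne hdb, Function.update_of_ne hda.symm,
    Function.update_of_ne hdb.symm, smul_smul]
  simp only [Function.update_comm hda, Function.update_comm hdb]
  rw [Finset.sum_congr rfl fun x _ => Finset.sum_comm, Finset.sum_comm]
  simp only [mul_comm]

theorem compLeft_comm_wordR (q u v : ℂ) (P : Module.End ℂ H) (a : ι) (i j : Fin n) :
    Commute (P.compLeft (ι → Fin n)) (wordR q H a u v i j) := by
  ext1 φ
  funext c
  simp [wordR_apply]

theorem compLeft_comm_braid (q u v : ℂ) (P : Module.End ℂ H) (a b : ι) :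
    Commute (P.compLeft (ι → Fin n)) (braid q a b u v) := by
  ext1 φ
  funext c
  simp [braid_apply, map_exch]

theorem compLeft_comm_siteAct (P : Module.End ℂ H) (a : ι)
    (A : Matrix (Fin n) (Fin n) (Module.End ℂ H)) (h : ∀ i j, Commute P (A i j)) :
    Commute (P.compLeft (ι → Fin n)) (siteAct a A) := by
  ext1 φ
  funext c
  simp only [Module.End.mul_apply, siteAct_apply, LinearMap.compLeft_apply, Function.comp, map_sum]
  exact Finset.sum_congr rfl fun x _ => LinearMap.congr_fun (h _ _) _

end Words

/-! ### Reordering labels by products of braidings -/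

section Transport

variable {ι : Type*} [DecidableEq ι] {G : Type*} [Monoid G]

/-- The product of braidings moving the label `a` to the right of all labels of a list. -/
def moveRight (br : ι → ι → G) (a : ι) : List ι → G
  | [] => 1
  | j :: js => moveRight br a js * br a j

/-- The product of braidings moving the label `a` to the left of all labels of a list. -/
def moveLeft (br : ι → ι → G) (a : ι) : List ι → G
  | [] => 1
  | i :: is => br i a * moveLeft br a is

/-- The sublist of labels belonging to `I`. -/
def inside (I : Finset ι) (L : List ι) : List ι := L.filter (· ∈ I)

/-- The sublist of labels not belonging to `I`. -/
def outside (I : Finset ι) (L : List ι) : List ι := L.filter (· ∉ I)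

/-- The product of braidings from the order `L` to the order `(outside I L, inside I L)`. -/
def separate (br : ι → ι → G) (I : Finset ι) : List ι → G
  | [] => 1
  | a :: L => if a ∈ I then moveRight br a (outside I L) * separate br I L else separate br I L

/-- The product of braidings from the order `(inside I L, outside I L)` to the order `L`. -/
def merge (br : ι → ι → G) (I : Finset ι) : List ι → G
  | [] => 1
  | a :: L => if a ∈ I then merge br I L else merge br I L * moveLeft br a (inside I L)

theorem inside_cons (I : Finset ι) (a : ι) (L : List ι) :
    inside I (a :: L) = if a ∈ I then a :: inside I L else inside I L := by
  simp [inside, List.filter_cons]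

theorem outside_cons (I : Finset ι) (a : ι) (L : List ι) :
    outside I (a :: L) = if a ∈ I then outside I L else a :: outside I L := by
  by_cases h : a ∈ I <;> simp [outside, h]

theorem mem_inside {I : Finset ι} {L : List ι} {a : ι} : a ∈ inside I L ↔ a ∈ L ∧ a ∈ I := by
  simp [inside]

theorem mem_outside {I : Finset ι} {L : List ι} {a : ι} : a ∈ outside I L ↔ a ∈ L ∧ a ∉ I := by
  simp [outside]

theorem perm_outside_append_inside (I : Finset ι) (L : List ι) :
    (outside I L ++ inside I L).Perm L := by
  induction L with
  | nil => simp [inside, outside]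
  | cons a L ih =>
    rw [inside_cons, outside_cons]
    split_ifs
    · exact List.perm_middle.trans (ih.cons a)
    · exact ih.cons a

theorem perm_inside_append_outside (I : Finset ι) (L : List ι) :
    (inside I L ++ outside I L).Perm L :=
  List.perm_append_comm.trans (perm_outside_append_inside I L)

/-- A family of elements indexed by orders, in which the braidings exchange adjacent labels. -/
def SwapLaw (br : ι → ι → G) (Q : List ι → G) : Prop :=
  ∀ l₁ a b l₂, (l₁ ++ a :: b :: l₂).Nodup →
    br a b * Q (l₁ ++ a :: b :: l₂) = Q (l₁ ++ b :: a :: l₂) * br a b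

theorem SwapLaw.moveRight {br : ι → ι → G} {Q : List ι → G} (h : SwapLaw br Q) (a : ι)
    (js l₁ l₂ : List ι) (hn : (l₁ ++ a :: (js ++ l₂)).Nodup) :
    moveRight br a js * Q (l₁ ++ a :: (js ++ l₂))
      = Q (l₁ ++ js ++ a :: l₂) * moveRight br a js := by
  induction js generalizing l₁ with
  | nil => simp [QAffine.moveRight]
  | cons j js ih =>
    have hn' : ((l₁ ++ [j]) ++ a :: (js ++ l₂)).Nodup := by
      refine (List.Perm.nodup_iff ?_).1 hn
      simpa using (List.Perm.swap _ _ _).append_left l₁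
    have := ih (l₁ ++ [j]) hn'
    simp only [List.append_assoc, List.cons_append, List.nil_append] at this hn ⊢
    rw [QAffine.moveRight, mul_assoc, h _ _ _ _ hn, ← mul_assoc, this, mul_assoc]

theorem SwapLaw.moveLeft {br : ι → ι → G} {Q : List ι → G} (h : SwapLaw br Q) (a : ι)
    (is l₁ l₂ : List ι) (hn : (l₁ ++ a :: (is ++ l₂)).Nodup) :
    moveLeft br a is * Q (l₁ ++ is ++ a :: l₂)
      = Q (l₁ ++ a :: (is ++ l₂)) * moveLeft br a is := by
  induction is generalizing l₁ with
  | nil => simp [QAffine.moveLeft]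
  | cons i is ih =>
    have hn' : ((l₁ ++ [i]) ++ a :: (is ++ l₂)).Nodup := by
      refine (List.Perm.nodup_iff ?_).1 hn
      simpa using (List.Perm.swap _ _ _).append_left l₁
    have := ih (l₁ ++ [i]) hn'
    simp only [List.append_assoc, List.cons_append, List.nil_append] at this hn hn' ⊢
    rw [QAffine.moveLeft, mul_assoc, this, ← mul_assoc, h _ _ _ _ hn', mul_assoc]

theorem SwapLaw.separate {br : ι → ι → G} {Q : List ι → G} (h : SwapLaw br Q) (I : Finset ι)
    (L l₁ : List ι) (hn : (l₁ ++ L).Nodup) :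
    separate br I L * Q (l₁ ++ L) = Q (l₁ ++ (outside I L ++ inside I L)) * separate br I L := by
  induction L generalizing l₁ with
  | nil => simp [QAffine.separate, inside, outside]
  | cons a L ih =>
    have := ih (l₁ ++ [a]) (by simpa using hn)
    simp only [List.append_assoc, List.singleton_append] at this
    rw [QAffine.separate, inside_cons, outside_cons]
    split_ifs with ha
    · have hn' : (l₁ ++ a :: (outside I L ++ inside I L)).Nodup :=
        ((((perm_outside_append_inside I L).cons a).append_left l₁).nodup_iff).2 hn
      rw [mul_assoc, this, ← mul_assoc, h.moveRight a _ _ _ hn', mul_assoc, List.append_assoc]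
    · exact this

theorem SwapLaw.merge {br : ι → ι → G} {Q : List ι → G} (h : SwapLaw br Q) (I : Finset ι)
    (L l₁ : List ι) (hn : (l₁ ++ L).Nodup) :
    merge br I L * Q (l₁ ++ (inside I L ++ outside I L)) = Q (l₁ ++ L) * merge br I L := by
  induction L generalizing l₁ with
  | nil => simp [QAffine.merge, inside, outside]
  | cons a L ih =>
    have := ih (l₁ ++ [a]) (by simpa using hn)
    simp only [List.append_assoc, List.singleton_append] at this
    rw [QAffine.merge, inside_cons, outside_cons]
    split_ifs with ha
    · exact this
    · have hn' : (l₁ ++ a :: (inside I L ++ outside I L)).Nodup :=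
        ((((perm_inside_append_outside I L).cons a).append_left l₁).nodup_iff).2 hn
      have h2 := h.moveLeft a _ _ _ hn'
      rw [List.append_assoc] at h2
      rw [mul_assoc, h2, ← mul_assoc, this, mul_assoc]

theorem swapLaw_prod {br : ι → ι → G} {Op : ι → G}
    (h : ∀ a b, a ≠ b → br a b * (Op a * Op b) = Op b * Op a * br a b)
    (hc : ∀ a b d, d ≠ a → d ≠ b → Commute (br a b) (Op d)) :
    SwapLaw br fun L => (L.map Op).prod := by
  have hl : ∀ a b (l : List ι), a ∉ l → b ∉ l → Commute (br a b) (l.map Op).prod := by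
    intro a b l ha hb
    refine Commute.list_prod_right _ _ fun x hx => ?_
    obtain ⟨d, hd, rfl⟩ := List.mem_map.1 hx
    exact hc a b d (fun e => ha (e ▸ hd)) (fun e => hb (e ▸ hd))
  intro l₁ a b l₂ hn
  rw [List.nodup_append] at hn
  obtain ⟨-, h2, h3⟩ := hn
  simp only [List.nodup_cons, List.mem_cons, not_or] at h2
  simp only [List.map_append, List.map_cons, List.prod_append, List.prod_cons]
  have e1 := hl a b l₁ (fun ha => h3 a ha a (by simp) rfl) (fun hb => h3 b hb b (by simp) rfl)
  have e2 := hl a b l₂ h2.1.2 h2.2.1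
  rw [← mul_assoc, e1.eq, mul_assoc, mul_assoc]
  congr 1
  rw [← mul_assoc (Op a), ← mul_assoc (br a b), h a b h2.1.1, mul_assoc, e2.eq]
  simp only [mul_assoc]

/-- The form needed for chains `R_{0,r} ⋯ R_{0,1}`, whose factors stand in the order opposite to
that of the sites. -/
theorem swapLaw_reverse_prod {br : ι → ι → G} {Op : ι → G}
    (h : ∀ a b, a ≠ b → br a b * (Op b * Op a) = Op a * Op b * br a b)
    (hc : ∀ a b d, d ≠ a → d ≠ b → Commute (br a b) (Op d)) :
    SwapLaw br fun L => ((L.map Op).reverse).prod := by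
  have hl : ∀ a b (l : List ι), a ∉ l → b ∉ l → Commute (br a b) (l.map Op).reverse.prod := by
    intro a b l ha hb
    refine Commute.list_prod_right _ _ fun x hx => ?_
    obtain ⟨d, hd, rfl⟩ := List.mem_map.1 (List.mem_reverse.1 hx)
    exact hc a b d (fun e => ha (e ▸ hd)) (fun e => hb (e ▸ hd))
  intro l₁ a b l₂ hn
  rw [List.nodup_append] at hn
  obtain ⟨-, h2, h3⟩ := hn
  simp only [List.nodup_cons, List.mem_cons, not_or] at h2
  simp only [List.map_append, List.map_cons, List.reverse_append, List.reverse_cons,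
    List.prod_append, List.prod_cons, List.prod_nil, mul_one]
  have e1 := hl a b l₁ (fun ha => h3 a ha a (by simp) rfl) (fun hb => h3 b hb b (by simp) rfl)
  have e2 := hl a b l₂ h2.1.2 h2.2.1
  rw [← mul_assoc, mul_assoc _ (Op b), ← mul_assoc (br a b), e2.eq, mul_assoc _ (br a b),
    h a b h2.1.1, mul_assoc, mul_assoc, mul_assoc, e1.eq]
  simp only [mul_assoc]

theorem map_moveRight {G' : Type*} [Monoid G'] (F : G →* G') (br : ι → ι → G) (a : ι)
    (L : List ι) : F (moveRight br a L) = moveRight (fun i j => F (br i j)) a L := by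
  induction L <;> simp [moveRight, *]

theorem map_separate {G' : Type*} [Monoid G'] (F : G →* G') (br : ι → ι → G) (I : Finset ι)
    (L : List ι) : F (separate br I L) = separate (fun i j => F (br i j)) I L := by
  induction L with
  | nil => simp [separate]
  | cons a L ih =>
    simp only [separate]
    split_ifs <;> simp [ih, map_moveRight]

/-- A property of the braidings stable under products holds for their products along a list. -/
theorem separate_induction {p : G → Prop} (h1 : p 1) (hm : ∀ x y, p x → p y → p (x * y))
    {br : ι → ι → G} (I : Finset ι) (L : List ι) (hL : L.Nodup)
    (h : ∀ a ∈ L, ∀ b ∈ L, a ≠ b → p (br a b)) : p (separate br I L) := by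
  have hr : ∀ a ∈ L, ∀ l : List ι, a ∉ l → (∀ x ∈ l, x ∈ L) → p (moveRight br a l) := by
    intro a ha l
    induction l with
    | nil => exact fun _ _ => h1
    | cons j js ih =>
      intro hn hs
      simp only [List.mem_cons, not_or] at hn
      exact hm _ _ (ih hn.2 fun x hx => hs x (by simp [hx])) (h _ ha _ (hs j (by simp)) hn.1)
  have key : ∀ l : List ι, l.Nodup → (∀ x ∈ l, x ∈ L) → p (separate br I l) := by
    intro l
    induction l with
    | nil => exact fun _ _ => h1
    | cons a l ih =>
      intro hn hs
      rw [List.nodup_cons] at hn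
      have := ih hn.2 fun x hx => hs x (by simp [hx])
      rw [separate]
      split_ifs
      · exact hm _ _ (hr a (hs a (by simp)) _ (fun h => hn.1 (mem_outside.1 h).1)
          fun x hx => hs x (by simp [(mem_outside.1 hx).1])) this
      · exact this
  exact key L hL fun _ h => h

theorem merge_induction {p : G → Prop} (h1 : p 1) (hm : ∀ x y, p x → p y → p (x * y))
    {br : ι → ι → G} (I : Finset ι) (L : List ι) (hL : L.Nodup)
    (h : ∀ a ∈ L, ∀ b ∈ L, a ≠ b → p (br a b)) : p (merge br I L) := by
  have hr : ∀ a ∈ L, ∀ l : List ι, a ∉ l → (∀ x ∈ l, x ∈ L) → p (moveLeft br a l) := by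
    intro a ha l
    induction l with
    | nil => exact fun _ _ => h1
    | cons j js ih =>
      intro hn hs
      simp only [List.mem_cons, not_or] at hn
      exact hm _ _ (h _ (hs j (by simp)) _ ha (Ne.symm hn.1))
        (ih hn.2 fun x hx => hs x (by simp [hx]))
  have key : ∀ l : List ι, l.Nodup → (∀ x ∈ l, x ∈ L) → p (merge br I l) := by
    intro l
    induction l with
    | nil => exact fun _ _ => h1
    | cons a l ih =>
      intro hn hs
      rw [List.nodup_cons] at hn
      have := ih hn.2 fun x hx => hs x (by simp [hx])
      rw [merge]
      split_ifs
      · exact this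
      · exact hm _ _ this (hr a (hs a (by simp)) _ (fun h => hn.1 (mem_inside.1 h).1)
          fun x hx => hs x (by simp [(mem_inside.1 hx).1]))
  exact key L hL fun _ h => h

theorem moveRight_append_singleton (br : ι → ι → G) (a j : ι) (L : List ι) :
    moveRight br a (L ++ [j]) = br a j * moveRight br a L := by
  induction L with
  | nil => simp [moveRight]
  | cons i L ih => simp only [List.cons_append, moveRight, ih, mul_assoc]

theorem moveRight_eq_prod {G : Type*} [CommMonoid G] (F : ι → ι → G) (a : ι) (L : List ι) :
    moveRight F a L = (L.map fun j => F a j).prod := by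
  induction L with
  | nil => simp [moveRight]
  | cons i L ih => simp [moveRight, ih, mul_comm]

theorem moveLeft_eq_prod {G : Type*} [CommMonoid G] (F : ι → ι → G) (a : ι) (L : List ι) :
    moveLeft F a L = (L.map fun i => F i a).prod := by
  induction L with
  | nil => simp [moveLeft]
  | cons i L ih => simp [moveLeft, ih]

/-- A pair `i ∈ I`, `j ∉ I` is braided exactly once: by `separate` if `i` precedes `j` in `L`, by
`merge` otherwise, and always with `i` as first argument. This is the origin of the factor `f(s̄_i,
s̄_ii)`. -/
theorem merge_mul_separate {G : Type*} [CommMonoid G] (F : ι → ι → G) (I : Finset ι)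
    (L : List ι) :
    merge F I L * separate F I L
      = ((inside I L).map fun i => ((outside I L).map fun j => F i j).prod).prod := by
  induction L with
  | nil => simp [merge, separate, inside]
  | cons a L ih =>
    rw [merge, separate, inside_cons, outside_cons]
    split_ifs
    · rw [List.map_cons, List.prod_cons, ← ih, moveRight_eq_prod, mul_left_comm]
    · simp only [List.map_cons, List.prod_cons, List.prod_map_mul]
      rw [← ih, moveLeft_eq_prod, mul_right_comm, mul_comm]

end Transport

/-! ### Triangularity of the reorderings, and the tautological model -/

section Completeness

open Function (update)

variable {ι : Type*} [DecidableEq ι] {n : ℕ} {M : Type*} [AddCommGroup M] [Module ℂ M]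
  {M' : Type*} [AddCommGroup M'] [Module ℂ M']

/-- The braidings of sites carrying the spectral parameters `τ`. -/
abbrev braids (q : ℂ) (n : ℕ) (M : Type*) [AddCommGroup M] [Module ℂ M] (τ : ι → ℂ) (a b : ι) :
    Module.End ℂ ((ι → Fin n) → M) :=
  braid q a b (τ a) (τ b)

theorem braid_apply_of_eq (q : ℂ) (a b : ι) (u v : ℂ) (φ : (ι → Fin n) → M) {c : ι → Fin n}
    (h : c a = c b) : braid q a b u v φ c = fFun q u v • φ c := by
  rw [braid_apply, exch, if_pos h, Function.update_eq_self, Function.update_eq_self]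

theorem braid_apply_of_ne (q : ℂ) (a b : ι) (u v : ℂ) (φ : (ι → Fin n) → M) {c : ι → Fin n}
    (h : c a ≠ c b) : braid q a b u v φ c = φ c
      + swapCoeff q u v (c a) (c b) • φ (update (update c a (c b)) b (c a)) := by
  rw [braid_apply, exch, if_neg h, Function.update_eq_self, Function.update_eq_self]

theorem braid_map (L : M →ₗ[ℂ] M') (q : ℂ) (a b : ι) (u v : ℂ) (φ : (ι → Fin n) → M) :
    braid q a b u v (fun c => L (φ c)) = fun c => L (braid q a b u v φ c) := by
  funext c
  rw [braid_apply, braid_apply, map_exch]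

theorem separate_map (L : M →ₗ[ℂ] M') (q : ℂ) (τ : ι → ℂ) (I : Finset ι) (l : List ι)
    (φ : (ι → Fin n) → M) :
    separate (braids q n M' τ) I l (fun c => L (φ c))
      = fun c => L (separate (braids q n M τ) I l φ c) := by
  have hm : ∀ a (l : List ι) (φ : (ι → Fin n) → M),
      moveRight (braids q n M' τ) a l (fun c => L (φ c))
        = fun c => L (moveRight (braids q n M τ) a l φ c) := by
    intro a l
    induction l with
    | nil => exact fun _ => rfl
    | cons j l ih =>
      intro φ
      simp only [moveRight, Module.End.mul_apply]
      rw [braid_map, ih]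
  induction l generalizing φ with
  | nil => rfl
  | cons a l ih =>
    simp only [separate]
    split_ifs
    · rw [Module.End.mul_apply, Module.End.mul_apply, ih, hm]
    · exact ih φ

theorem merge_map (L : M →ₗ[ℂ] M') (q : ℂ) (τ : ι → ℂ) (I : Finset ι) (l : List ι)
    (φ : (ι → Fin n) → M) :
    merge (braids q n M' τ) I l (fun c => L (φ c))
      = fun c => L (merge (braids q n M τ) I l φ c) := by
  have hm : ∀ a (l : List ι) (φ : (ι → Fin n) → M),
      moveLeft (braids q n M' τ) a l (fun c => L (φ c))
        = fun c => L (moveLeft (braids q n M τ) a l φ c) := by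
    intro a l
    induction l with
    | nil => exact fun _ => rfl
    | cons j l ih =>
      intro φ
      simp only [moveLeft, Module.End.mul_apply]
      rw [ih, braid_map]
  induction l generalizing φ with
  | nil => rfl
  | cons a l ih =>
    simp only [merge]
    split_ifs
    · exact ih φ
    · rw [Module.End.mul_apply, Module.End.mul_apply, hm, ih]

/-- `φ` vanishes on all words whose letter at `a` is `0`. -/
def VanishZero (a : ι) (φ : (ι → Fin (n + 1)) → M) : Prop := ∀ c, c a = 0 → φ c = 0

theorem VanishZero.braid {d a b : ι} {φ : (ι → Fin (n + 1)) → M} (h : VanishZero d φ)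
    (ha : d ≠ a) (hb : d ≠ b) (q u v : ℂ) : VanishZero d (braid q a b u v φ) := by
  intro c hc
  have : ∀ x y, φ (update (update c a x) b y) = 0 := fun x y => h _ (by simp [ha, hb, hc])
  simp only [braid_apply, exch, this, smul_zero, add_zero, ite_self]

theorem VanishZero.separate {d : ι} {φ : (ι → Fin (n + 1)) → M} (h : VanishZero d φ) (q : ℂ)
    (τ : ι → ℂ) (I : Finset ι) {l : List ι} (hl : l.Nodup) (hd : d ∉ l) :
    VanishZero d (separate (braids q (n + 1) M τ) I l φ) := by
  refine separate_induction (p := fun X : Module.End ℂ ((ι → Fin (n + 1)) → M) =>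
    ∀ φ, VanishZero d φ → VanishZero d (X φ)) (fun _ h => h) (fun _ _ hx hy φ h => hx _ (hy _ h))
    I l hl ?_ φ h
  intro a ha b hb _ φ h
  exact h.braid (fun e => hd (e ▸ ha)) (fun e => hd (e ▸ hb)) _ _ _

theorem VanishZero.merge {d : ι} {φ : (ι → Fin (n + 1)) → M} (h : VanishZero d φ) (q : ℂ)
    (τ : ι → ℂ) (I : Finset ι) {l : List ι} (hl : l.Nodup) (hd : d ∉ l) :
    VanishZero d (merge (braids q (n + 1) M τ) I l φ) := by
  refine merge_induction (p := fun X : Module.End ℂ ((ι → Fin (n + 1)) → M) =>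
    ∀ φ, VanishZero d φ → VanishZero d (X φ)) (fun _ h => h) (fun _ _ hx hy φ h => hx _ (hy _ h))
    I l hl ?_ φ h
  intro a ha b hb _ φ h
  exact h.braid (fun e => hd (e ▸ ha)) (fun e => hd (e ▸ hb)) _ _ _

theorem VanishZero.moveLeft {d a : ι} {φ : (ι → Fin (n + 1)) → M} (h : VanishZero d φ) (q : ℂ)
    (τ : ι → ℂ) {l : List ι} (ha : d ≠ a) (hd : d ∉ l) :
    VanishZero d (moveLeft (braids q (n + 1) M τ) a l φ) := by
  induction l with
  | nil => exact h
  | cons j l ih =>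
    simp only [List.mem_cons, not_or] at hd
    exact (ih hd.2).braid hd.1 ha _ _ _

theorem moveRight_apply_of_zero (q : ℂ) (τ : ι → ℂ) {a : ι} {l : List ι}
    {φ : (ι → Fin (n + 1)) → M} (hφ : VanishZero a φ) {c : ι → Fin (n + 1)} (hca : c a = 0)
    (hc : ∀ j ∈ l, c j = 0) : moveRight (braids q (n + 1) M τ) a l φ c = 0 := by
  induction l using List.reverseRecOn with
  | nil => exact hφ c hca
  | append_singleton l j ih =>
    rw [moveRight_append_singleton, Module.End.mul_apply, braid_apply_of_eq, ih, smul_zero]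
    · exact fun i hi => hc i (by simp [hi])
    · rw [hca, hc j (by simp)]

/-- Each exchange term would carry a letter `0` to the site `a`, and such terms vanish by
`moveRight_apply_of_zero`. -/
theorem moveRight_apply (q : ℂ) (τ : ι → ℂ) {a : ι} {l : List ι} (ha : a ∉ l) (hl : l.Nodup)
    {φ : (ι → Fin (n + 1)) → M} (hφ : VanishZero a φ) {c : ι → Fin (n + 1)} (hca : c a ≠ 0)
    (hc : ∀ j ∈ l, c j = 0) : moveRight (braids q (n + 1) M τ) a l φ c = φ c := by
  induction l using List.reverseRecOn with
  | nil => rfl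
  | append_singleton l j ih =>
    simp only [List.mem_append, List.mem_singleton, not_or] at ha
    have hj : c j = 0 := hc j (by simp)
    have hjl : j ∉ l := by
      rw [List.nodup_append] at hl
      exact fun h => hl.2.2 j h j (by simp) rfl
    rw [moveRight_append_singleton, Module.End.mul_apply, braid_apply_of_ne _ _ _ _ _ _ (by rwa [hj]),
      ih ha.1 (hl.sublist (by simp)) fun i hi => hc i (by simp [hi]), moveRight_apply_of_zero q τ hφ,
      smul_zero, add_zero]
    · rw [Function.update_of_ne ha.2, Function.update_self, hj]
    · intro i hi
      rw [Function.update_of_ne (ne_of_mem_of_not_mem hi hjl),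
        Function.update_of_ne (ne_of_mem_of_not_mem hi ha.1)]
      exact hc i (by simp [hi])

/-- The letter `0` at `a` could only be exchanged with the letter of some `i ∈ l`; that evaluates a
function vanishing when the letter at `i` is `0`. -/
theorem moveLeft_apply (q : ℂ) (τ : ι → ℂ) {a : ι} {l : List ι} (ha : a ∉ l) (hl : l.Nodup)
    {φ : (ι → Fin (n + 1)) → M} (hφ : ∀ i ∈ l, VanishZero i φ) {c : ι → Fin (n + 1)}
    (hca : c a = 0) : moveLeft (braids q (n + 1) M τ) a l φ c = φ c := by
  induction l with
  | nil => rfl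
  | cons i l ih =>
    simp only [List.mem_cons, not_or] at ha
    rw [List.nodup_cons] at hl
    have hv := (hφ i (by simp)).moveLeft q τ (Ne.symm ha.1) hl.1
    rw [moveLeft, Module.End.mul_apply]
    by_cases hi : c i = 0
    · rw [braid_apply_of_eq _ _ _ _ _ _ (hi.trans hca.symm), hv c hi, smul_zero, hφ i (by simp) c hi]
    · rw [braid_apply_of_ne _ _ _ _ _ _ (by rwa [hca]), ih ha.2 hl.2 fun j hj => hφ j (by simp [hj]),
        hv, smul_zero, add_zero]
      rw [Function.update_of_ne (Ne.symm ha.1), Function.update_self, hca]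

/-- The diagonal blocks of the resolution of the identity. By triangularity, no exchange term
contributes when the nonzero letters sit exactly at `I` on both sides. -/
theorem separate_merge_apply (q : ℂ) (τ : ι → ℂ) (I : Finset ι) {l : List ι} (hl : l.Nodup)
    {φ : (ι → Fin (n + 1)) → M} (hφ : ∀ i ∈ l, i ∈ I → VanishZero i φ) {c : ι → Fin (n + 1)}
    (hc : ∀ i ∈ l, (c i = 0 ↔ i ∉ I)) :
    separate (braids q (n + 1) M τ) I l (merge (braids q (n + 1) M τ) I l φ) c = φ c := by
  induction l generalizing φ with
  | nil => rfl
  | cons a l ih =>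
    rw [List.nodup_cons] at hl
    have ih' := fun φ hφ => ih (φ := φ) hl.2 hφ fun i hi => hc i (by simp [hi])
    rw [separate, merge]
    split_ifs with ha
    · rw [Module.End.mul_apply, moveRight_apply q τ (fun h => hl.1 (mem_outside.1 h).1)
        (hl.2.filter _), ih' _ fun i hi => hφ i (by simp [hi])]
      · exact ((hφ a (by simp) ha).merge q τ I hl.2 hl.1).separate q τ I hl.2 hl.1
      · exact fun h => (hc a (by simp)).1 h ha
      · exact fun j hj => (hc j (by simp [(mem_outside.1 hj).1])).2 (mem_outside.1 hj).2
    · rw [Module.End.mul_apply]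
      set φ' := moveLeft (braids q (n + 1) M τ) a (inside I l) φ with hφ'
      have hca : c a = 0 := (hc a (by simp)).2 ha
      -- Moving `a` to the left changes `φ` only at words with a nonzero letter at `a`. The
      -- remaining braidings leave the site `a` alone, so the change is invisible at `c`.
      have hv : VanishZero a (φ' - φ) := by
        intro d hd
        rw [Pi.sub_apply, hφ', moveLeft_apply q τ (fun h => hl.1 (mem_inside.1 h).1)
          (hl.2.filter _) _ hd, sub_self]
        exact fun i hi => hφ i (by simp [(mem_inside.1 hi).1]) (mem_inside.1 hi).2
      have : φ' = φ + (φ' - φ) := by abel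
      rw [this, map_add, map_add, Pi.add_apply, ih' _ fun i hi => hφ i (by simp [hi]),
        (hv.merge q τ I hl.2 hl.1).separate q τ I hl.2 hl.1 c hca, add_zero]

/-! ### The tautological model -/

/-- The monodromy operators of the tautological model: the sites cross an extra space `ℂ^n`
with spectral parameter `z`. -/
def tautAct (q : ℂ) (n : ℕ) (τ : ι → ℂ) (z : ℂ) (a : ι) :
    Module.End ℂ ((ι → Fin n) → (Unit → Fin n) → ℂ) :=
  siteAct a (wordR q ℂ () (τ a) z)

theorem tautAct_apply (q : ℂ) (τ : ι → ℂ) (z : ℂ) (a : ι)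
    (φ : (ι → Fin n) → (Unit → Fin n) → ℂ) (c : ι → Fin n) (x : Fin n) :
    tautAct q n τ z a φ c (fun _ => x)
      = exch q (τ a) z (fun x' y => φ (update c a x') (fun _ => y)) (c a) x := by
  rw [tautAct, siteAct_apply, sum_wordR_apply]
  rfl

theorem swapLaw_taut {q : ℂ} (hq : q ≠ 0) {τ : ι → ℂ} (hτ : Function.Injective τ) {z : ℂ}
    (hz : ∀ a, τ a ≠ z) :
    SwapLaw (braids q n ((Unit → Fin n) → ℂ) τ) fun l => (l.map (tautAct q n τ z)).prod := by
  refine swapLaw_prod (fun a b hab => ?_) fun a b d ha hb => braid_comm_siteAct _ _ _ _ ha hb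
  exact braid_siteAct (exchRel_wordR hq () (fun h => hab (hτ h)) (hz a) (hz b)) hab

/-- Tensoring with the basis vector `e_0` of the extra space. -/
def extraZero (n : ℕ) : ℂ →ₗ[ℂ] ((Unit → Fin (n + 1)) → ℂ) :=
  LinearMap.single ℂ (fun _ : Unit → Fin (n + 1) => ℂ) (fun _ => 0)

theorem extraZero_apply (w : ℂ) (x : Fin (n + 1)) :
    extraZero n w (fun _ => x) = if x = 0 then w else 0 := by
  simp [extraZero, Pi.single_apply, funext_iff]

theorem taut_apply_zero (q : ℂ) (τ : ι → ℂ) (z : ℂ) (l : List ι)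
    (φ : (ι → Fin (n + 1)) → (Unit → Fin (n + 1)) → ℂ) {c : ι → Fin (n + 1)}
    (hc : ∀ i ∈ l, c i = 0) :
    (l.map (tautAct q (n + 1) τ z)).prod φ c (fun _ => 0)
      = (l.map fun a => fFun q (τ a) z).prod * φ c fun _ => 0 := by
  induction l with
  | nil => simp
  | cons a l ih =>
    rw [List.map_cons, List.prod_cons, Module.End.mul_apply, tautAct_apply, exch,
      if_pos (hc a (by simp)), Function.update_eq_self,
      ih fun i hi => hc i (by simp [hi]), List.map_cons, List.prod_cons, smul_eq_mul, mul_assoc]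

/-- Letter conservation: the `0` entering through the extra space has to leave somewhere. -/
theorem taut_extraZero_apply_ne (q : ℂ) (τ : ι → ℂ) (z : ℂ) (l : List ι)
    (φ : (ι → Fin (n + 1)) → ℂ) {c : ι → Fin (n + 1)} (hc : ∀ i ∈ l, c i ≠ 0) {x : Fin (n + 1)}
    (hx : x ≠ 0) :
    (l.map (tautAct q (n + 1) τ z)).prod (fun c => extraZero n (φ c)) c (fun _ => x) = 0 := by
  induction l generalizing c x with
  | nil => simp [extraZero_apply, hx]
  | cons a l ih =>
    rw [List.map_cons, List.prod_cons, Module.End.mul_apply, tautAct_apply, exch]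
    have hca := hc a (by simp)
    have h1 : ∀ y, y ≠ 0 → ∀ i ∈ l, update c a y i ≠ 0 := by
      intro y hy i hi
      by_cases h : i = a
      · subst h
        simpa using hy
      · simpa [h] using hc i (by simp [hi])
    simp only [ih (h1 _ hca) hx, ih (h1 _ hx) hca, smul_zero, add_zero, ite_self]

/-- The left eigenvector side of the comparison: sites with a nonzero outgoing letter contribute the
factor `1`, whereas by `taut_apply_zero` sites with outgoing letter `0` contribute `f(τ a, z)`. -/
theorem taut_extraZero_apply (q : ℂ) (τ : ι → ℂ) (z : ℂ) {l : List ι} (hl : l.Nodup)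
    (φ : (ι → Fin (n + 1)) → ℂ) {c : ι → Fin (n + 1)} (hc : ∀ i ∈ l, c i ≠ 0) :
    (l.map (tautAct q (n + 1) τ z)).prod (fun c => extraZero n (φ c)) c (fun _ => 0) = φ c := by
  induction l with
  | nil => simp [extraZero_apply]
  | cons a l ih =>
    rw [List.nodup_cons] at hl
    have hca := hc a (by simp)
    rw [List.map_cons, List.prod_cons, Module.End.mul_apply, tautAct_apply, exch, if_neg hca,
      Function.update_eq_self, ih hl.2 fun i hi => hc i (by simp [hi]),
      taut_extraZero_apply_ne q τ z l φ (fun i hi => ?_) hca, smul_zero, add_zero]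
    rw [Function.update_of_ne (ne_of_mem_of_not_mem hi hl.1)]
    exact hc i (by simp [hi])

/-- The right eigenvector side: sites carrying only the letter `0` contribute `f(τ a, z)`, and those
carrying only nonzero letters contribute `1` by `taut_extraZero_apply_of_vanish`. -/
theorem taut_extraZero_of_vanish (q : ℂ) (τ : ι → ℂ) (z : ℂ) (l : List ι)
    {φ : (ι → Fin (n + 1)) → ℂ} (hφ : ∀ i ∈ l, ∀ c : ι → Fin (n + 1), c i ≠ 0 → φ c = 0) :
    (l.map (tautAct q (n + 1) τ z)).prod (fun c => extraZero n (φ c))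
      = (l.map fun a => fFun q (τ a) z).prod • fun c => extraZero n (φ c) := by
  induction l with
  | nil => simp
  | cons a l ih =>
    have ha := hφ a (by simp)
    rw [List.map_cons, List.prod_cons, Module.End.mul_apply, ih fun i hi => hφ i (by simp [hi]),
      map_smul, List.map_cons, List.prod_cons, mul_comm, mul_smul]
    congr 1
    funext c d
    obtain ⟨x, rfl⟩ : ∃ x, d = fun _ => x := ⟨d (), rfl⟩
    rw [tautAct_apply, exch]
    simp only [Pi.smul_apply, extraZero_apply, smul_eq_mul, Function.update_eq_self]
    by_cases hx : x = 0 <;> by_cases hca : c a = 0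
    · simp [hx, hca]
    · simp [hx, hca, ha c hca]
    · have : φ (update c a x) = 0 := ha _ (by simpa using hx)
      simp [hx, hca, Ne.symm hx, this]
    · simp [hx, hca]

theorem VanishZero.taut {d : ι} {φ : (ι → Fin (n + 1)) → (Unit → Fin (n + 1)) → ℂ}
    (h : VanishZero d φ) (q : ℂ) (τ : ι → ℂ) (z : ℂ) {l : List ι} (hd : d ∉ l) :
    VanishZero d ((l.map (tautAct q (n + 1) τ z)).prod φ) := by
  induction l with
  | nil => exact h
  | cons a l ih =>
    simp only [List.mem_cons, not_or] at hd
    intro c hc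
    funext e
    obtain ⟨x, rfl⟩ : ∃ x, e = fun _ => x := ⟨e (), rfl⟩
    have : ∀ y, (l.map (tautAct q (n + 1) τ z)).prod φ (update c a y) = 0 := fun y =>
      ih hd.2 _ (by rwa [Function.update_of_ne hd.1])
    rw [List.map_cons, List.prod_cons, Module.End.mul_apply, tautAct_apply, exch]
    simp only [this, Pi.zero_apply, smul_zero, add_zero, ite_self]

theorem taut_extraZero_apply_of_vanish (q : ℂ) (τ : ι → ℂ) (z : ℂ) {l : List ι} (hl : l.Nodup)
    {φ : (ι → Fin (n + 1)) → ℂ} (hφ : ∀ i ∈ l, VanishZero i φ) (c : ι → Fin (n + 1)) :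
    (l.map (tautAct q (n + 1) τ z)).prod (fun c => extraZero n (φ c)) c (fun _ => 0) = φ c := by
  induction l generalizing c with
  | nil => simp [extraZero_apply]
  | cons a l ih =>
    rw [List.nodup_cons] at hl
    have ih' := ih hl.2 fun i hi => hφ i (by simp [hi])
    have hv : VanishZero a fun c => extraZero n (φ c) := fun c hc => by
      simp only [hφ a (by simp) c hc, map_zero]
    rw [List.map_cons, List.prod_cons, Module.End.mul_apply, tautAct_apply, exch,
      Function.update_eq_self]
    split_ifs with h
    · rw [ih', hφ a (by simp) c h, smul_zero]
    · rw [ih', hv.taut q τ z hl.1 _ (Function.update_self _ _ _), Pi.zero_apply, smul_zero, add_zero]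

end Completeness

/-! ### The resolution of the identity -/

section Resolution

variable {ι : Type*} [DecidableEq ι] {n : ℕ}

/-- Consider the `(0,0)` matrix element, in the extra space, of the tautological chain. The vector
`merge_J φ` is a right eigenvector of it and evaluation of `separate_I` at `c` is a left one,
because the swap law carries both to orders in which the chain is explicit. Computing the pairing in
two ways gives the equality. -/
theorem separate_merge_eigen {q : ℂ} (hq : q ≠ 0) {τ : ι → ℂ} (hτ : Function.Injective τ) {z : ℂ}
    (hz : ∀ a, τ a ≠ z) (I J : Finset ι) {l : List ι} (hl : l.Nodup)
    {φ : (ι → Fin (n + 1)) → ℂ} (hφ : ∀ i ∈ l, i ∈ J → VanishZero i φ)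
    (hφ' : ∀ i ∈ l, i ∉ J → ∀ c : ι → Fin (n + 1), c i ≠ 0 → φ c = 0)
    {c : ι → Fin (n + 1)} (hc : ∀ i ∈ l, (c i = 0 ↔ i ∉ I)) :
    ((outside J l).map fun a => fFun q (τ a) z).prod *
        separate (braids q (n + 1) ℂ τ) I l (merge (braids q (n + 1) ℂ τ) J l φ) c
      = ((outside I l).map fun a => fFun q (τ a) z).prod *
        separate (braids q (n + 1) ℂ τ) I l (merge (braids q (n + 1) ℂ τ) J l φ) c := by
  have hs := swapLaw_taut (n := n + 1) hq hτ hz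
  let ev : ((Unit → Fin (n + 1)) → ℂ) →ₗ[ℂ] ℂ := LinearMap.proj (fun _ => 0)
  set Q : List ι → Module.End ℂ ((ι → Fin (n + 1)) → (Unit → Fin (n + 1)) → ℂ) :=
    fun l => (l.map (tautAct q (n + 1) τ z)).prod with hQ
  have hQa : ∀ l₁ l₂, Q (l₁ ++ l₂) = Q l₁ * Q l₂ := fun l₁ l₂ => by
    simp [hQ]
  set ψ := merge (braids q (n + 1) ℂ τ) J l φ with hψ
  have h1 : (fun c => ev (Q l (fun c => extraZero n (ψ c)) c))
      = ((outside J l).map fun a => fFun q (τ a) z).prod • ψ := by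
    have := LinearMap.congr_fun (hs.merge J l [] (by simpa using hl)) fun c => extraZero n (φ c)
    simp only [Module.End.mul_apply, List.nil_append] at this
    rw [merge_map] at this
    change _ = Q l (fun c => extraZero n (ψ c)) at this
    rw [← this, ← merge_map ev]
    rw [hψ, ← map_smul, hQa, Module.End.mul_apply]
    congr 1
    funext c
    have e := taut_extraZero_of_vanish (n := n) q τ z (outside J l) (φ := φ) fun i hi =>
      hφ' i (mem_outside.1 hi).1 (mem_outside.1 hi).2
    change Q (outside J l) _ = _ at e
    rw [e, map_smul, Pi.smul_apply, map_smul, Pi.smul_apply]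
    congr 1
    exact taut_extraZero_apply_of_vanish q τ z (hl.filter _)
      (fun i hi => hφ i (mem_inside.1 hi).1 (mem_inside.1 hi).2) c
  have h2 : separate (braids q (n + 1) ℂ τ) I l
      (fun c => ev (Q l (fun c => extraZero n (ψ c)) c)) c
      = ((outside I l).map fun a => fFun q (τ a) z).prod *
        separate (braids q (n + 1) ℂ τ) I l ψ c := by
    have := LinearMap.congr_fun (hs.separate I l [] (by simpa using hl)) fun c => extraZero n (ψ c)
    simp only [Module.End.mul_apply, List.nil_append] at this
    rw [separate_map ev, this, separate_map, hQa, Module.End.mul_apply]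
    change Q (outside I l) _ c (fun _ => 0) = _
    rw [hQ]
    simp only
    rw [taut_apply_zero]
    · congr 1
      exact taut_extraZero_apply q τ z (hl.filter _) _
        fun i hi h => (hc i (mem_inside.1 hi).1).1 h (mem_inside.1 hi).2
    · exact fun i hi => (hc i (mem_outside.1 hi).1).2 (mem_outside.1 hi).2
  rw [h1, map_smul] at h2
  exact h2

/-- Orthogonality of eigenvectors: for `p` in exactly one of `I`, `J`, the parameter `z = q² τ p` is
the zero of `f(τ p, ·)`, so one of the two eigenvalues in `separate_merge_eigen` vanishes and the
other does not. -/
theorem separate_merge_of_ne {q : ℂ} (hq : q ≠ 0) {τ : ι → ℂ} (hτ : Function.Injective τ)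
    (hτ0 : ∀ a, τ a ≠ 0) (hf : ∀ a b, a ≠ b → fFun q (τ a) (τ b) ≠ 0)
    {I J : Finset ι} {l : List ι} (hl : l.Nodup) (hIJ : ∃ p ∈ l, ¬ (p ∈ I ↔ p ∈ J))
    {φ : (ι → Fin (n + 1)) → ℂ} (hφ : ∀ i ∈ l, i ∈ J → VanishZero i φ)
    (hφ' : ∀ i ∈ l, i ∉ J → ∀ c : ι → Fin (n + 1), c i ≠ 0 → φ c = 0)
    {c : ι → Fin (n + 1)} (hc : ∀ i ∈ l, (c i = 0 ↔ i ∉ I)) :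
    separate (braids q (n + 1) ℂ τ) I l (merge (braids q (n + 1) ℂ τ) J l φ) c = 0 := by
  obtain ⟨p, hpl, hp⟩ := hIJ
  -- Here `q² τ p` would collide with `τ p`, so the eigenvalue argument fails; but `g = 0`, the
  -- braidings are diagonal, and it suffices that `φ c = 0`.
  by_cases hq2 : q ^ 2 = 1
  · have hφc : φ c = 0 := by
      by_cases hpJ : p ∈ J
      · exact hφ p hpl hpJ c ((hc p hpl).2 (by tauto))
      · refine hφ' p hpl hpJ c fun h => ?_
        have := (hc p hpl).1 h
        tauto
    have hqq : q - q⁻¹ = 0 := by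
      field_simp
      rw [hq2, sub_self, mul_zero]
    have hb : ∀ a ∈ l, ∀ b ∈ l, a ≠ b → ∀ ψ : (ι → Fin (n + 1)) → ℂ, ψ c = 0 →
        braids q (n + 1) ℂ τ a b ψ c = 0 := by
      intro a _ b _ _ ψ h
      by_cases hab : c a = c b
      · rw [braid_apply_of_eq _ _ _ _ _ _ hab, h, smul_zero]
      · rw [braid_apply_of_ne _ _ _ _ _ _ hab, h, swapCoeff, gFun, hqq]
        simp
    exact separate_induction (p := fun X : Module.End ℂ ((ι → Fin (n + 1)) → ℂ) =>
      ∀ ψ, ψ c = 0 → X ψ c = 0) (fun _ h => h) (fun x y hx hy ψ h => hx (y ψ) (hy ψ h)) I l hl hb _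
      (merge_induction (p := fun X : Module.End ℂ ((ι → Fin (n + 1)) → ℂ) =>
        ∀ ψ, ψ c = 0 → X ψ c = 0) (fun _ h => h) (fun x y hx hy ψ h => hx (y ψ) (hy ψ h)) J l hl hb φ
        hφc)
  -- A coincidence with another `τ a` would mean `f(τ p, τ a) = 0`, which genericity excludes.
  · have hz : ∀ a, τ a ≠ q ^ 2 * τ p := by
      intro a h
      by_cases hap : a = p
      · subst hap
        exact hq2 (mul_right_cancel₀ (hτ0 a) (by rw [one_mul]; exact h.symm))
      · refine hf p a (Ne.symm hap) ?_
        rw [fFun, h]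
        field_simp
        simp
    have hzero : fFun q (τ p) (q ^ 2 * τ p) = 0 := by
      rw [fFun]
      field_simp
      simp
    have hne : ∀ a, a ≠ p → fFun q (τ a) (q ^ 2 * τ p) ≠ 0 := by
      intro a hap
      rw [fFun]
      refine div_ne_zero ?_ (sub_ne_zero.2 (hz a))
      have : q * τ a - q⁻¹ * (q ^ 2 * τ p) = q * (τ a - τ p) := by
        field_simp
      rw [this]
      exact mul_ne_zero hq (sub_ne_zero.2 fun h => hap (hτ h))
    have key := separate_merge_eigen (n := n) hq hτ hz I J hl hφ hφ' hc
    have hprod0 : ∀ K : Finset ι, p ∉ K →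
        ((outside K l).map fun a => fFun q (τ a) (q ^ 2 * τ p)).prod = 0 := fun K hK =>
      List.prod_eq_zero (List.mem_map.2 ⟨p, mem_outside.2 ⟨hpl, hK⟩, hzero⟩)
    have hprod : ∀ K : Finset ι, p ∈ K →
        ((outside K l).map fun a => fFun q (τ a) (q ^ 2 * τ p)).prod ≠ 0 := by
      intro K hK h
      obtain ⟨a, ha, h⟩ := List.mem_map.1 (List.prod_eq_zero_iff.1 h)
      exact hne a (fun e => (mem_outside.1 ha).2 (e ▸ hK)) h
    by_cases hpJ : p ∈ J
    · rw [hprod0 I (by tauto), zero_mul] at key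
      exact (mul_eq_zero.1 key).resolve_left (hprod J hpJ)
    · rw [hprod0 J hpJ, zero_mul] at key
      exact (mul_eq_zero.1 key.symm).resolve_left (hprod I (by tauto))

variable [Fintype ι]

/-- The positions of the nonzero letters of a word. -/
def nonzeroSites (c : ι → Fin (n + 1)) : Finset ι := Finset.univ.filter fun a => c a ≠ 0

/-- The projection onto words whose nonzero letters are at the positions in `I`. -/
def siteProj (n : ℕ) (M : Type*) [AddCommGroup M] [Module ℂ M] (I : Finset ι) :
    Module.End ℂ ((ι → Fin (n + 1)) → M) where
  toFun φ c := if nonzeroSites c = I then φ c else 0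
  map_add' φ ψ := by
    funext c
    by_cases h : nonzeroSites c = I <;> simp [h]
  map_smul' r φ := by
    funext c
    by_cases h : nonzeroSites c = I <;> simp [h]

theorem siteProj_apply {M : Type*} [AddCommGroup M] [Module ℂ M] (I : Finset ι)
    (φ : (ι → Fin (n + 1)) → M) (c : ι → Fin (n + 1)) :
    siteProj n M I φ c = if nonzeroSites c = I then φ c else 0 := rfl

theorem eq_zero_iff_notMem_nonzeroSites (c : ι → Fin (n + 1)) (i : ι) :
    c i = 0 ↔ i ∉ nonzeroSites c := by
  simp [nonzeroSites]

/-- With `A = ∑ P_I separate_I` and `B = ∑ merge_J P_J`, the diagonal and off-diagonal computations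
give `A B = 1`, while the claim is `B A = 1`. -/
theorem sum_merge_separate_complex {q : ℂ} (hq : q ≠ 0) {τ : ι → ℂ} (hτ : Function.Injective τ)
    (hτ0 : ∀ a, τ a ≠ 0) (hf : ∀ a b, a ≠ b → fFun q (τ a) (τ b) ≠ 0)
    {l : List ι} (hl : l.Nodup) (hl' : ∀ a, a ∈ l) :
    ∑ I : Finset ι, merge (braids q (n + 1) ℂ τ) I l * siteProj n ℂ I *
      separate (braids q (n + 1) ℂ τ) I l = 1 := by
  set X := fun I => separate (braids q (n + 1) ℂ τ) I l with hX
  set Y := fun I => merge (braids q (n + 1) ℂ τ) I l with hY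
  set A : Module.End ℂ ((ι → Fin (n + 1)) → ℂ) := ∑ I : Finset ι, siteProj n ℂ I * X I with hA
  set B : Module.End ℂ ((ι → Fin (n + 1)) → ℂ) := ∑ J : Finset ι, Y J * siteProj n ℂ J with hB
  have hAapp : ∀ φ c, A φ c = X (nonzeroSites c) φ c := by
    intro φ c
    simp [hA, LinearMap.sum_apply, siteProj_apply]
  have hAB : A * B = 1 := by
    refine LinearMap.ext fun φ => ?_
    funext c
    rw [Module.End.mul_apply, hAapp, hB, LinearMap.sum_apply, map_sum, Finset.sum_apply,
      Finset.sum_eq_single (nonzeroSites c)]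
    · rw [Module.End.mul_apply, hX, hY]
      simp only
      rw [separate_merge_apply q τ _ hl _ fun i _ => eq_zero_iff_notMem_nonzeroSites c i,
        siteProj_apply, if_pos rfl, Module.End.one_apply]
      intro i _ hi d hd
      rw [siteProj_apply, if_neg]
      rintro h
      rw [← h] at hi
      exact (eq_zero_iff_notMem_nonzeroSites d i).1 hd hi
    · intro J _ hJ
      rw [Module.End.mul_apply]
      refine separate_merge_of_ne hq hτ hτ0 hf hl ?_ ?_ ?_
        fun i _ => eq_zero_iff_notMem_nonzeroSites c i
      · by_contra! h
        exact hJ (Finset.ext fun p => (h p (hl' p)).symm)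
      · intro i _ hi d hd
        rw [siteProj_apply, if_neg]
        rintro h
        rw [← h] at hi
        exact (eq_zero_iff_notMem_nonzeroSites d i).1 hd hi
      · intro i _ hi d hd
        rw [siteProj_apply, if_neg]
        rintro h
        rw [← h] at hi
        exact hd ((eq_zero_iff_notMem_nonzeroSites d i).2 hi)
    · simp
  -- The space of scalar functions on words is finite-dimensional, so a one-sided inverse is
  -- two-sided.
  rw [mul_eq_one_comm] at hAB
  rw [← hAB, hB, Finset.sum_mul]
  refine Finset.sum_congr rfl fun J _ => ?_
  rw [mul_assoc, mul_assoc]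
  congr 1
  refine LinearMap.ext fun φ => ?_
  funext c
  rw [Module.End.mul_apply, Module.End.mul_apply, siteProj_apply, siteProj_apply, hAapp]
  split_ifs with h
  · rw [h]
  · rfl

/-- Coefficients in any space reduce to scalar ones: linear functionals separate points, and the
reorderings and projections act on the words only. -/
theorem sum_merge_separate {q : ℂ} (hq : q ≠ 0) {τ : ι → ℂ} (hτ : Function.Injective τ)
    (hτ0 : ∀ a, τ a ≠ 0) (hf : ∀ a b, a ≠ b → fFun q (τ a) (τ b) ≠ 0)
    {l : List ι} (hl : l.Nodup) (hl' : ∀ a, a ∈ l) {M : Type*} [AddCommGroup M] [Module ℂ M]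
    (φ : (ι → Fin (n + 1)) → M) :
    ∑ I : Finset ι, merge (braids q (n + 1) M τ) I l (siteProj n M I
      (separate (braids q (n + 1) M τ) I l φ)) = φ := by
  funext c
  rw [← sub_eq_zero, ← Module.forall_dual_apply_eq_zero_iff ℂ]
  intro L
  have := congrFun (LinearMap.congr_fun (sum_merge_separate_complex (n := n) hq hτ hτ0 hf hl hl')
    fun c => L (φ c)) c
  rw [map_sub, sub_eq_zero, Finset.sum_apply, map_sum]
  rw [LinearMap.sum_apply, Finset.sum_apply, Module.End.one_apply] at this
  rw [← this]
  refine Finset.sum_congr rfl fun I _ => ?_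
  rw [Module.End.mul_apply, Module.End.mul_apply, separate_map]
  have e : (siteProj n ℂ I fun c => L (separate (braids q (n + 1) M τ) I l φ c))
      = fun c => L (siteProj n M I (separate (braids q (n + 1) M τ) I l φ) c) := by
    funext d
    rw [siteProj_apply, siteProj_apply]
    split_ifs <;> simp
  rw [e, merge_map]

end Resolution

/-! ### Functoriality of Bethe vectors -/

section Functoriality

open Function (update)

/-- The monodromy matrix with its first row and column removed. -/
def lowerBlock {H : Type*} [AddCommGroup H] [Module ℂ H] {n : ℕ} (T : OpMatrix (n + 1) H) :
    OpMatrix n H := fun u => Matrix.of fun i j => T u i.succ j.succ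

/-- The monodromy matrix `E(u) R_{0,l_r}(u,τ_{l_r}) ⋯ R_{0,l_1}(u,τ_{l_1})` with labelled sites. -/
def siteMonodromy {ι : Type*} [DecidableEq ι] {H : Type*} [AddCommGroup H] [Module ℂ H] {n : ℕ}
    (q : ℂ) (E : OpMatrix n H) (τ : ι → ℂ) (l : List ι) (u : ℂ) :
    Matrix (Fin n) (Fin n) (Module.End ℂ ((ι → Fin n) → H)) :=
  compLeftMatrix _ (E u) * ((l.map fun a => wordR q H a u (τ a)).reverse).prod

theorem nestedMonodromy_eq {H : Type u} [AddCommGroup H] [Module ℂ H] {n : ℕ}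
    (q : ℂ) (T : OpMatrix (n + 1) H) (t : List ℂ) :
    nestedMonodromy q T t = siteMonodromy q (lowerBlock T) t.get (List.finRange t.length) := by
  funext u
  rw [nestedMonodromy, siteMonodromy, List.ofFn_eq_map]
  rfl

theorem mk_sum_sum {X X' κ : Type*} [AddCommMonoid X] [AddCommMonoid X'] (s : Finset κ)
    (f : κ → X) (g : κ → X') : (∑ k ∈ s, f k, ∑ k ∈ s, g k) = ∑ k ∈ s, (f k, g k) := by
  ext <;> simp [Prod.fst_sum, Prod.snd_sum]

/-- Pairs of families which are related componentwise. -/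
def liftRel {H H' : Type*} [AddCommGroup H] [Module ℂ H] [AddCommGroup H'] [Module ℂ H']
    (κ : Type*) (V : Submodule ℂ (H × H')) : Submodule ℂ ((κ → H) × (κ → H')) where
  carrier := {p | ∀ c, (p.1 c, p.2 c) ∈ V}
  add_mem' h h' c := V.add_mem (h c) (h' c)
  zero_mem' _ := V.zero_mem
  smul_mem' r _ h c := V.smul_mem r (h c)

/-- The entries of two matrices of operators map related pairs to related pairs. -/
def MapsRel {X X' : Type*} [AddCommGroup X] [Module ℂ X] [AddCommGroup X'] [Module ℂ X'] {n : ℕ}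
    (A : Matrix (Fin n) (Fin n) (Module.End ℂ X)) (A' : Matrix (Fin n) (Fin n) (Module.End ℂ X'))
    (V V' : Submodule ℂ (X × X')) : Prop :=
  ∀ i j, ∀ p ∈ V, (A i j p.1, A' i j p.2) ∈ V'

theorem MapsRel.mul {X X' : Type*} [AddCommGroup X] [Module ℂ X] [AddCommGroup X'] [Module ℂ X']
    {n : ℕ} {A B : Matrix (Fin n) (Fin n) (Module.End ℂ X)}
    {A' B' : Matrix (Fin n) (Fin n) (Module.End ℂ X')} {V V' V'' : Submodule ℂ (X × X')}
    (hA : MapsRel A A' V' V'') (hB : MapsRel B B' V V') : MapsRel (A * B) (A' * B') V V'' := by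
  intro i j p hp
  simp only [Matrix.mul_apply, LinearMap.sum_apply, Module.End.mul_apply]
  rw [mk_sum_sum]
  exact Submodule.sum_mem _ fun k _ => hA i k _ (hB k j p hp)

theorem MapsRel.one {X X' : Type*} [AddCommGroup X] [Module ℂ X] [AddCommGroup X'] [Module ℂ X']
    {n : ℕ} (V : Submodule ℂ (X × X')) :
    MapsRel (1 : Matrix (Fin n) (Fin n) (Module.End ℂ X)) 1 V V := by
  intro i j p hp
  by_cases h : i = j
  · subst h
    simpa using hp
  · rw [Matrix.one_apply_ne h, Matrix.one_apply_ne h]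
    exact V.zero_mem

theorem mapsRel_wordR {H H' : Type*} [AddCommGroup H] [Module ℂ H] [AddCommGroup H'] [Module ℂ H']
    {ι : Type*} [DecidableEq ι] {n : ℕ} (q : ℂ) (a : ι) (u v : ℂ) (V : Submodule ℂ (H × H')) :
    MapsRel (wordR (n := n) q H a u v) (wordR q H' a u v) (liftRel _ V) (liftRel _ V) := by
  intro i j p hp c
  simp only [wordR_apply]
  rw [mk_sum_sum]
  exact Submodule.sum_mem _ fun k _ => V.smul_mem _ (hp _)

theorem mapsRel_siteMonodromy {H H' : Type*} [AddCommGroup H] [Module ℂ H] [AddCommGroup H']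
    [Module ℂ H'] {ι : Type*} [DecidableEq ι] {n : ℕ} (q : ℂ) {E : OpMatrix n H}
    {E' : OpMatrix n H'} (τ : ι → ℂ) (l : List ι) {u : ℂ} {V V' : Submodule ℂ (H × H')}
    (h : MapsRel (E u) (E' u) V V') :
    MapsRel (siteMonodromy q E τ l u) (siteMonodromy q E' τ l u) (liftRel _ V) (liftRel _ V') := by
  refine MapsRel.mul (V' := liftRel _ V) (fun i j p hp c => h i j _ (hp c)) ?_
  induction l with
  | nil => exact MapsRel.one _
  | cons a l ih =>
    simp only [List.map_cons, List.reverse_cons, List.prod_append, List.prod_singleton]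
    exact ih.mul (mapsRel_wordR q a u (τ a) V)

/-- Functoriality of Bethe vectors with respect to relations that are only preserved by the
monodromy operators at spectral parameters that have not been used before. -/
theorem betheVector_rel (q : ℂ) (N : ℕ) {H H' : Type u} [AddCommGroup H] [Module ℂ H]
    [AddCommGroup H'] [Module ℂ H'] (T : OpMatrix (N + 1) H) (T' : OpMatrix (N + 1) H')
    (lam : Fin (N + 1) → ℂ → ℂ) (v : H) (v' : H') (t : Fin N → List ℂ)
    (Rel : Set ℂ → Submodule ℂ (H × H')) (S : Set ℂ)
    (hstep : ∀ S' ⊆ S, ∀ u ∈ S', MapsRel (T u) (T' u) (Rel S') (Rel (S' \ {u})))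
    (ht : (List.ofFn t).flatten.Nodup) (hS : ∀ u ∈ (List.ofFn t).flatten, u ∈ S)
    (hv : (v, v') ∈ Rel S) :
    (betheVector q N T lam v t, betheVector q N T' lam v' t)
      ∈ Rel (S \ {u | u ∈ (List.ofFn t).flatten}) := by
  induction N generalizing H H' S with
  | zero => simpa [betheVector] using hv
  | succ N ih =>
    rw [List.ofFn_succ, List.flatten_cons] at ht hS ⊢
    rw [List.nodup_append] at ht
    obtain ⟨ht0, ht1, hd⟩ := ht
    have hN := ih (nestedMonodromy q T (t 0)) (nestedMonodromy q T' (t 0)) (nestedEigen q lam (t 0))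
      (nestedVac (t 0).length v) (nestedVac (t 0).length v') (fun ν => t ν.succ)
      (fun S' => liftRel _ (Rel S')) S ?_ ht1 (fun u hu => hS u (by simp [hu])) ?_
    · set S₁ := S \ {u | u ∈ (List.ofFn fun ν : Fin N => t ν.succ).flatten} with hS₁
      -- The creation operators consume their parameters one at a time. As all parameters are
      -- distinct, each is still available when its turn comes.
      have hlist : ∀ (k : Fin (t 0).length → Fin (N + 1)) (l : List (Fin (t 0).length)), l.Nodup →
          ∀ p ∈ Rel S₁, ((l.map fun a => T ((t 0).get a) 0 (k a).succ).prod p.1,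
            (l.map fun a => T' ((t 0).get a) 0 (k a).succ).prod p.2)
            ∈ Rel (S₁ \ {u | u ∈ l.map (t 0).get}) := by
        intro k l
        induction l with
        | nil => simp
        | cons a l ihl =>
          intro hl p hp
          rw [List.nodup_cons] at hl
          simp only [List.map_cons, List.prod_cons, Module.End.mul_apply]
          have hmem : (t 0).get a ∈ S₁ \ {u | u ∈ l.map (t 0).get} := by
            refine ⟨⟨hS _ (by simp), fun h => hd _ (List.get_mem _ _) _ h rfl⟩, fun h => ?_⟩
            obtain ⟨b, hb, hab⟩ := List.mem_map.1 h
            exact hl.1 (List.nodup_iff_injective_get.1 ht0 hab ▸ hb)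
          have := hstep _ (fun x hx => hx.1.1) _ hmem 0 (k a).succ _ (ihl hl.2 p hp)
          convert this using 2
          ext x
          simp only [Set.mem_sdiff, Set.mem_ofPred_eq, List.mem_cons, Set.mem_singleton_iff]
          tauto
      have hfin : S₁ \ {u | u ∈ (List.finRange (t 0).length).map (t 0).get}
          = S \ {u | u ∈ t 0 ++ (List.ofFn fun ν : Fin N => t ν.succ).flatten} := by
        ext x
        rw [hS₁, List.map_get_finRange]
        simp only [Set.mem_sdiff, Set.mem_ofPred_eq, List.mem_append]
        tauto
      rw [← hfin]
      simp only [betheVector]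
      have hsmul : ∀ (V : Submodule ℂ (H × H')) (r : ℂ) (a : H) (b : H'), (a, b) ∈ V →
          (r • a, r • b) ∈ V := fun V r a b h => V.smul_mem r h
      refine hsmul _ _ _ _ ?_
      rw [mk_sum_sum]
      refine Submodule.sum_mem _ fun k _ => ?_
      rw [List.ofFn_eq_map, List.ofFn_eq_map]
      exact hlist k _ (List.nodup_finRange _) (_, _) (hN k)
    -- The nested monodromy at `u` contains `T(u)` once in every term, so it consumes just `u`; its
    -- `R`-factors have scalar weights and respect every relation.
    · intro S' hS' u hu
      rw [nestedMonodromy_eq, nestedMonodromy_eq]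
      exact mapsRel_siteMonodromy q _ _ fun i j p hp => hstep S' hS' u hu _ _ p hp
    · intro c
      simp only [nestedVac, Pi.single_apply]
      split_ifs
      · exact hv
      · exact (Rel S).zero_mem

/-- The relation `P x = r • y`, taken constant in the set of available parameters. The scalar `r`
accommodates maps that rescale the pseudovacuum. -/
theorem betheVector_intertwine (q : ℂ) (N : ℕ) {H H' : Type u} [AddCommGroup H] [Module ℂ H]
    [AddCommGroup H'] [Module ℂ H'] (T : OpMatrix (N + 1) H) (T' : OpMatrix (N + 1) H')
    (lam : Fin (N + 1) → ℂ → ℂ) (v : H) (v' : H') (t : Fin N → List ℂ)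
    (P : H →ₗ[ℂ] H') (r : ℂ) (ht : (List.ofFn t).flatten.Nodup)
    (hP : ∀ u ∈ (List.ofFn t).flatten, ∀ i j x, P (T u i j x) = T' u i j (P x))
    (hv : P v = r • v') :
    P (betheVector q N T lam v t) = r • betheVector q N T' lam v' t := by
  let V : Submodule ℂ (H × H') :=
    LinearMap.eqLocus (P ∘ₗ LinearMap.fst ℂ H H') (r • LinearMap.snd ℂ H H')
  refine betheVector_rel q N T T' lam v v' t (fun _ => V) {u | u ∈ (List.ofFn t).flatten} ?_ ht
    (fun _ h => h) hv
  intro S' hS' u hu i j p hp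
  have hp' : P p.1 = r • p.2 := hp
  change P (T u i j p.1) = r • T' u i j p.2
  rw [hP u (hS' hu), hp', map_smul]

section Pull

variable {κ ι : Type*} [DecidableEq κ] [DecidableEq ι] {n : ℕ} {H₁ H : Type*} [AddCommGroup H₁]
  [Module ℂ H₁] [AddCommGroup H] [Module ℂ H]

/-- Pulling back functions on words along a map of labels, with coefficients. -/
def pullWords (e : κ → ι) (η : (ι → Fin n) → H₁ →ₗ[ℂ] H) :
    ((κ → Fin n) → H₁) →ₗ[ℂ] ((ι → Fin n) → H) where
  toFun x c := η c (x fun l => c (e l))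
  map_add' x y := by
    funext c
    simp
  map_smul' r x := by
    funext c
    simp

theorem pullWords_apply (e : κ → ι) (η : (ι → Fin n) → H₁ →ₗ[ℂ] H) (x : (κ → Fin n) → H₁)
    (c : ι → Fin n) : pullWords e η x c = η c (x fun l => c (e l)) := rfl

/-- The `R`-factors change only letters at sites in the range of `e`, on which the coefficients `η`
do not depend. -/
theorem pullWords_siteMonodromy (q : ℂ) {e : κ → ι} (he : Function.Injective e)
    {η : (ι → Fin n) → H₁ →ₗ[ℂ] H} (hη : ∀ c l x, η (update c (e l) x) = η c)
    {E₁ : OpMatrix n H₁} {E : OpMatrix n H} (τ : ι → ℂ) (lst : List κ) {u : ℂ}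
    (hE : ∀ c i j x, η c (E₁ u i j x) = E u i j (η c x)) (i j : Fin n) (x : (κ → Fin n) → H₁) :
    pullWords e η (siteMonodromy q E₁ (fun l => τ (e l)) lst u i j x)
      = siteMonodromy q E τ (lst.map e) u i j (pullWords e η x) := by
  have hm : ∀ (A B : Matrix (Fin n) (Fin n) (Module.End ℂ ((κ → Fin n) → H₁)))
      (A' B' : Matrix (Fin n) (Fin n) (Module.End ℂ ((ι → Fin n) → H))),
      (∀ i j x, pullWords e η (A i j x) = A' i j (pullWords e η x)) →
      (∀ i j x, pullWords e η (B i j x) = B' i j (pullWords e η x)) →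
      ∀ i j x, pullWords e η ((A * B) i j x) = (A' * B') i j (pullWords e η x) := by
    intro A B A' B' hA hB i j x
    simp only [Matrix.mul_apply, LinearMap.sum_apply, Module.End.mul_apply, map_sum, hA, hB]
  refine hm _ _ _ _ (fun i j x => ?_) ?_ i j x
  · funext c
    exact hE c i j _
  · induction lst with
    | nil =>
      intro i j x
      by_cases h : i = j
      · subst h
        simp
      · simp [Matrix.one_apply_ne h]
    | cons a l ih =>
      simp only [List.map_cons, List.reverse_cons, List.prod_append, List.prod_singleton]
      refine hm _ _ _ _ ih fun i j x => ?_
      funext c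
      simp only [pullWords_apply, wordR_apply, map_sum, map_smul, hη]
      refine Finset.sum_congr rfl fun y _ => ?_
      congr 3
      funext l
      by_cases hl : l = a
      · subst hl
        simp
      · simp [hl, he.ne hl]

end Pull

/-- The pseudovacuum `v ⊗ e_1 ⊗ ⋯ ⊗ e_1` with labelled sites. -/
def wordVac (ι : Type*) (n : ℕ) {H : Type*} [AddCommGroup H] (v : H) :
    (ι → Fin (n + 1)) → H := fun c => open Classical in if c = fun _ => 0 then v else 0

theorem nestedVac_apply {H : Type u} [AddCommGroup H] [Module ℂ H] {n : ℕ} (r : ℕ) (v : H)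
    (c : Fin r → Fin (n + 1)) : nestedVac r v c = open Classical in
    if c = fun _ => 0 then v else 0 := by
  rw [nestedVac, Pi.single_apply]

theorem wordVac_apply {ι : Type*} {n : ℕ} {H : Type*} [AddCommGroup H] (v : H)
    (c : ι → Fin (n + 1)) :
    wordVac ι n v c = open Classical in if c = fun _ => 0 then v else 0 := rfl

/-- The recursive definition of Bethe vectors, with labelled sites. -/
theorem betheVector_succ_labelled (q : ℂ) {N : ℕ} {H : Type u} [AddCommGroup H] [Module ℂ H]
    (T : OpMatrix (N + 2) H) (lam : Fin (N + 2) → ℂ → ℂ) (v : H) (t : Fin (N + 1) → List ℂ)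
    {ι : Type} [Fintype ι] [DecidableEq ι] (τ : ι → ℂ) (e : Fin (t 0).length ≃ ι)
    (he : ∀ a, τ (e a) = (t 0).get a) (ht : (List.ofFn fun ν : Fin N => t ν.succ).flatten.Nodup)
    {l : List ι} (hl : (List.finRange (t 0).length).map e = l) :
    betheVector q (N + 1) T lam v t
      = (prodOver (lam 1) (t 0) * fProd q (headFamily fun ν : Fin N => t ν.succ) (t 0))⁻¹ •
        ∑ k : ι → Fin (N + 1), (l.map fun a => T (τ a) 0 (k a).succ).prod
          (betheVector q N (siteMonodromy q (lowerBlock T) τ l) (nestedEigen q lam (t 0))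
            (wordVac ι N v) (fun ν => t ν.succ) k) := by
  have hτ : (t 0).get = fun a => τ (e a) := funext fun a => (he a).symm
  have key := betheVector_intertwine q N (nestedMonodromy q T (t 0))
    (siteMonodromy q (lowerBlock T) τ l) (nestedEigen q lam (t 0)) (nestedVac (t 0).length v)
    (wordVac ι N v) (fun ν => t ν.succ) (pullWords e fun _ => LinearMap.id) 1 ht ?_ ?_
  · rw [one_smul] at key
    simp only [betheVector]
    congr 1
    refine (Equiv.sum_comp (Equiv.arrowCongr e (Equiv.refl (Fin (N + 1)))) _).symm.trans ?_ |>.symm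
    refine Finset.sum_congr rfl fun k _ => ?_
    rw [← key, pullWords_apply, ← hl, List.ofFn_eq_map, List.map_map]
    simp [Function.comp_def, he]
  · intro u _ i j x
    rw [nestedMonodromy_eq, ← hl, hτ]
    exact pullWords_siteMonodromy q e.injective (fun _ _ _ => rfl) τ _ (fun _ _ _ _ => rfl) i j x
  · rw [one_smul]
    funext c
    rw [pullWords_apply, nestedVac_apply, wordVac_apply, LinearMap.id_apply]
    congr 1
    simp only [funext_iff, eq_iff_iff]
    exact e.forall_congr_right (q := fun a => c a = 0)

end Functoriality

/-! ### Normal ordering of the creation operators of a composite model -/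

section Composite

open Function (update)

variable {ι : Type*} [DecidableEq ι] {n : ℕ} {H : Type*} [AddCommGroup H] [Module ℂ H]

/-- The product of the monodromy operators at the labels of a list, each acting in its own site. -/
def wordMonodromy (T : OpMatrix n H) (τ : ι → ℂ) (l : List ι) :
    Module.End ℂ ((ι → Fin n) → H) :=
  (l.map fun a => siteAct a (T (τ a))).prod

theorem wordMonodromy_nil (T : OpMatrix n H) (τ : ι → ℂ) : wordMonodromy T τ [] = 1 := rfl

theorem wordMonodromy_cons (T : OpMatrix n H) (τ : ι → ℂ) (a : ι) (l : List ι) :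
    wordMonodromy T τ (a :: l) = siteAct a (T (τ a)) * wordMonodromy T τ l := by
  simp [wordMonodromy]

theorem wordMonodromy_append (T : OpMatrix n H) (τ : ι → ℂ) (l l' : List ι) :
    wordMonodromy T τ (l ++ l') = wordMonodromy T τ l * wordMonodromy T τ l' := by
  simp [wordMonodromy]

/-- Operators at different sites with commuting entries commute, so every factor of `S₂` can be
moved to the right of all factors of `S₁`. -/
theorem wordMonodromy_mul {S₁ S₂ : OpMatrix n H} {τ : ι → ℂ}
    (hc : ∀ a b i j k l, Commute (S₁ (τ a) i j) (S₂ (τ b) k l)) {l : List ι} (hl : l.Nodup) :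
    wordMonodromy (fun u => S₁ u * S₂ u) τ l = wordMonodromy S₁ τ l * wordMonodromy S₂ τ l := by
  induction l with
  | nil => simp [wordMonodromy_nil]
  | cons a l ih =>
    rw [List.nodup_cons] at hl
    have h : Commute (siteAct a (S₂ (τ a))) (wordMonodromy S₁ τ l) := by
      refine Commute.list_prod_right _ _ fun x hx => ?_
      obtain ⟨b, hb, rfl⟩ := List.mem_map.1 hx
      exact siteAct_comm (ne_of_mem_of_not_mem hb hl.1).symm fun i j k l => (hc _ _ _ _ _ _).symm
    rw [wordMonodromy_cons, wordMonodromy_cons, wordMonodromy_cons, ih hl.2, siteAct_mul, mul_assoc,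
      ← mul_assoc (siteAct a (S₂ (τ a))), h.eq]
    simp only [mul_assoc]

theorem swapLaw_wordMonodromy {q : ℂ} {T : OpMatrix n H} {τ : ι → ℂ}
    (h : ∀ a b, a ≠ b → ExchRel q (τ a) (τ b) (T (τ a)) (T (τ b))) :
    SwapLaw (braids q n H τ) (wordMonodromy T τ) :=
  swapLaw_prod (fun a b hab => braid_siteAct (h a b hab) hab)
    fun _ _ _ ha hb => braid_comm_siteAct _ _ _ _ ha hb

theorem wordMonodromy_apply [Fintype ι] (T : OpMatrix n H) (τ : ι → ℂ) {l : List ι} (hl : l.Nodup)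
    (φ : (ι → Fin n) → H) (c : ι → Fin n) :
    wordMonodromy T τ l φ c = ∑ k : ι → Fin n, open Classical in
      if ∀ b, b ∉ l → k b = c b then (l.map fun a => T (τ a) (c a) (k a)).prod (φ k) else 0 := by
  classical
  induction l generalizing c with
  | nil =>
    rw [Finset.sum_eq_single c]
    · simp [wordMonodromy_nil]
    · intro k _ hk
      rw [if_neg]
      exact fun h => hk (funext fun b => h b (by simp))
    · simp
  | cons a l ih =>
    rw [List.nodup_cons] at hl
    rw [wordMonodromy_cons, Module.End.mul_apply, siteAct_apply]
    simp only [ih hl.2, map_sum]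
    rw [Finset.sum_comm]
    refine Finset.sum_congr rfl fun k _ => ?_
    rw [Finset.sum_eq_single (k a)]
    · have h1 : (∀ b, b ∉ l → k b = update c a (k a) b) ↔ ∀ b, b ∉ a :: l → k b = c b := by
        constructor
        · intro h b hb
          simp only [List.mem_cons, not_or] at hb
          rw [h b hb.2, Function.update_of_ne hb.1]
        · intro h b hb
          by_cases hba : b = a
          · subst hba
            simp
          · rw [Function.update_of_ne hba]
            exact h b (by simp [hba, hb])
      have h2 : (l.map fun b => T (τ b) (update c a (k a) b) (k b))
          = l.map fun b => T (τ b) (c b) (k b) :=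
        List.map_congr_left fun b hb => by
          rw [Function.update_of_ne (ne_of_mem_of_not_mem hb hl.1)]
      rw [h2]
      simp only [h1]
      split_ifs
      · rfl
      · exact map_zero _
    · intro x _ hx
      rw [if_neg, map_zero]
      intro h
      have := h a hl.1
      rw [Function.update_self] at this
      exact hx this.symm
    · simp

/-- Functions on words in the letters `1, …, n`, extended by zero to words in `0, …, n`. -/
def extendWords (ι : Type*) (n : ℕ) (H : Type*) [AddCommGroup H] [Module ℂ H] :
    ((ι → Fin n) → H) →ₗ[ℂ] ((ι → Fin (n + 1)) → H) where
  toFun φ c := open Classical in if h : ∀ a, c a ≠ 0 then φ fun a => (c a).pred (h a) else 0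
  map_add' φ ψ := by
    funext c
    by_cases h : ∀ a, c a ≠ 0 <;> simp [h]
  map_smul' r φ := by
    funext c
    by_cases h : ∀ a, c a ≠ 0 <;> simp [h]

theorem extendWords_of_zero (φ : (ι → Fin n) → H) {c : ι → Fin (n + 1)} {a : ι} (h : c a = 0) :
    extendWords ι n H φ c = 0 := by
  simp only [extendWords, LinearMap.coe_mk, AddHom.coe_mk]
  exact dif_neg fun h' => h' a h

theorem extendWords_succ (φ : (ι → Fin n) → H) (k : ι → Fin n) :
    extendWords ι n H φ (fun a => (k a).succ) = φ k := by
  simp [extendWords]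

theorem exists_zero_or_eq_succ (c : ι → Fin (n + 1)) :
    (∃ a, c a = 0) ∨ ∃ k : ι → Fin n, c = fun a => (k a).succ := by
  by_cases h : ∃ a, c a = 0
  · exact Or.inl h
  · push Not at h
    exact Or.inr ⟨fun a => (c a).pred (h a), by simp⟩

theorem update_succ (k : ι → Fin n) (a : ι) (x : Fin n) :
    update (fun a => (k a).succ) a x.succ = fun b => (update k a x b).succ := by
  funext b
  by_cases h : b = a
  · subst h
    simp
  · simp [h]

theorem braid_extendWords (q : ℂ) {a b : ι} (hab : a ≠ b) (u v : ℂ) (φ : (ι → Fin n) → H) :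
    braid q a b u v (extendWords ι n H φ) = extendWords ι n H (braid q a b u v φ) := by
  funext c
  rcases exists_zero_or_eq_succ c with ⟨d, hd⟩ | ⟨k, rfl⟩
  · rw [extendWords_of_zero _ hd]
    by_cases h : c a = c b
    · rw [braid_apply_of_eq _ _ _ _ _ _ h, extendWords_of_zero _ hd, smul_zero]
    · rw [braid_apply_of_ne _ _ _ _ _ _ h, extendWords_of_zero _ hd, zero_add]
      by_cases hda : d = a
      · subst hda
        rw [extendWords_of_zero (a := b), smul_zero]
        simp [hd]
      · by_cases hdb : d = b
        · subst hdb
          rw [extendWords_of_zero (a := a), smul_zero]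
          simp [hd, hab]
        · rw [extendWords_of_zero (a := d), smul_zero]
          simp [hd, hda, hdb]
  · rw [extendWords_succ]
    by_cases h : k a = k b
    · rw [braid_apply_of_eq _ _ _ _ _ _ h, braid_apply_of_eq (c := fun a => (k a).succ) q a b u v _
        (congrArg Fin.succ h), extendWords_succ]
    · rw [braid_apply_of_ne _ _ _ _ _ _ h,
        braid_apply_of_ne (c := fun a => (k a).succ) q a b u v _
          (fun e => h (Fin.succ_injective _ e)), extendWords_succ]
      simp only [update_succ, extendWords_succ, swapCoeff, Fin.succ_lt_succ_iff]

theorem separate_extendWords (q : ℂ) (τ : ι → ℂ) (I : Finset ι) {l : List ι} (hl : l.Nodup)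
    (φ : (ι → Fin n) → H) :
    separate (braids q (n + 1) H τ) I l (extendWords ι n H φ)
      = extendWords ι n H (separate (braids q n H τ) I l φ) := by
  have hm : ∀ a (l : List ι), a ∉ l → ∀ (φ : (ι → Fin n) → H),
      moveRight (braids q (n + 1) H τ) a l (extendWords ι n H φ)
        = extendWords ι n H (moveRight (braids q n H τ) a l φ) := by
    intro a l
    induction l with
    | nil => exact fun _ _ => rfl
    | cons j l ih =>
      intro ha φ
      simp only [List.mem_cons, not_or] at ha
      rw [moveRight, moveRight, Module.End.mul_apply, Module.End.mul_apply,
        braid_extendWords q ha.1, ih ha.2]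
  induction l generalizing φ with
  | nil => rfl
  | cons a l ih =>
    rw [List.nodup_cons] at hl
    simp only [separate]
    split_ifs
    · rw [Module.End.mul_apply, Module.End.mul_apply, ih hl.2,
        hm _ _ fun h => hl.1 (mem_outside.1 h).1]
    · exact ih hl.2 φ

/-- With nonzero letters both entering and leaving at `a`, only the lower block of `T` is seen. -/
theorem siteAct_extendWords (T : OpMatrix (n + 1) H) (u : ℂ) (a : ι) (φ : (ι → Fin n) → H)
    {c : ι → Fin (n + 1)} (hc : c a ≠ 0) :
    siteAct a (T u) (extendWords ι n H φ) c
      = extendWords ι n H (siteAct a (lowerBlock T u) φ) c := by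
  rcases exists_zero_or_eq_succ c with ⟨d, hd⟩ | ⟨k, rfl⟩
  · rw [extendWords_of_zero _ hd, siteAct_apply]
    refine Finset.sum_eq_zero fun x _ => ?_
    rw [extendWords_of_zero (a := d), map_zero]
    rw [Function.update_of_ne, hd]
    rintro rfl
    exact hc hd
  · rw [extendWords_succ, siteAct_apply, siteAct_apply, Fin.sum_univ_succ,
      extendWords_of_zero (a := a) _ (Function.update_self _ _ _), map_zero, zero_add]
    simp only [update_succ, extendWords_succ]
    rfl

theorem wordMonodromy_extendWords (T : OpMatrix (n + 1) H) (τ : ι → ℂ) {l : List ι}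
    (hl : l.Nodup) (φ : (ι → Fin n) → H) {c : ι → Fin (n + 1)} (hc : ∀ a ∈ l, c a ≠ 0) :
    wordMonodromy T τ l (extendWords ι n H φ) c
      = extendWords ι n H (wordMonodromy (lowerBlock T) τ l φ) c := by
  induction l generalizing c with
  | nil => rfl
  | cons a l ih =>
    rw [List.nodup_cons] at hl
    rw [wordMonodromy_cons, wordMonodromy_cons, Module.End.mul_apply, Module.End.mul_apply,
      ← siteAct_extendWords T _ _ _ (hc a (by simp)), siteAct_apply, siteAct_apply]
    refine Finset.sum_congr rfl fun x _ => congrArg _ (ih hl.2 fun b hb => ?_)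
    rw [Function.update_of_ne (ne_of_mem_of_not_mem hb hl.1)]
    exact hc b (by simp [hb])

theorem wordMonodromy_congr (T : OpMatrix n H) (τ : ι → ℂ) {l : List ι} {p : (ι → Fin n) → Prop}
    (hp : ∀ a ∈ l, ∀ c x, p c → p (update c a x)) {φ ψ : (ι → Fin n) → H}
    (h : ∀ c, p c → φ c = ψ c) {c : ι → Fin n} (hc : p c) :
    wordMonodromy T τ l φ c = wordMonodromy T τ l ψ c := by
  induction l generalizing c with
  | nil => exact h c hc
  | cons a l ih =>
    rw [wordMonodromy_cons, Module.End.mul_apply, Module.End.mul_apply, siteAct_apply,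
      siteAct_apply]
    exact Finset.sum_congr rfl fun x _ => congrArg _
      (ih (fun b hb => hp b (by simp [hb])) (hp a (by simp) c x hc))

theorem sum_extendWords [Fintype ι] (F : (ι → Fin (n + 1)) → H →ₗ[ℂ] H) (φ : (ι → Fin n) → H) :
    ∑ d, F d (extendWords ι n H φ d) = ∑ k : ι → Fin n, F (fun a => (k a).succ) (φ k) := by
  symm
  refine Fintype.sum_of_injective (fun k a => (k a).succ) (fun k k' h => funext fun a =>
    Fin.succ_injective _ (congrFun h a)) _ _ (fun d hd => ?_) fun k => ?_
  · rcases exists_zero_or_eq_succ d with ⟨a, ha⟩ | ⟨k, rfl⟩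
    · rw [extendWords_of_zero _ ha, map_zero]
    · exact absurd ⟨k, rfl⟩ hd
  · rw [extendWords_succ]

/-- At a constant word every braiding multiplies by `f`; this turns the `merge` coming out of
`W(S₁)` into a scalar. -/
theorem merge_apply_zero (q : ℂ) (τ : ι → ℂ) (I : Finset ι) (l : List ι)
    (φ : (ι → Fin (n + 1)) → H) :
    merge (braids q (n + 1) H τ) I l φ (fun _ => 0)
      = merge (fun a b => fFun q (τ a) (τ b)) I l • φ fun _ => 0 := by
  have hm : ∀ a (l : List ι) (φ : (ι → Fin (n + 1)) → H),
      moveLeft (braids q (n + 1) H τ) a l φ (fun _ => 0)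
        = moveLeft (fun a b => fFun q (τ a) (τ b)) a l • φ fun _ => 0 := by
    intro a l
    induction l with
    | nil => simp [moveLeft]
    | cons j l ih =>
      intro φ
      rw [moveLeft, Module.End.mul_apply, braid_apply_of_eq _ _ _ _ _ _ (by rfl), ih, moveLeft,
        mul_smul]
  induction l generalizing φ with
  | nil => simp [merge]
  | cons a l ih =>
    simp only [merge]
    split_ifs
    · exact ih φ
    · rw [Module.End.mul_apply, ih, hm, mul_smul]

theorem braid_wordVac (q : ℂ) {a b : ι} (hab : a ≠ b) (u v : ℂ) (w : H) :
    braid q a b u v (wordVac ι n w) = fFun q u v • wordVac ι n w := by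
  funext c
  rw [Pi.smul_apply]
  by_cases h : c a = c b
  · rw [braid_apply_of_eq _ _ _ _ _ _ h]
  · have h1 : wordVac ι n w c = 0 := by
      rw [wordVac_apply, if_neg]
      rintro rfl
      exact h rfl
    have h2 : wordVac ι n w (update (update c a (c b)) b (c a)) = 0 := by
      rw [wordVac_apply, if_neg]
      intro e
      have e1 := congrFun e a
      have e2 := congrFun e b
      rw [Function.update_of_ne hab, Function.update_self] at e1
      rw [Function.update_self] at e2
      exact h (e2.trans e1.symm)
    rw [braid_apply_of_ne _ _ _ _ _ _ h, h1, h2]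
    simp

theorem separate_wordVac (q : ℂ) (τ : ι → ℂ) (I : Finset ι) {l : List ι} (hl : l.Nodup) (w : H) :
    separate (braids q (n + 1) H τ) I l (wordVac ι n w)
      = separate (fun a b => fFun q (τ a) (τ b)) I l • wordVac ι n w := by
  have hm : ∀ a (l : List ι), a ∉ l →
      moveRight (braids q (n + 1) H τ) a l (wordVac ι n w)
        = moveRight (fun a b => fFun q (τ a) (τ b)) a l • wordVac ι n w := by
    intro a l
    induction l with
    | nil => simp [moveRight]
    | cons j l ih =>
      intro ha
      simp only [List.mem_cons, not_or] at ha
      rw [moveRight, Module.End.mul_apply, braid_wordVac _ ha.1, map_smul, ih ha.2, moveRight,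
        smul_smul, mul_comm]
  induction l with
  | nil => simp [separate]
  | cons a l ih =>
    rw [List.nodup_cons] at hl
    simp only [separate]
    split_ifs
    · rw [Module.End.mul_apply, ih hl.2, map_smul, hm _ _ fun h => hl.1 (mem_outside.1 h).1,
        smul_smul, mul_comm]
    · exact ih hl.2

variable [Fintype ι]

/-- Creation operators are first-row entries: the outgoing word is constantly `0`, and extension by
zero restricts the incoming letters to `1, …, n`. -/
theorem sum_creation_eq (T : OpMatrix (n + 1) H) (τ : ι → ℂ) {l : List ι} (hl : l.Nodup)
    (hl' : ∀ a, a ∈ l) (φ : (ι → Fin n) → H) :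
    ∑ k : ι → Fin n, (l.map fun a => T (τ a) 0 (k a).succ).prod (φ k)
      = wordMonodromy T τ l (extendWords ι n H φ) fun _ => 0 := by
  rw [wordMonodromy_apply T τ hl]
  simp only [hl', not_true_eq_false, false_implies, implies_true, if_true]
  exact (sum_extendWords (fun d => (l.map fun a => T (τ a) 0 (d a)).prod) φ).symm

/-- The projection fixes the intermediate word between the two factors. Where its letter is nonzero
the creation happens in `S₁`; where it is `0`, `S₁` contributes its corner entry and `S₂` creates.
-/
theorem split_creation_eq (S₁ S₂ : OpMatrix (n + 1) H) (τ : ι → ℂ) {l : List ι} (hl : l.Nodup)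
    (hl' : ∀ a, a ∈ l) (I : Finset ι) (ψ : (ι → Fin n) → H) :
    wordMonodromy S₁ τ (inside I l ++ outside I l) (siteProj n H I
        (wordMonodromy S₂ τ (outside I l) (extendWords ι n H ψ))) (fun _ => 0)
      = ∑ k : ι → Fin n, ((inside I l).map fun a => S₁ (τ a) 0 (k a).succ).prod
          (((outside I l).map fun a => S₁ (τ a) 0 0).prod
            (((outside I l).map fun a => S₂ (τ a) 0 (k a).succ).prod (ψ k))) := by
  classical
  have hmem : ∀ a, a ∈ inside I l ++ outside I l := fun a =>
    ((perm_inside_append_outside I l).mem_iff).2 (hl' a)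
  have hin : ∀ a, a ∈ inside I l ↔ a ∈ I := fun a => by simp [mem_inside, hl']
  have hout : ∀ a, a ∈ outside I l ↔ a ∉ I := fun a => by simp [mem_outside, hl']
  rw [wordMonodromy_apply S₁ τ (((perm_inside_append_outside I l).nodup_iff).2 hl)]
  simp only [hmem, not_true_eq_false, false_implies, implies_true, if_true, siteProj_apply]
  have hexp : ∀ d : ι → Fin (n + 1), wordMonodromy S₂ τ (outside I l) (extendWords ι n H ψ) d
      = ∑ k : ι → Fin n, if ∀ b, b ∈ I → (k b).succ = d b then
          ((outside I l).map fun a => S₂ (τ a) (d a) (k a).succ).prod (ψ k) else 0 := by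
    intro d
    rw [wordMonodromy_apply S₂ τ (l := outside I l) (hl.filter _)]
    have := sum_extendWords (fun e : ι → Fin (n + 1) => if ∀ b, b ∈ I → e b = d b then
      ((outside I l).map fun a => S₂ (τ a) (d a) (e a)).prod else 0) ψ
    simp only [hout, not_not]
    refine (Finset.sum_congr rfl fun e _ => ?_).trans (this.trans (Finset.sum_congr rfl
      fun k _ => ?_))
    · split_ifs <;> rfl
    · split_ifs <;> rfl
  have hswap : ∀ d : ι → Fin (n + 1),
      ((inside I l ++ outside I l).map fun a => S₁ (τ a) 0 (d a)).prod
        (if nonzeroSites d = I then wordMonodromy S₂ τ (outside I l) (extendWords ι n H ψ) d else 0)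
      = ∑ k : ι → Fin n, if nonzeroSites d = I ∧ ∀ b, b ∈ I → (k b).succ = d b then
          ((inside I l ++ outside I l).map fun a => S₁ (τ a) 0 (d a)).prod
            (((outside I l).map fun a => S₂ (τ a) (d a) (k a).succ).prod (ψ k)) else 0 := by
    intro d
    by_cases h : nonzeroSites d = I
    · rw [if_pos h, hexp, map_sum]
      refine Finset.sum_congr rfl fun k _ => ?_
      simp only [h, true_and]
      split_ifs
      · rfl
      · exact map_zero _
    · simp only [h, false_and, if_false, map_zero, Finset.sum_const_zero]
  rw [Finset.sum_congr rfl fun d _ => hswap d, Finset.sum_comm]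
  refine Finset.sum_congr rfl fun k _ => ?_
  -- The only intermediate word compatible with `k`: `S₂` acts outside `I` only, and the projection
  -- forces `0` there.
  set d₀ : ι → Fin (n + 1) := fun a => if a ∈ I then (k a).succ else 0 with hd₀
  rw [Finset.sum_eq_single d₀]
  · have h1 : nonzeroSites d₀ = I := by
      ext a
      simp [nonzeroSites, hd₀]
    have h2 : ∀ b, b ∈ I → (k b).succ = d₀ b := fun b hb => by simp [hd₀, hb]
    rw [if_pos ⟨h1, h2⟩, List.map_append, List.prod_append, Module.End.mul_apply]
    have e1 : (inside I l).map (fun a => S₁ (τ a) 0 (d₀ a))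
        = (inside I l).map fun a => S₁ (τ a) 0 (k a).succ :=
      List.map_congr_left fun a ha => by simp [hd₀, (hin a).1 ha]
    have e2 : (outside I l).map (fun a => S₁ (τ a) 0 (d₀ a))
        = (outside I l).map fun a => S₁ (τ a) 0 0 :=
      List.map_congr_left fun a ha => by simp [hd₀, (hout a).1 ha]
    have e3 : (outside I l).map (fun a => S₂ (τ a) (d₀ a) (k a).succ)
        = (outside I l).map fun a => S₂ (τ a) 0 (k a).succ :=
      List.map_congr_left fun a ha => by simp [hd₀, (hout a).1 ha]
    rw [e1, e2, e3]
  · intro d _ hd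
    refine if_neg fun h => hd (funext fun a => ?_)
    by_cases ha : a ∈ I
    · simp [hd₀, ha, h.2 a ha]
    · have := (eq_zero_iff_notMem_nonzeroSites d a).2 (by rw [h.1]; exact ha)
      simp [hd₀, ha, this]
  · simp

/-- Normal ordering of the product of creation operators of a composite model. -/
theorem creation_composite {q : ℂ} (hq : q ≠ 0) {τ : ι → ℂ} (hτ : Function.Injective τ)
    (hτ0 : ∀ a, τ a ≠ 0) (hf : ∀ a b, a ≠ b → fFun q (τ a) (τ b) ≠ 0)
    {S₁ S₂ : OpMatrix (n + 1) H}
    (hS₁ : ∀ a b, a ≠ b → ExchRel q (τ a) (τ b) (S₁ (τ a)) (S₁ (τ b)))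
    (hS₂ : ∀ a b, a ≠ b → ExchRel q (τ a) (τ b) (S₂ (τ a)) (S₂ (τ b)))
    (hc : ∀ a b i j k l, Commute (S₁ (τ a) i j) (S₂ (τ b) k l))
    {l : List ι} (hl : l.Nodup) (hl' : ∀ a, a ∈ l) (φ : (ι → Fin n) → H) :
    ∑ k : ι → Fin n, (l.map fun a => (S₁ (τ a) * S₂ (τ a)) 0 (k a).succ).prod (φ k)
      = ∑ I : Finset ι, merge (fun a b => fFun q (τ a) (τ b)) I l •
          ∑ k : ι → Fin n, ((inside I l).map fun a => S₁ (τ a) 0 (k a).succ).prod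
            (((outside I l).map fun a => S₁ (τ a) 0 0).prod
              (((outside I l).map fun a => S₂ (τ a) 0 (k a).succ).prod
                (wordMonodromy (lowerBlock S₂) τ (inside I l)
                  (separate (braids q n H τ) I l φ) k))) := by
  have h0 := sum_creation_eq (fun u => S₁ u * S₂ u) τ hl hl' φ
  refine h0.trans ?_
  -- The resolution of the identity is inserted between `W(S₁)` and `W(S₂)`.
  rw [wordMonodromy_mul hc hl, Module.End.mul_apply,
    ← sum_merge_separate (n := n) hq hτ hτ0 hf hl hl'
      (wordMonodromy S₂ τ l (extendWords ι n H φ)), map_sum, Finset.sum_apply]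
  refine Finset.sum_congr rfl fun I _ => ?_
  have e1 := LinearMap.congr_fun ((swapLaw_wordMonodromy hS₁).merge I l [] (by simpa using hl))
  have e2 := LinearMap.congr_fun ((swapLaw_wordMonodromy hS₂).separate I l [] (by simpa using hl))
  simp only [Module.End.mul_apply, List.nil_append] at e1 e2
  rw [← e1, merge_apply_zero, e2, ← split_creation_eq S₁ S₂ τ hl hl' I]
  refine congrArg (_ • wordMonodromy S₁ τ _ · _) ?_
  funext c
  rw [siteProj_apply, siteProj_apply]
  split_ifs with h
  · rw [separate_extendWords q τ I hl, wordMonodromy_append, Module.End.mul_apply]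
    -- After the projection the letters in `I` are nonzero, and the factors of `S₂` outside `I` do
    -- not alter them, so at `I` only the lower block of `S₂` acts.
    refine wordMonodromy_congr S₂ τ (p := fun c => ∀ a ∈ I, c a ≠ 0) ?_ ?_ ?_
    · intro a ha d x hd b hb
      rw [Function.update_of_ne (ne_of_mem_of_not_mem hb (mem_outside.1 ha).2)]
      exact hd b hb
    · intro d hd
      exact wordMonodromy_extendWords S₂ τ (hl.filter _) _ fun a ha => hd a (mem_inside.1 ha).2
    · intro a ha h0
      rw [← h] at ha
      exact (eq_zero_iff_notMem_nonzeroSites c a).1 h0 ha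
  · rfl

end Composite

/-! ### Reordering and splitting nested monodromy matrices -/

section SiteMonodromy

open Function (update)

theorem commute_mul_apply {R : Type*} [Ring R] {n : ℕ} {x : R} {A B : Matrix (Fin n) (Fin n) R}
    (hA : ∀ i j, Commute x (A i j)) (hB : ∀ i j, Commute x (B i j)) (i j : Fin n) :
    Commute x ((A * B) i j) := by
  rw [Matrix.mul_apply]
  exact Commute.sum_right _ _ _ fun k _ => (hA i k).mul_right (hB k j)

theorem commute_list_prod_apply {R : Type*} [Ring R] {n : ℕ} {x : R}
    {L : List (Matrix (Fin n) (Fin n) R)} (h : ∀ A ∈ L, ∀ i j, Commute x (A i j)) (i j : Fin n) :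
    Commute x (L.prod i j) := by
  induction L generalizing i j with
  | nil =>
    rw [List.prod_nil, Matrix.one_apply]
    split_ifs
    · exact Commute.one_right x
    · exact Commute.zero_right x
  | cons A L ih =>
    rw [List.prod_cons]
    exact commute_mul_apply (h A (by simp)) (ih fun B hB => h B (by simp [hB])) i j

variable {ι : Type*} [DecidableEq ι] {n : ℕ} {H : Type*} [AddCommGroup H] [Module ℂ H]

/-- The product `R_{0,l_r}(u,τ_{l_r}) ⋯ R_{0,l_1}(u,τ_{l_1})`. -/
def siteChain (q : ℂ) (n : ℕ) (H : Type*) [AddCommGroup H] [Module ℂ H] (τ : ι → ℂ)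
    (l : List ι) (u : ℂ) : Matrix (Fin n) (Fin n) (Module.End ℂ ((ι → Fin n) → H)) :=
  ((l.map fun a => wordR q H a u (τ a)).reverse).prod

theorem siteMonodromy_eq (q : ℂ) (E : OpMatrix n H) (τ : ι → ℂ) (l : List ι) (u : ℂ) :
    siteMonodromy q E τ l u = compLeftMatrix _ (E u) * siteChain q n H τ l u := rfl

theorem siteChain_nil (q : ℂ) (τ : ι → ℂ) (u : ℂ) : siteChain q n H τ [] u = 1 := rfl

theorem siteChain_cons (q : ℂ) (τ : ι → ℂ) (a : ι) (l : List ι) (u : ℂ) :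
    siteChain q n H τ (a :: l) u = siteChain q n H τ l u * wordR q H a u (τ a) := by
  simp [siteChain]

theorem siteChain_append (q : ℂ) (τ : ι → ℂ) (l l' : List ι) (u : ℂ) :
    siteChain q n H τ (l ++ l') u = siteChain q n H τ l' u * siteChain q n H τ l u := by
  simp [siteChain]

theorem commute_siteChain {X : Module.End ℂ ((ι → Fin n) → H)} {q : ℂ} {τ : ι → ℂ} {l : List ι}
    {u : ℂ} (h : ∀ a ∈ l, ∀ i j, Commute X (wordR q H a u (τ a) i j)) (i j : Fin n) :
    Commute X (siteChain q n H τ l u i j) := by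
  refine commute_list_prod_apply (fun A hA => ?_) i j
  obtain ⟨a, ha, rfl⟩ := List.mem_map.1 (List.mem_reverse.1 hA)
  exact h a ha

theorem compLeft_comm_compLeft {X Y : Module.End ℂ H} (h : Commute X Y) (κ : Type*) :
    Commute (X.compLeft κ) (Y.compLeft κ) := by
  refine LinearMap.ext fun φ => funext fun c => ?_
  exact LinearMap.congr_fun h (φ c)

/-- Braidings enter as scalar matrices over the auxiliary space, so that the transport lemmas apply
in the monoid of operator matrices and treat all entries at once. -/
theorem swapLaw_siteMonodromy {q : ℂ} (hq : q ≠ 0) {τ : ι → ℂ} (hτ : Function.Injective τ)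
    (E : OpMatrix n H) {u : ℂ} (hu : ∀ a, u ≠ τ a) :
    SwapLaw (fun a b => Matrix.scalar (Fin n) (braids q n H τ a b))
      fun l => siteMonodromy q E τ l u := by
  have h : SwapLaw (fun a b => Matrix.scalar (Fin n) (braids q n H τ a b))
      fun l => siteChain q n H τ l u :=
    swapLaw_reverse_prod (fun a b hab => braid_mul_wordR hq hab (hu a) (hu b)
        fun e => hab (hτ e))
      fun a b d ha hb => scalar_mul_comm _ _ fun i j => braid_comm_wordR _ _ _ _ _ ha hb i j
  intro l₁ a b l₂ hn
  have hc := scalar_mul_comm (braids q n H τ a b) (compLeftMatrix _ (E u)) fun i j =>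
    (compLeft_comm_braid q (τ a) (τ b) (E u i j) a b).symm
  simp only [siteMonodromy_eq]
  rw [← mul_assoc, hc, mul_assoc, h l₁ a b l₂ hn, mul_assoc]

theorem separate_siteMonodromy {q : ℂ} (hq : q ≠ 0) {τ : ι → ℂ} (hτ : Function.Injective τ)
    (E : OpMatrix n H) {u : ℂ} (hu : ∀ a, u ≠ τ a) (I : Finset ι) {l : List ι} (hl : l.Nodup)
    (i j : Fin n) :
    separate (braids q n H τ) I l * siteMonodromy q E τ l u i j
      = siteMonodromy q E τ (outside I l ++ inside I l) u i j * separate (braids q n H τ) I l := by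
  have h := (swapLaw_siteMonodromy hq hτ E hu).separate I l [] (by simpa using hl)
  have e := map_separate (Matrix.scalar (Fin n) : _ →+* Matrix (Fin n) (Fin n)
    (Module.End ℂ ((ι → Fin n) → H))).toMonoidHom (braids q n H τ) I l
  change Matrix.scalar (Fin n) _ = separate (fun a b => Matrix.scalar (Fin n) _) I l at e
  rw [← e] at h
  have := congrFun (congrFun h i) j
  rwa [scalar_mul_apply, mul_scalar_apply] at this

theorem commute_wordMonodromy {X : Module.End ℂ ((ι → Fin n) → H)} {T : OpMatrix n H} {τ : ι → ℂ}
    {l : List ι} (h : ∀ a ∈ l, Commute X (siteAct a (T (τ a)))) :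
    Commute X (wordMonodromy T τ l) := by
  refine Commute.list_prod_right _ _ fun x hx => ?_
  obtain ⟨b, hb, rfl⟩ := List.mem_map.1 hx
  exact h b hb

theorem wordMonodromy_comm_wordR (q : ℂ) (T : OpMatrix n H) (τ : ι → ℂ) {l : List ι} {a : ι}
    (ha : a ∉ l) (u v : ℂ) (i j : Fin n) :
    Commute (wordMonodromy T τ l) (wordR q H a u v i j) :=
  (commute_wordMonodromy fun _ hb =>
    (siteAct_comm_wordR q u v _ (ne_of_mem_of_not_mem hb ha) i j).symm).symm

/-- The train argument: the operator at a site crosses `E(u)` together with its own `R`-factor by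
`siteAct_mul_wordR`, and commutes with the `R`-factors of all other sites. -/
theorem wordMonodromy_siteChain {q : ℂ} {E : OpMatrix n H} {τ : ι → ℂ} {u : ℂ}
    (hE : ∀ a, ExchRel q u (τ a) (E u) (E (τ a))) {l : List ι} (hl : l.Nodup) :
    Matrix.scalar (Fin n) (wordMonodromy E τ l) *
        (compLeftMatrix _ (E u) * siteChain q n H τ l u)
      = siteChain q n H τ l u *
        (compLeftMatrix _ (E u) * Matrix.scalar (Fin n) (wordMonodromy E τ l)) := by
  induction l with
  | nil => simp [siteChain_nil, wordMonodromy_nil]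
  | cons a l ih =>
    rw [List.nodup_cons] at hl
    have h1 := scalar_mul_comm (wordMonodromy E τ l) (wordR q H a u (τ a))
      (wordMonodromy_comm_wordR q E τ hl.1 u (τ a))
    have h2 := scalar_mul_comm (siteAct a (E (τ a))) (siteChain q n H τ l u)
      (commute_siteChain fun b hb i j =>
        siteAct_comm_wordR q u (τ b) _ (ne_of_mem_of_not_mem hb hl.1).symm i j)
    have h3 := siteAct_mul_wordR (hE a) a
    rw [siteChain_cons, wordMonodromy_cons, map_mul]
    calc _ = Matrix.scalar (Fin n) (siteAct a (E (τ a))) *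
          (Matrix.scalar (Fin n) (wordMonodromy E τ l) *
            (compLeftMatrix _ (E u) * siteChain q n H τ l u)) * wordR q H a u (τ a) := by
          simp only [mul_assoc]
      _ = (Matrix.scalar (Fin n) (siteAct a (E (τ a))) * siteChain q n H τ l u) *
          (compLeftMatrix _ (E u) *
            (Matrix.scalar (Fin n) (wordMonodromy E τ l) * wordR q H a u (τ a))) := by
          rw [ih hl.2]
          simp only [mul_assoc]
      _ = siteChain q n H τ l u * (Matrix.scalar (Fin n) (siteAct a (E (τ a))) *
          (compLeftMatrix _ (E u) * wordR q H a u (τ a))) *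
            Matrix.scalar (Fin n) (wordMonodromy E τ l) := by
          rw [h1, h2]
          simp only [mul_assoc]
      _ = _ := by
          rw [h3]
          simp only [mul_assoc]

/-- The product of the operators of the second factor intertwines two arrangements of sites. -/
theorem wordMonodromy_siteMonodromy {q : ℂ} {E₁ E₂ : OpMatrix n H} {τ : ι → ℂ} {u : ℂ}
    (hE : ∀ a, ExchRel q u (τ a) (E₂ u) (E₂ (τ a)))
    (hc : ∀ a i j k l, Commute (E₁ u i j) (E₂ (τ a) k l)) {l l' : List ι} (hl : l.Nodup)
    (hd : ∀ a ∈ l', a ∉ l) (i j : Fin n) :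
    wordMonodromy E₂ τ l * siteMonodromy q (fun u => E₁ u * E₂ u) τ (l' ++ l) u i j
      = (siteMonodromy q E₁ τ l u * siteMonodromy q E₂ τ l' u) i j * wordMonodromy E₂ τ l := by
  rw [← scalar_mul_apply, ← mul_scalar_apply]
  refine congrFun (congrFun ?_ i) j
  have h1 := scalar_mul_comm (wordMonodromy E₂ τ l) (compLeftMatrix _ (E₁ u)) fun i j =>
    (commute_wordMonodromy fun a _ => compLeft_comm_siteAct _ _ _ fun k l => hc a i j k l).symm
  have h2 := scalar_mul_comm (wordMonodromy E₂ τ l) (siteChain q n H τ l' u)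
    (commute_siteChain fun b hb i j => wordMonodromy_comm_wordR q E₂ τ (hd b hb) u (τ b) i j)
  have h3 := wordMonodromy_siteChain hE hl
  simp only [siteMonodromy_eq]
  rw [siteChain_append, compLeftMatrix_mul]
  -- In the order `l' ++ l` the chain of `l` stands next to `E₂(u)`. Crossing both moves that chain
  -- to the left of `E₂(u)`, where it joins `E₁(u)`; the chain of `l'` stays with `E₂(u)`.
  calc _ = (Matrix.scalar (Fin n) (wordMonodromy E₂ τ l) * compLeftMatrix _ (E₁ u)) *
        (compLeftMatrix _ (E₂ u) * siteChain q n H τ l u) * siteChain q n H τ l' u := by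
        simp only [mul_assoc]
    _ = compLeftMatrix _ (E₁ u) * (Matrix.scalar (Fin n) (wordMonodromy E₂ τ l) *
        (compLeftMatrix _ (E₂ u) * siteChain q n H τ l u)) * siteChain q n H τ l' u := by
        rw [h1]
        simp only [mul_assoc]
    _ = compLeftMatrix _ (E₁ u) * (siteChain q n H τ l u * compLeftMatrix _ (E₂ u)) *
        (Matrix.scalar (Fin n) (wordMonodromy E₂ τ l) * siteChain q n H τ l' u) := by
        rw [h3]
        simp only [mul_assoc]
    _ = _ := by
        rw [h2]
        simp only [mul_assoc]

theorem exchRel_one (q u v : ℂ) {X : Type*} [AddCommGroup X] [Module ℂ X] :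
    ExchRel q u v (1 : Matrix (Fin n) (Fin n) (Module.End ℂ X)) 1 := by
  intro F i k
  have h : ∀ (G : Fin n → X) (x : Fin n),
      ∑ y, (1 : Matrix (Fin n) (Fin n) (Module.End ℂ X)) x y (G y) = G x := by
    intro G x
    rw [Finset.sum_eq_single x]
    · simp
    · intro y _ hy
      simp [Matrix.one_apply_ne hy.symm]
    · simp
  simp only [h]

/-- `ExchRel.mul` applied one `R`-factor at a time, since distinct sites commute. Yang–Baxter is
what requires `u` and `v` to avoid the site parameters. -/
theorem exchRel_siteMonodromy {q : ℂ} (hq : q ≠ 0) {E : OpMatrix n H} {τ : ι → ℂ} {u v : ℂ}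
    (huv : u ≠ v) (hu : ∀ a, u ≠ τ a) (hv : ∀ a, v ≠ τ a) (hE : ExchRel q u v (E u) (E v))
    {l : List ι} (hl : l.Nodup) :
    ExchRel q u v (siteMonodromy q E τ l u) (siteMonodromy q E τ l v) := by
  have hchain : ExchRel q u v (siteChain q n H τ l u) (siteChain q n H τ l v) := by
    induction l with
    | nil => exact exchRel_one q u v
    | cons a l ih =>
      rw [List.nodup_cons] at hl
      rw [siteChain_cons, siteChain_cons]
      refine (ih hl.2).mul (exchRel_wordR hq a huv (hu a) (hv a)) (fun i j k m => ?_)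
        fun i j k m => ?_
      · exact commute_siteChain (fun b hb k m => wordR_comm_wordR q _ _ _ _
          (ne_of_mem_of_not_mem hb hl.1).symm _ _ _ _) _ _
      · exact (commute_siteChain (fun b hb k m => wordR_comm_wordR q _ _ _ _
          (ne_of_mem_of_not_mem hb hl.1).symm _ _ _ _) _ _).symm
  refine (hE.compLeft _).mul hchain (fun i j k m => ?_) fun i j k m => ?_
  · exact (commute_siteChain (fun a _ k m => compLeft_comm_wordR q _ _ _ _ _ _) _ _).symm
  · exact commute_siteChain (fun a _ k m => compLeft_comm_wordR q _ _ _ _ _ _) _ _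

theorem commute_siteMonodromy {q : ℂ} {E₁ E₂ : OpMatrix n H} {τ : ι → ℂ} {u v : ℂ}
    (hc : ∀ i j k l, Commute (E₁ u i j) (E₂ v k l)) {l l' : List ι}
    (hd : ∀ a ∈ l', a ∉ l) (i j k m : Fin n) :
    Commute (siteMonodromy q E₁ τ l u i j) (siteMonodromy q E₂ τ l' v k m) := by
  refine commute_mul_apply (fun k m => ?_) (commute_siteChain fun b hb k m => ?_) k m
  · refine (commute_mul_apply (fun i j => ?_) (commute_siteChain fun a ha i j => ?_) i j).symm
    · exact (compLeft_comm_compLeft (hc i j k m) _).symm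
    · exact compLeft_comm_wordR q _ _ _ _ _ _
  · refine (commute_mul_apply (fun i j => ?_) (commute_siteChain fun a ha i j => ?_) i j).symm
    · exact (compLeft_comm_wordR q _ _ (E₁ u i j) _ _ _).symm
    · exact wordR_comm_wordR q _ _ _ _ (ne_of_mem_of_not_mem ha (hd b hb)).symm _ _ _ _

end SiteMonodromy

/-! ### Pseudovacua of nested monodromy matrices -/

section Vacuum

open Function (update)

variable {ι : Type*} [DecidableEq ι] {n : ℕ} {H : Type*} [AddCommGroup H] [Module ℂ H]

/-- `w` is a pseudovacuum with vacuum eigenvalues `lam` for `T` at the points of `D`. -/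
def IsVacuum (D : Set ℂ) (T : OpMatrix n H) (lam : Fin n → ℂ → ℂ) (w : H) : Prop :=
  ∀ u ∈ D, (∀ i j, j < i → T u i j w = 0) ∧ ∀ i, T u i i w = lam i u • w

theorem wordR_apply_of_vanish (q : ℂ) (a : ι) (u v : ℂ) {φ : (ι → Fin (n + 1)) → H}
    (hφ : ∀ c : ι → Fin (n + 1), c a ≠ 0 → φ c = 0) {i j : Fin (n + 1)} (hij : j < i) :
    wordR q H a u v i j φ = 0 := by
  funext c
  rw [wordR_apply]
  refine Finset.sum_eq_zero fun x _ => ?_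
  by_cases hx : x = 0
  · have : RMatrix q (n + 1) u v (i, c a) (j, x) = 0 := by
      rw [RMatrix_apply]
      have h1 : j ≠ i := hij.ne
      have h2 : x ≠ i := by
        rw [hx]
        rintro rfl
        exact absurd hij (by simp)
      simp [h1, h2]
    rw [this, zero_smul]
  · rw [hφ _ (by simpa using hx), smul_zero]

theorem wordR_apply_diag (q : ℂ) (a : ι) (u v : ℂ) {φ : (ι → Fin (n + 1)) → H}
    (hφ : ∀ c : ι → Fin (n + 1), c a ≠ 0 → φ c = 0) (i : Fin (n + 1)) :
    wordR q H a u v i i φ = (if i = 0 then fFun q u v else 1) • φ := by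
  funext c
  rw [wordR_apply, Finset.sum_eq_single 0]
  · rw [RMatrix_apply, Pi.smul_apply]
    by_cases hc : c a = 0
    · have : update c a 0 = c := by rw [← hc, Function.update_eq_self]
      rw [this]
      by_cases hi : i = 0
      · simp [hi, hc]
      · simp [hi, hc]
    · rw [hφ c hc, smul_zero]
      by_cases hi : i = c a
      · rw [if_pos hi, if_neg (fun h => hc h.2.symm), zero_smul]
      · rw [if_neg hi, if_neg (fun h => hc h.2.symm), if_neg (fun h => hi h.1), zero_smul]
  · intro x _ hx
    rw [hφ _ (by simpa using hx), smul_zero]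
  · simp

/-- A product of upper triangular actions. In `∑ₖ M_{ik} R_{kj}`, terms with `j < k` die by
triangularity of `R` on the first letter and terms with `k < i` by induction. The hypotheses on `φ`
concern only the sites of `l`, because `R_{kj} φ` need no longer be a vacuum at the site just
removed. -/
theorem siteMonodromy_vacuum (q : ℂ) {E : OpMatrix (n + 1) H} (τ : ι → ℂ)
    {lam : Fin (n + 1) → ℂ} {u : ℂ} {l : List ι} (hl : l.Nodup) {φ : (ι → Fin (n + 1)) → H}
    (h0 : ∀ c i j, j < i → E u i j (φ c) = 0) (h1 : ∀ c i, E u i i (φ c) = lam i • φ c)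
    (hφ : ∀ a ∈ l, ∀ c : ι → Fin (n + 1), c a ≠ 0 → φ c = 0) :
    (∀ i j, j < i → siteMonodromy q E τ l u i j φ = 0) ∧
      ∀ i, siteMonodromy q E τ l u i i φ
        = (lam i * if i = 0 then (l.map fun a => fFun q u (τ a)).prod else 1) • φ := by
  induction l generalizing φ with
  | nil =>
    have e : siteMonodromy q E τ [] u = compLeftMatrix _ (E u) := by
      rw [siteMonodromy_eq, siteChain_nil, mul_one]
    rw [e]
    refine ⟨fun i j hij => funext fun c => h0 c i j hij, fun i => funext fun c => ?_⟩
    simpa [compLeftMatrix_apply] using h1 c i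
  | cons a l ih =>
    rw [List.nodup_cons] at hl
    have e : siteMonodromy q E τ (a :: l) u = siteMonodromy q E τ l u * wordR q H a u (τ a) := by
      rw [siteMonodromy_eq, siteChain_cons, ← mul_assoc, siteMonodromy_eq]
    have ih' : ∀ k j, _ := fun k j => ih (φ := wordR q H a u (τ a) k j φ) hl.2
      (fun c i j hij => by
        rw [wordR_apply, map_sum]
        exact Finset.sum_eq_zero fun x _ => by rw [map_smul, h0 _ _ _ hij, smul_zero])
      (fun c i => by
        rw [wordR_apply, map_sum, Finset.smul_sum]
        exact Finset.sum_congr rfl fun x _ => by rw [map_smul, h1, smul_comm])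
      (fun b hb c hc => by
        rw [wordR_apply]
        refine Finset.sum_eq_zero fun x _ => ?_
        rw [hφ b (by simp [hb]), smul_zero]
        rwa [Function.update_of_ne (ne_of_mem_of_not_mem hb hl.1)])
    have ha := hφ a (by simp)
    rw [e]
    constructor
    · intro i j hij
      rw [Matrix.mul_apply, LinearMap.sum_apply]
      refine Finset.sum_eq_zero fun k _ => ?_
      rw [Module.End.mul_apply]
      by_cases hk : j < k
      · rw [wordR_apply_of_vanish q a u _ ha hk, map_zero]
      · exact (ih' k j).1 i k (lt_of_le_of_lt (not_lt.1 hk) hij)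
    · intro i
      rw [Matrix.mul_apply, LinearMap.sum_apply, Finset.sum_eq_single i]
      · rw [Module.End.mul_apply, (ih' i i).2 i, wordR_apply_diag q a u _ ha, smul_smul]
        congr 1
        split_ifs
        · simp only [List.map_cons, List.prod_cons]
          ring
        · ring
      · intro k _ hk
        rw [Module.End.mul_apply]
        rcases lt_or_gt_of_ne hk with h | h
        · exact (ih' k i).1 i k h
        · rw [wordR_apply_of_vanish q a u _ ha h, map_zero]
      · simp

theorem siteAct_wordVac (a : ι) {A : Matrix (Fin (n + 1)) (Fin (n + 1)) (Module.End ℂ H)} {w : H}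
    {r : ℂ} (h0 : ∀ i, 0 < i → A i 0 w = 0) (h1 : A 0 0 w = r • w) :
    siteAct a A (wordVac ι n w) = r • wordVac ι n w := by
  funext c
  rw [siteAct_apply, Pi.smul_apply, Finset.sum_eq_single 0]
  · by_cases hc : ∀ b, b ≠ a → c b = 0
    · have e1 : update c a 0 = fun _ => 0 := by
        funext b
        by_cases hb : b = a
        · subst hb
          simp
        · simp [hb, hc b hb]
      rw [wordVac_apply, if_pos e1, wordVac_apply]
      by_cases hca : c a = 0
      · have e2 : c = fun _ => 0 := by
          rw [← e1, ← hca, Function.update_eq_self]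
        rw [if_pos e2, hca, h1]
      · rw [if_neg (fun e => hca (congrFun e a)), smul_zero]
        exact h0 _ (Fin.pos_iff_ne_zero.2 hca)
    · push Not at hc
      obtain ⟨b, hb, hcb⟩ := hc
      rw [wordVac_apply, wordVac_apply, if_neg, if_neg, map_zero, smul_zero]
      · exact fun e => hcb (congrFun e b)
      · intro e
        have := congrFun e b
        rw [Function.update_of_ne hb] at this
        exact hcb this
  · intro x _ hx
    rw [wordVac_apply, if_neg, map_zero]
    intro e
    have := congrFun e a
    rw [Function.update_self] at this
    exact hx this
  · simp

theorem wordMonodromy_wordVac {T : OpMatrix (n + 1) H} {τ : ι → ℂ} {w : H} {lam : ℂ → ℂ}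
    (h0 : ∀ a i, 0 < i → T (τ a) i 0 w = 0) (h1 : ∀ a, T (τ a) 0 0 w = lam (τ a) • w)
    (l : List ι) :
    wordMonodromy T τ l (wordVac ι n w) = prodOver lam (l.map τ) • wordVac ι n w := by
  induction l with
  | nil => simp [wordMonodromy_nil, prodOver]
  | cons a l ih =>
    rw [wordMonodromy_cons, Module.End.mul_apply, ih, map_smul,
      siteAct_wordVac a (h0 a) (h1 a), smul_smul]
    simp [prodOver, mul_comm]

end Vacuum

/-! ### Lower blocks and the kernel of the first column -/

section Reduction

variable {n : ℕ} {H : Type*} [AddCommGroup H] [Module ℂ H]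

theorem ExchRel.apply_of_ne {q u v : ℂ} {A B : Matrix (Fin n) (Fin n) (Module.End ℂ H)}
    (h : ExchRel q u v A B) {j l : Fin n} (hjl : j ≠ l) (i k : Fin n) (w : H) :
    exch q u v (fun x y => A x j (B y l w)) i k
      = B k l (A i j w) + swapCoeff q u v l j • B k j (A i l w) := by
  have key := h (fun x y => if x = j then if y = l then w else 0 else 0) i k
  simp only [apply_ite (A _ _), apply_ite (B _ _), map_zero, Finset.sum_ite_eq',
    Finset.mem_univ, if_true, Finset.sum_ite_irrel, Finset.sum_const_zero] at key
  rw [key]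
  have e : ∀ x y, exch q u v (fun x y => if x = j then if y = l then w else 0 else 0) x y
      = (if x = j then if y = l then w else 0 else 0)
        + if x = l then if y = j then swapCoeff q u v l j • w else 0 else 0 := by
    intro x y
    unfold exch
    by_cases hxy : x = y
    · subst hxy
      rw [if_pos rfl]
      by_cases h1 : x = j
      · subst h1
        simp [hjl]
      · simp [h1]
    · rw [if_neg hxy]
      congr 1
      by_cases h1 : x = l
      · by_cases h2 : y = j
        · simp [h1, h2]
        · simp [h1, h2]
      · simp [h1]
  simp only [e, map_add, Finset.sum_add_distrib, apply_ite (A _ _), apply_ite (B _ _), map_zero,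
    map_smul, Finset.sum_ite_eq', Finset.mem_univ, if_true]

theorem exch_eq_zero {q u v : ℂ} {F : Fin n → Fin n → H} {i k : Fin n} (h1 : F i k = 0)
    (h2 : F k i = 0) : exch q u v F i k = 0 := by
  unfold exch
  split_ifs <;> simp [h1, h2]

/-- The lower block preserves the common kernel of the first column. -/
theorem ExchRel.kernel_lowerBlock {q u v : ℂ}
    {A B : Matrix (Fin (n + 1)) (Fin (n + 1)) (Module.End ℂ H)} (h : ExchRel q u v A B) {x : H}
    (hA : ∀ j : Fin n, A j.succ 0 x = 0) (hB : ∀ j : Fin n, B j.succ 0 x = 0) (a b c : Fin n) :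
    B c.succ 0 (A a.succ b.succ x) = 0 := by
  have key := h.apply_of_ne (Fin.succ_ne_zero b) a.succ c.succ x
  rw [exch_eq_zero (by rw [hB, map_zero]) (by rw [hB, map_zero]), hA, map_zero, smul_zero,
    add_zero] at key
  exact key.symm

/-- On the common kernel of the first column, the upper left entry commutes with the lower
block. -/
theorem ExchRel.diag_lowerBlock {q u v : ℂ}
    {A B : Matrix (Fin (n + 1)) (Fin (n + 1)) (Module.End ℂ H)} (h : ExchRel q u v A B) {x : H}
    (hA : ∀ j : Fin n, A j.succ 0 x = 0) (hB : ∀ j : Fin n, B j.succ 0 x = 0) (a b : Fin n) :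
    B 0 0 (A a.succ b.succ x) = A a.succ b.succ (B 0 0 x) := by
  have key := h.apply_of_ne (Fin.succ_ne_zero b) a.succ 0 x
  rw [hA, map_zero, smul_zero, add_zero, exch, if_neg (Fin.succ_ne_zero a), hB, map_zero,
    smul_zero, add_zero] at key
  exact key.symm

theorem RMatrix_succ (q : ℂ) (u v : ℂ) (i k j l : Fin n) :
    RMatrix q (n + 1) u v (i.succ, k.succ) (j.succ, l.succ) = RMatrix q n u v (i, k) (j, l) := by
  simp only [RMatrix_apply, swapCoeff, Fin.succ_inj, Fin.succ_lt_succ_iff]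

theorem RMatrix_eq_zero {q : ℂ} {u v : ℂ} {i k j l : Fin n} (h1 : ¬ (j = i ∧ l = k))
    (h2 : ¬ (j = k ∧ l = i)) : RMatrix q n u v (i, k) (j, l) = 0 := by
  rw [RMatrix_apply, if_neg h1, if_neg h2, if_neg h1, ite_self]

/-- By letter conservation the letters `1, …, n` span an invariant subspace of `R`, on which `R` is
the `R`-matrix of rank one less. -/
theorem ExchRel.lowerBlock {q u v : ℂ} {A B : OpMatrix (n + 1) H} (h : ExchRel q u v (A u) (B v)) :
    ExchRel q u v (lowerBlock A u) (lowerBlock B v) := by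
  rw [exchRel_iff_components] at h ⊢
  intro i k j l
  have key := h i.succ k.succ j.succ l.succ
  have z1 : ∀ y, RMatrix q (n + 1) u v (i.succ, k.succ) (0, y) = 0 := fun y =>
    RMatrix_eq_zero (fun h => Fin.succ_ne_zero _ h.1.symm) fun h => Fin.succ_ne_zero _ h.1.symm
  have z2 : ∀ x, RMatrix q (n + 1) u v (i.succ, k.succ) (x, 0) = 0 := fun y =>
    RMatrix_eq_zero (fun h => Fin.succ_ne_zero _ h.2.symm) fun h => Fin.succ_ne_zero _ h.2.symm
  have z3 : ∀ y, RMatrix q (n + 1) u v (0, y) (j.succ, l.succ) = 0 := fun y =>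
    RMatrix_eq_zero (fun h => Fin.succ_ne_zero _ h.1) fun h => Fin.succ_ne_zero _ h.2
  have z4 : ∀ x, RMatrix q (n + 1) u v (x, 0) (j.succ, l.succ) = 0 := fun y =>
    RMatrix_eq_zero (fun h => Fin.succ_ne_zero _ h.2) fun h => Fin.succ_ne_zero _ h.1
  simp only [Fin.sum_univ_succ (n := n), z1, z2, z3, z4, zero_smul, Finset.sum_const_zero, zero_add,
    RMatrix_succ] at key
  exact key

/-- The pairs `(x, x)` where `x` is annihilated by the first column of `S` at the points of `U` and
at the points `τ a`, and is an eigenvector of the upper left entries at the points `τ a`. -/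
def columnKernelRel {ι : Type*} (S : OpMatrix (n + 1) H) (τ : ι → ℂ) (lam : ι → ℂ) (U : Set ℂ) :
    Submodule ℂ (H × H) where
  carrier := {p | p.1 = p.2 ∧ (∀ u ∈ U, ∀ j : Fin n, S u j.succ 0 p.1 = 0) ∧
    (∀ a, ∀ j : Fin n, S (τ a) j.succ 0 p.1 = 0) ∧ ∀ a, S (τ a) 0 0 p.1 = lam a • p.1}
  add_mem' := by
    rintro p p' ⟨h1, h2, h3, h4⟩ ⟨h1', h2', h3', h4'⟩
    refine ⟨?_, fun u hu j => ?_, fun a j => ?_, fun a => ?_⟩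
    · rw [Prod.fst_add, Prod.snd_add, h1, h1']
    · rw [Prod.fst_add, map_add, h2 u hu, h2' u hu, add_zero]
    · rw [Prod.fst_add, map_add, h3, h3', add_zero]
    · rw [Prod.fst_add, map_add, h4, h4', smul_add]
  zero_mem' := by simp
  smul_mem' := by
    rintro r p ⟨h1, h2, h3, h4⟩
    refine ⟨?_, fun u hu j => ?_, fun a j => ?_, fun a => ?_⟩
    · rw [Prod.smul_fst, Prod.smul_snd, h1]
    · rw [Prod.smul_fst, map_smul, h2 u hu, smul_zero]
    · rw [Prod.smul_fst, map_smul, h3, smul_zero]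
    · rw [Prod.smul_fst, map_smul, h4, smul_comm]

/-- The two matrices differ by `S₁_{i0} S₂_{0j} = S₂_{0j} S₁_{i0}`, which kills vectors in the
kernel of the first column of `S₁`. The exchange relation preserves this kernel at parameters other
than `u` only, which is why `u` is dropped from `U`. -/
theorem mapsRel_lowerBlock_composite {ι : Type*} {q : ℂ} {D : Set ℂ} {S₁ S₂ : OpMatrix (n + 1) H}
    {τ : ι → ℂ} (lam : ι → ℂ) (hτ : ∀ a, τ a ∈ D)
    (h₁ : ∀ u ∈ D, ∀ v ∈ D, u ≠ v → ExchRel q u v (S₁ u) (S₁ v))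
    (hc : ∀ u ∈ D, ∀ v ∈ D, ∀ i j k l, Commute (S₁ u i j) (S₂ v k l)) {U : Set ℂ}
    (hU : U ⊆ {u ∈ D | ∀ a, u ≠ τ a}) {u : ℂ} (hu : u ∈ U) :
    MapsRel (lowerBlock (fun u => S₁ u * S₂ u) u) (lowerBlock S₁ u * lowerBlock S₂ u)
      (columnKernelRel S₁ τ lam U) (columnKernelRel S₁ τ lam (U \ {u})) := by
  have huD := (hU hu).1
  rintro i j ⟨x, x'⟩ ⟨h1, h2, h3, h4⟩
  obtain rfl : x = x' := h1
  dsimp only at h2 h3 h4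
  have hS : ∀ k l, ∀ v ∈ D, ∀ k' l', S₁ v k l (S₂ u k' l' x) = S₂ u k' l' (S₁ v k l x) :=
    fun k l v hv k' l' => LinearMap.congr_fun (hc v hv u huD k l k' l') x
  have hk : ∀ k l : Fin n, (S₁ u k.succ l.succ (S₂ u l.succ j.succ x),
      S₁ u k.succ l.succ (S₂ u l.succ j.succ x)) ∈ columnKernelRel S₁ τ lam (U \ {u}) := by
    intro k l
    set y := S₂ u l.succ j.succ x with hy
    have y2 : ∀ v ∈ U, ∀ j : Fin n, S₁ v j.succ 0 y = 0 := fun v hv j => by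
      rw [hy, hS _ _ v (hU hv).1, h2 v hv, map_zero]
    have y3 : ∀ a, ∀ j : Fin n, S₁ (τ a) j.succ 0 y = 0 := fun a j => by
      rw [hy, hS _ _ _ (hτ a), h3, map_zero]
    have y4 : ∀ a, S₁ (τ a) 0 0 y = lam a • y := fun a => by
      rw [hy, hS _ _ _ (hτ a), h4, map_smul]
    refine ⟨rfl, fun v hv c => ?_, fun a c => ?_, fun a => ?_⟩
    · exact (h₁ u huD v (hU hv.1).1 (Ne.symm hv.2)).kernel_lowerBlock (y2 u hu) (y2 v hv.1) _ _ _
    · exact (h₁ u huD _ (hτ a) ((hU hu).2 a)).kernel_lowerBlock (y2 u hu) (y3 a) _ _ _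
    · exact ((h₁ u huD _ (hτ a) ((hU hu).2 a)).diag_lowerBlock (y2 u hu) (y3 a) _ _).trans
        (by rw [y4, map_smul])
  have e1 : lowerBlock (fun u => S₁ u * S₂ u) u i j x
      = ∑ l : Fin n, S₁ u i.succ l.succ (S₂ u l.succ j.succ x) := by
    change (∑ k, S₁ u i.succ k * S₂ u k j.succ) x = _
    rw [LinearMap.sum_apply, Fin.sum_univ_succ, Module.End.mul_apply, hS _ _ u huD, h2 u hu,
      map_zero, zero_add]
    rfl
  have e2 : (lowerBlock S₁ u * lowerBlock S₂ u) i j x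
      = ∑ l : Fin n, S₁ u i.succ l.succ (S₂ u l.succ j.succ x) := by
    rw [Matrix.mul_apply, LinearMap.sum_apply]
    rfl
  change (lowerBlock (fun u => S₁ u * S₂ u) u i j x, (lowerBlock S₁ u * lowerBlock S₂ u) i j x) ∈ _
  rw [e1, e2, mk_sum_sum]
  exact Submodule.sum_mem _ fun l _ => hk i l

variable {ι : Type*} [DecidableEq ι]

/-- An eigenvector, componentwise, of an operator commuting with the entries of `E` stays one
after reordering and applying the operators of `E`. -/
theorem apply_wordMonodromy_separate {q : ℂ} {A : Module.End ℂ H} {E : OpMatrix n H} {τ : ι → ℂ}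
    (hA : ∀ a i j, Commute A (E (τ a) i j)) (I : Finset ι) {l l' : List ι} (hl : l.Nodup)
    {φ : (ι → Fin n) → H} {r : ℂ} (hφ : ∀ c, A (φ c) = r • φ c) (k : ι → Fin n) :
    A (wordMonodromy E τ l' (separate (braids q n H τ) I l φ) k)
      = r • wordMonodromy E τ l' (separate (braids q n H τ) I l φ) k := by
  have h1 : Commute (A.compLeft (ι → Fin n)) (wordMonodromy E τ l') :=
    commute_wordMonodromy fun a _ => compLeft_comm_siteAct _ _ _ (hA a)
  have h2 : Commute (A.compLeft (ι → Fin n)) (separate (braids q n H τ) I l) :=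
    separate_induction (Commute.one_right _) (fun _ _ => Commute.mul_right) I l hl
      fun a _ b _ _ => compLeft_comm_braid _ _ _ _ _ _
  have h3 := LinearMap.congr_fun (h1.mul_right h2) φ
  have h4 : A.compLeft (ι → Fin n) φ = r • φ := funext hφ
  simp only [Module.End.mul_apply, h4, map_smul] at h3
  exact congrFun h3 k

theorem list_prod_apply_eigen {κ : Type*} {l : List κ} {A : κ → Module.End ℂ H} {r : κ → ℂ} {x : H}
    (h : ∀ a ∈ l, A a x = r a • x) : (l.map A).prod x = (l.map r).prod • x := by
  induction l with
  | nil => simp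
  | cons a l ih =>
    rw [List.map_cons, List.prod_cons, Module.End.mul_apply, ih fun b hb => h b (by simp [hb]),
      map_smul, h a (by simp), smul_smul]
    simp [mul_comm]

end Reduction

/-! ### One level of the nested ansatz for a composite model -/

section Step

variable {N : ℕ} {H : Type u} [AddCommGroup H] [Module ℂ H] {ι : Type} [Fintype ι] [DecidableEq ι]

theorem fProd_map_map {κ κ' : Type*} (q : ℂ) (τ : κ → ℂ) (τ' : κ' → ℂ) (l : List κ)
    (l' : List κ') : fProd q (l.map τ) (l'.map τ')
      = (l.map fun i => (l'.map fun j => fFun q (τ i) (τ' j)).prod).prod := by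
  simp [fProd, Function.comp_def]

/-- The first step of the nested Bethe ansatz for a composite model. -/
theorem betheVector_composite_succ {q : ℂ} (hq : q ≠ 0) {D : Set ℂ} {S₁ S₂ : OpMatrix (N + 2) H}
    (h₁ : ∀ u ∈ D, ∀ v ∈ D, u ≠ v → ExchRel q u v (S₁ u) (S₁ v))
    (h₂ : ∀ u ∈ D, ∀ v ∈ D, u ≠ v → ExchRel q u v (S₂ u) (S₂ v))
    (hc : ∀ u ∈ D, ∀ v ∈ D, ∀ i j k l, Commute (S₁ u i j) (S₂ v k l))
    {lam₁ lam₂ : Fin (N + 2) → ℂ → ℂ} {w : H} (hw₁ : IsVacuum D S₁ lam₁ w)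
    (hw₂ : IsVacuum D S₂ lam₂ w) {τ : ι → ℂ} (hτ : Function.Injective τ) (hτ0 : ∀ a, τ a ≠ 0)
    (hτD : ∀ a, τ a ∈ D) (hf : ∀ a b, a ≠ b → fFun q (τ a) (τ b) ≠ 0)
    {lam : Fin (N + 1) → ℂ → ℂ} {t : Fin N → List ℂ} (ht : (List.ofFn t).flatten.Nodup)
    (htD : ∀ u ∈ (List.ofFn t).flatten, u ∈ D ∧ ∀ a, u ≠ τ a)
    {l : List ι} (hl : l.Nodup) (hl' : ∀ a, a ∈ l) :
    ∑ k : ι → Fin (N + 1), (l.map fun a => (S₁ (τ a) * S₂ (τ a)) 0 (k a).succ).prod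
        (betheVector q N (siteMonodromy q (lowerBlock fun u => S₁ u * S₂ u) τ l) lam
          (wordVac ι N w) t k)
      = ∑ I : Finset ι,
          (fProd q ((inside I l).map τ) ((outside I l).map τ) *
            (prodOver (lam₂ 1) ((inside I l).map τ) * prodOver (lam₁ 0) ((outside I l).map τ))) •
          ∑ k : ι → Fin (N + 1), ((inside I l).map fun a => S₁ (τ a) 0 (k a).succ).prod
            (((outside I l).map fun a => S₂ (τ a) 0 (k a).succ).prod
              (betheVector q N (fun u => siteMonodromy q (lowerBlock S₁) τ (inside I l) u
                  * siteMonodromy q (lowerBlock S₂) τ (outside I l) u) lam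
                (wordVac ι N w) t k)) := by
  set Φ := betheVector q N (siteMonodromy q (lowerBlock fun u => S₁ u * S₂ u) τ l) lam
    (wordVac ι N w) t with hΦ
  set Φ' := betheVector q N (siteMonodromy q (fun u => lowerBlock S₁ u * lowerBlock S₂ u) τ l) lam
    (wordVac ι N w) t with hΦ'
  -- This yields both the replacement of the lower block of `S₁ S₂` by the product of lower blocks
  -- and the eigenvalues of `S₁_{00}(τ a)` on the nested Bethe vector.
  have hrel := betheVector_rel q N (siteMonodromy q (lowerBlock fun u => S₁ u * S₂ u) τ l)
    (siteMonodromy q (fun u => lowerBlock S₁ u * lowerBlock S₂ u) τ l) lam (wordVac ι N w)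
    (wordVac ι N w) t
    (fun U => liftRel _ (columnKernelRel S₁ τ (fun a => lam₁ 0 (τ a)) U))
    {u ∈ D | ∀ a, u ≠ τ a}
    (fun U hU u hu => mapsRel_siteMonodromy q τ l
      (mapsRel_lowerBlock_composite _ hτD h₁ hc hU hu)) ht htD (by
      intro c
      change (wordVac ι N w c, wordVac ι N w c) ∈ _
      rw [wordVac_apply]
      split_ifs
      · exact ⟨rfl, fun u hu j => (hw₁ u hu.1).1 _ _ (Fin.succ_pos j),
          fun a j => (hw₁ _ (hτD a)).1 _ _ (Fin.succ_pos j), fun a => (hw₁ _ (hτD a)).2 0⟩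
      · exact Submodule.zero_mem _)
  have hΦΦ' : Φ = Φ' := funext fun c => (hrel c).1
  have hA : ∀ a c, S₁ (τ a) 0 0 (Φ' c) = lam₁ 0 (τ a) • Φ' c := fun a c => by
    rw [← hΦΦ']
    exact (hrel c).2.2.2 a
  rw [hΦΦ', creation_composite hq hτ hτ0 hf (fun a b hab => h₁ _ (hτD a) _ (hτD b) (hτ.ne hab))
    (fun a b hab => h₂ _ (hτD a) _ (hτD b) (hτ.ne hab))
    (fun a b => hc _ (hτD a) _ (hτD b)) hl hl']
  refine Finset.sum_congr rfl fun I _ => ?_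
  have hD₂ : ∀ u ∈ D, ∀ v ∈ D, u ≠ v → ExchRel q u v (lowerBlock S₂ u) (lowerBlock S₂ v) :=
    fun u hu v hv huv => (h₂ u hu v hv huv).lowerBlock
  -- Reordering and the lower block of `S₂` on `I` give an intertwiner. Its scalar on the
  -- pseudovacuum is the product of the `f` factors from `separate` and of `λ_2` of the second model
  -- over `I`.
  have hW := betheVector_intertwine q N
    (siteMonodromy q (fun u => lowerBlock S₁ u * lowerBlock S₂ u) τ l)
    (fun u => siteMonodromy q (lowerBlock S₁) τ (inside I l) u
      * siteMonodromy q (lowerBlock S₂) τ (outside I l) u) lam (wordVac ι N w) (wordVac ι N w) t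
    (wordMonodromy (lowerBlock S₂) τ (inside I l) * separate (braids q (N + 1) H τ) I l)
    (separate (fun a b => fFun q (τ a) (τ b)) I l * prodOver (lam₂ 1) ((inside I l).map τ)) ht
    (fun u hu i j x => by
      obtain ⟨huD, huτ⟩ := htD u hu
      have e1 := LinearMap.congr_fun (separate_siteMonodromy hq hτ
        (fun u => lowerBlock S₁ u * lowerBlock S₂ u) huτ I hl i j) x
      have e2 := LinearMap.congr_fun (wordMonodromy_siteMonodromy (E₁ := lowerBlock S₁)
        (E₂ := lowerBlock S₂) (l := inside I l) (l' := outside I l)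
        (fun a => hD₂ u huD _ (hτD a) (huτ a))
        (fun a i j k l => hc u huD _ (hτD a) _ _ _ _) (hl.filter _)
        (fun a ha h => (mem_outside.1 ha).2 (mem_inside.1 h).2) i j)
        (separate (braids q (N + 1) H τ) I l x)
      exact (congrArg (wordMonodromy (lowerBlock S₂) τ (inside I l)) e1).trans e2)
    (by
      rw [Module.End.mul_apply, separate_wordVac q τ I hl, map_smul,
        wordMonodromy_wordVac (T := lowerBlock S₂) (lam := lam₂ 1)
          (fun a i hi => (hw₂ _ (hτD a)).1 _ _ (Fin.succ_lt_succ_iff.2 hi))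
          (fun a => (hw₂ _ (hτD a)).2 1), smul_smul])
  rw [Module.End.mul_apply, ← hΦ'] at hW
  set Ψ := betheVector q N (fun u => siteMonodromy q (lowerBlock S₁) τ (inside I l) u
      * siteMonodromy q (lowerBlock S₂) τ (outside I l) u) lam (wordVac ι N w) t with hΨ
  -- The corner entries of `S₁` commute with everything coming from `S₂` and with the reordering, so
  -- they reach the nested Bethe vector and become eigenvalues.
  have hk : ∀ k : ι → Fin (N + 1), ((outside I l).map fun a => S₁ (τ a) 0 0).prod
      (((outside I l).map fun a => S₂ (τ a) 0 (k a).succ).prod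
        (wordMonodromy (lowerBlock S₂) τ (inside I l) (separate (braids q (N + 1) H τ) I l Φ') k))
      = (prodOver (lam₁ 0) ((outside I l).map τ) *
          (separate (fun a b => fFun q (τ a) (τ b)) I l *
            prodOver (lam₂ 1) ((inside I l).map τ))) •
        ((outside I l).map fun a => S₂ (τ a) 0 (k a).succ).prod (Ψ k) := by
    intro k
    have e : Commute ((outside I l).map fun a => S₁ (τ a) 0 0).prod
        ((outside I l).map fun a => S₂ (τ a) 0 (k a).succ).prod := by
      refine Commute.list_prod_left _ _ fun x hx => Commute.list_prod_right _ _ fun y hy => ?_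
      obtain ⟨a, -, rfl⟩ := List.mem_map.1 hx
      obtain ⟨b, -, rfl⟩ := List.mem_map.1 hy
      exact hc _ (hτD a) _ (hτD b) _ _ _ _
    rw [← Module.End.mul_apply, e.eq, Module.End.mul_apply,
      list_prod_apply_eigen (r := fun a => lam₁ 0 (τ a)) fun a _ =>
        apply_wordMonodromy_separate (E := lowerBlock S₂) (fun b i j => hc _ (hτD a) _ (hτD b) _ _ _ _) I hl
          (hA a) k, map_smul, hW, Pi.smul_apply, map_smul, smul_smul]
    simp [prodOver, Function.comp_def]
  simp only [hk, map_smul]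
  rw [← Finset.smul_sum, smul_smul, fProd_map_map, ← merge_mul_separate]
  congr 1
  ring

end Step

/-! ### Scalar bookkeeping -/

section Coefficients

variable {q : ℂ}

theorem prodOver_append (h : ℂ → ℂ) (x y : List ℂ) :
    prodOver h (x ++ y) = prodOver h x * prodOver h y := by
  simp [prodOver]

theorem prodOver_perm (h : ℂ → ℂ) {x y : List ℂ} (p : x.Perm y) : prodOver h x = prodOver h y :=
  (p.map h).prod_eq

theorem prodOver_mul (g h : ℂ → ℂ) (x : List ℂ) :
    prodOver (fun u => g u * h u) x = prodOver g x * prodOver h x :=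
  List.prod_map_mul

theorem prodOver_div (g h : ℂ → ℂ) (x : List ℂ) :
    prodOver (fun u => g u / h u) x = prodOver g x / prodOver h x :=
  by simpa [prodOver] using Multiset.prod_map_div (m := (x : Multiset ℂ)) (f := g) (g := h)

theorem prodOver_ne_zero {h : ℂ → ℂ} {x : List ℂ} (hx : ∀ u ∈ x, h u ≠ 0) : prodOver h x ≠ 0 := by
  refine List.prod_ne_zero fun h0 => ?_
  obtain ⟨a, ha, h0⟩ := List.mem_map.1 h0
  exact hx a ha h0

theorem fProd_eq_prodOver (q : ℂ) (x y : List ℂ) :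
    fProd q x y = prodOver (fun a => prodOver (fFun q a) y) x := rfl

theorem fProd_append_left (q : ℂ) (x x' y : List ℂ) :
    fProd q (x ++ x') y = fProd q x y * fProd q x' y :=
  prodOver_append _ _ _

theorem fProd_append_right (q : ℂ) (x y y' : List ℂ) :
    fProd q x (y ++ y') = fProd q x y * fProd q x y' := by
  simp only [fProd_eq_prodOver, prodOver_append, prodOver_mul]

theorem fProd_perm (q : ℂ) {x x' y y' : List ℂ} (hx : x.Perm x') (hy : y.Perm y') :
    fProd q x y = fProd q x' y' := by
  simp only [fProd_eq_prodOver, prodOver_perm _ hx, prodOver_perm _ hy]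

theorem fProd_nil_left (q : ℂ) (y : List ℂ) : fProd q [] y = 1 := rfl

theorem fProd_singleton_left (q u : ℂ) (y : List ℂ) : fProd q [u] y = prodOver (fFun q u) y := by
  simp [fProd_eq_prodOver, prodOver]

theorem fProd_ne_zero {x y : List ℂ} (h : ∀ a ∈ x, ∀ b ∈ y, fFun q a b ≠ 0) : fProd q x y ≠ 0 :=
  prodOver_ne_zero fun a ha => prodOver_ne_zero (h a ha)

theorem coproductCoeff_succ (q : ℂ) {N : ℕ} (lam : Fin (N + 2) → ℂ → ℂ)
    (si sii : Fin (N + 1) → List ℂ) :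
    coproductCoeff q lam si sii
      = prodOver (fun u => lam 0 u / lam 1 u) (sii 0) * fProd q (si 0) (sii 0)
          / fProd q (headFamily fun ν : Fin N => si ν.succ) (sii 0)
        * coproductCoeff q (fun i => lam i.succ) (fun ν => si ν.succ) fun ν => sii ν.succ := by
  cases N with
  | zero => simp [coproductCoeff, headFamily, fProd_nil_left]
  | succ N =>
    have e : ∏ ν : Fin (N + 1 + 1 - 1), fProd q (si ⟨ν + 1, by omega⟩) (sii ⟨ν, by omega⟩)
        = fProd q (si 1) (sii 0)
          * ∏ ν : Fin (N + 1 - 1), fProd q (si ⟨ν + 2, by omega⟩) (sii ⟨ν + 1, by omega⟩) :=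
      Fin.prod_univ_succ (n := N) fun ν => fProd q (si ⟨ν + 1, by omega⟩) (sii ⟨ν, by omega⟩)
    unfold coproductCoeff
    rw [Fin.prod_univ_succ, e, mul_div_mul_comm]
    rfl

theorem nestedEigen_zero (q : ℂ) {n : ℕ} (lam : Fin (n + 2) → ℂ → ℂ) (t : List ℂ) (u : ℂ) :
    nestedEigen q lam t 0 u = lam 1 u * prodOver (fFun q u) t := by
  rw [nestedEigen, if_pos rfl, fProd_singleton_left]

theorem nestedEigen_succ (q : ℂ) {n : ℕ} (lam : Fin (n + 2) → ℂ → ℂ) (t : List ℂ) (i : Fin n) :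
    nestedEigen q lam t i.succ = lam i.succ.succ := by
  funext u
  rw [nestedEigen, if_neg (Fin.succ_ne_zero i)]

theorem nestedEigen_mul (q : ℂ) {n : ℕ} (lam₁ lam₂ : Fin (n + 2) → ℂ → ℂ) {t t₁ t₂ : List ℂ}
    (h : t.Perm (t₁ ++ t₂)) :
    nestedEigen q (fun i u => lam₁ i u * lam₂ i u) t
      = fun i u => nestedEigen q lam₁ t₁ i u * nestedEigen q lam₂ t₂ i u := by
  funext i u
  refine Fin.cases ?_ (fun i => ?_) i
  · simp only [nestedEigen_zero, prodOver_perm _ h, prodOver_append]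
    ring
  · simp only [nestedEigen_succ]

/-- Nesting modifies only the first remaining eigenvalue, which occurs only in the numerator of the
first remaining `α`. -/
theorem coproductCoeff_nestedEigen (q : ℂ) {N : ℕ} (lam : Fin (N + 2) → ℂ → ℂ) (t : List ℂ)
    (si sii : Fin N → List ℂ) :
    coproductCoeff q (nestedEigen q lam t) si sii
      = coproductCoeff q (fun i => lam i.succ) si sii * fProd q (headFamily sii) t := by
  cases N with
  | zero => simp [coproductCoeff, headFamily, fProd_nil_left]
  | succ N =>
    have h : (fun i : Fin (N + 1) => nestedEigen q lam t i.succ) = fun i => lam i.succ.succ :=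
      funext fun i => nestedEigen_succ q lam t i
    have h1 : nestedEigen q lam t 1 = lam 2 := nestedEigen_succ q lam t 0
    rw [coproductCoeff_succ, coproductCoeff_succ, h, h1]
    simp only [nestedEigen_zero]
    rw [prodOver_div, prodOver_div, prodOver_mul, ← fProd_eq_prodOver]
    change _ = prodOver (lam 1) (sii 0) / prodOver (lam 2) (sii 0) * _ / _ * _ * fProd q (sii 0) t
    ring

/-- One step of the nested recursion for the coefficients of the coproduct formula. -/
theorem coproductCoeff_step {N : ℕ} {lam₁ lam₂ : Fin (N + 2) → ℂ → ℂ}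
    {t si sii : Fin (N + 1) → List ℂ} (ht : ∀ ν, (t ν).Perm (si ν ++ sii ν))
    (h₁ : ∀ u ∈ t 0, lam₁ 1 u ≠ 0) (h₂ : ∀ u ∈ t 0, lam₂ 1 u ≠ 0)
    (hf : ∀ a ∈ headFamily (fun ν : Fin N => t ν.succ), ∀ b ∈ t 0, fFun q a b ≠ 0) :
    (prodOver (fun u => lam₁ 1 u * lam₂ 1 u) (t 0)
        * fProd q (headFamily fun ν : Fin N => t ν.succ) (t 0))⁻¹
      * ((fProd q (si 0) (sii 0) * (prodOver (lam₂ 1) (si 0) * prodOver (lam₁ 0) (sii 0)))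
        * (coproductCoeff q (nestedEigen q lam₁ (si 0)) (fun ν => si ν.succ) (fun ν => sii ν.succ)
          * ((prodOver (lam₁ 1) (si 0) * fProd q (headFamily fun ν : Fin N => si ν.succ) (si 0))
            * (prodOver (lam₂ 1) (sii 0)
              * fProd q (headFamily fun ν : Fin N => sii ν.succ) (sii 0)))))
      = coproductCoeff q lam₁ si sii := by
  have hh : (headFamily fun ν : Fin N => t ν.succ).Perm
      (headFamily (fun ν : Fin N => si ν.succ) ++ headFamily fun ν : Fin N => sii ν.succ) := by
    cases N with
    | zero => exact List.Perm.refl _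
    | succ N => exact ht 1
  have m1 : ∀ u ∈ si 0, u ∈ t 0 := fun u hu => (ht 0).mem_iff.2 (by simp [hu])
  have m2 : ∀ u ∈ sii 0, u ∈ t 0 := fun u hu => (ht 0).mem_iff.2 (by simp [hu])
  have m3 : ∀ u ∈ headFamily (fun ν : Fin N => si ν.succ), u ∈ headFamily fun ν : Fin N => t ν.succ :=
    fun u hu => hh.mem_iff.2 (by simp [hu])
  have m4 : ∀ u ∈ headFamily (fun ν : Fin N => sii ν.succ),
      u ∈ headFamily fun ν : Fin N => t ν.succ := fun u hu => hh.mem_iff.2 (by simp [hu])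
  -- Splitting both families breaks `f(t̄²,t̄¹)` into four blocks. Two cancel against the
  -- normalisations of the partial Bethe vectors, one against the factor from the nested eigenvalue,
  -- and `f(t̄²_i, t̄¹_ii)` survives in the denominator.
  rw [coproductCoeff_nestedEigen, coproductCoeff_succ, fProd_perm q hh (ht 0),
    prodOver_perm _ (ht 0), prodOver_mul, prodOver_div, prodOver_append, prodOver_append,
    fProd_append_left, fProd_append_right, fProd_append_right]
  have n1 := prodOver_ne_zero fun u hu => h₁ u (m1 u hu)
  have n2 := prodOver_ne_zero fun u hu => h₁ u (m2 u hu)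
  have n3 := prodOver_ne_zero fun u hu => h₂ u (m1 u hu)
  have n4 := prodOver_ne_zero fun u hu => h₂ u (m2 u hu)
  have n5 := fProd_ne_zero fun u hu v hv => hf u (m3 u hu) v (m1 v hv)
  have n6 := fProd_ne_zero fun u hu v hv => hf u (m3 u hu) v (m2 v hv)
  have n7 := fProd_ne_zero fun u hu v hv => hf u (m4 u hu) v (m1 v hv)
  have n8 := fProd_ne_zero fun u hu v hv => hf u (m4 u hu) v (m2 v hv)
  field_simp

end Coefficients

/-! ### Labels for subfamilies of parameters -/

section Labels

theorem inside_finRange {r : ℕ} (I : Finset (Fin r)) :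
    inside I (List.finRange r) = I.sort (· ≤ ·) := by
  refine List.Perm.eq_of_pairwise (le := (· ≤ ·)) (fun _ _ _ _ => le_antisymm) ?_ ?_ ?_
  · exact (List.pairwise_le_finRange r).filter _
  · exact I.pairwise_sort _
  · refine (List.perm_ext_iff_of_nodup ((List.nodup_finRange r).filter _)
      (I.sort_nodup _)).2 fun a => ?_
    simp

theorem outside_eq_inside_compl {r : ℕ} (I : Finset (Fin r)) (l : List (Fin r)) :
    outside I l = inside Iᶜ l := by
  simp [outside, inside]

theorem nodup_flatten_ofFn {N : ℕ} {r : Fin N → ℕ} {s : (ν : Fin N) → Fin (r ν) → ℂ}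
    (hs : Function.Injective fun p : (ν : Fin N) × Fin (r ν) => s p.1 p.2) :
    (List.ofFn fun ν => List.ofFn (s ν)).flatten.Nodup := by
  rw [List.nodup_flatten]
  constructor
  · intro l hl
    obtain ⟨ν, rfl⟩ := (List.mem_ofFn' _ _).1 hl
    refine List.nodup_ofFn.2 fun a b hab => ?_
    have := hs (a₁ := ⟨ν, a⟩) (a₂ := ⟨ν, b⟩) hab
    simpa using this
  · rw [List.pairwise_ofFn]
    intro ν μ hνμ x h1 h2
    obtain ⟨a, rfl⟩ := (List.mem_ofFn' _ _).1 h1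
    obtain ⟨b, hb⟩ := (List.mem_ofFn' _ _).1 h2
    have := hs (a₁ := ⟨μ, b⟩) (a₂ := ⟨ν, a⟩) hb
    exact hνμ.ne (congrArg Sigma.fst this).symm

theorem mem_flatten_ofFn {N : ℕ} {r : Fin N → ℕ} {s : (ν : Fin N) → Fin (r ν) → ℂ} {u : ℂ} :
    u ∈ (List.ofFn fun ν => List.ofFn (s ν)).flatten ↔ ∃ ν a, s ν a = u := by
  simp [List.mem_flatten, List.mem_ofFn]

/-- The label of a member of the family `τ` along the list `L`. -/
def familyLabel {ι : Type*} (τ : ι → ℂ) (L : List ι) (a : Fin (L.map τ).length) : ι :=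
  L.get (a.cast (List.length_map τ))

variable {ι : Type*} (τ : ι → ℂ) (L : List ι)

theorem apply_familyLabel (a : Fin (L.map τ).length) : τ (familyLabel τ L a) = (L.map τ).get a := by
  simp [familyLabel]

theorem map_familyLabel : (List.finRange (L.map τ).length).map (familyLabel τ L) = L := by
  refine List.ext_getElem (by simp) fun i h1 h2 => ?_
  simp [familyLabel]

variable {L}

theorem familyLabel_injective (hL : L.Nodup) : Function.Injective (familyLabel τ L) :=
  fun _ _ hab => Fin.cast_injective _ (List.nodup_iff_injective_get.1 hL hab)

theorem familyLabel_mem (a : Fin (L.map τ).length) : familyLabel τ L a ∈ L := List.get_mem _ _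

theorem exists_familyLabel {a : ι} (ha : a ∈ L) : ∃ b, familyLabel τ L b = a := by
  obtain ⟨b, hb⟩ := List.get_of_mem ha
  exact ⟨b.cast (List.length_map τ).symm, hb⟩

end Labels

/-! ### Bilinear maps on words over a split set of sites -/

section PairWords

variable {κ₁ κ₂ ι : Type*} {n : ℕ} {H₁ H₂ H : Type*} [AddCommGroup H₁] [Module ℂ H₁]
  [AddCommGroup H₂] [Module ℂ H₂] [AddCommGroup H] [Module ℂ H]

/-- The bilinear map on functions on words induced by a bilinear map and two maps of labels. -/
def pairWords (n : ℕ) (e₁ : κ₁ → ι) (e₂ : κ₂ → ι) (μ : H₁ →ₗ[ℂ] H₂ →ₗ[ℂ] H) :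
    ((κ₁ → Fin n) → H₁) →ₗ[ℂ] ((κ₂ → Fin n) → H₂) →ₗ[ℂ] ((ι → Fin n) → H) :=
  LinearMap.mk₂ ℂ (fun x y c => μ (x fun a => c (e₁ a)) (y fun a => c (e₂ a)))
    (fun x x' y => funext fun c => by simp) (fun r x y => funext fun c => by simp)
    (fun x y y' => funext fun c => by simp) (fun r x y => funext fun c => by simp)

theorem pairWords_apply (e₁ : κ₁ → ι) (e₂ : κ₂ → ι) (μ : H₁ →ₗ[ℂ] H₂ →ₗ[ℂ] H)
    (x : (κ₁ → Fin n) → H₁) (y : (κ₂ → Fin n) → H₂) (c : ι → Fin n) :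
    pairWords n e₁ e₂ μ x y c = μ (x fun a => c (e₁ a)) (y fun a => c (e₂ a)) := rfl

theorem pairWords_wordVac {e₁ : κ₁ → ι} {e₂ : κ₂ → ι}
    (hcov : ∀ a, (∃ b, e₁ b = a) ∨ ∃ b, e₂ b = a) (μ : H₁ →ₗ[ℂ] H₂ →ₗ[ℂ] H) (v₁ : H₁) (v₂ : H₂) :
    pairWords (n + 1) e₁ e₂ μ (wordVac κ₁ n v₁) (wordVac κ₂ n v₂) = wordVac ι n (μ v₁ v₂) := by
  funext c
  rw [pairWords_apply, wordVac_apply, wordVac_apply, wordVac_apply]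
  by_cases h : c = fun _ => 0
  · subst h
    simp
  · rw [if_neg h]
    have : ∃ a, c a ≠ 0 := by
      by_contra! h'
      exact h (funext h')
    obtain ⟨a, ha⟩ := this
    rcases hcov a with ⟨b, rfl⟩ | ⟨b, rfl⟩
    · rw [if_neg fun e => ha (congrFun e b), map_zero, LinearMap.zero_apply]
    · rw [if_neg (c := (fun a => c (e₂ a)) = fun _ => 0) fun e => ha (congrFun e b), map_zero]

variable [DecidableEq κ₁] [DecidableEq κ₂] [DecidableEq ι]

theorem pairWords_siteMonodromy_left (q : ℂ) {e₁ : κ₁ → ι} {e₂ : κ₂ → ι}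
    (he : Function.Injective e₁) (hd : ∀ a b, e₁ a ≠ e₂ b) {μ : H₁ →ₗ[ℂ] H₂ →ₗ[ℂ] H}
    {E₁ : OpMatrix n H₁} {E : OpMatrix n H} (τ : ι → ℂ) (l : List κ₁) {u : ℂ}
    (hE : ∀ i j x y, μ (E₁ u i j x) y = E u i j (μ x y)) (i j : Fin n)
    (x : (κ₁ → Fin n) → H₁) (y : (κ₂ → Fin n) → H₂) :
    pairWords n e₁ e₂ μ (siteMonodromy q E₁ (fun a => τ (e₁ a)) l u i j x) y
      = siteMonodromy q E τ (l.map e₁) u i j (pairWords n e₁ e₂ μ x y) := by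
  refine pullWords_siteMonodromy (E := E) q he (η := fun c => μ.flip (y fun a => c (e₂ a))) ?_ τ l
    (fun c i j x => hE i j x _) i j x
  intro c a z
  simp only [Function.update_of_ne (hd _ _).symm]

theorem pairWords_siteMonodromy_right (q : ℂ) {e₁ : κ₁ → ι} {e₂ : κ₂ → ι}
    (he : Function.Injective e₂) (hd : ∀ a b, e₁ a ≠ e₂ b) {μ : H₁ →ₗ[ℂ] H₂ →ₗ[ℂ] H}
    {E₂ : OpMatrix n H₂} {E : OpMatrix n H} (τ : ι → ℂ) (l : List κ₂) {u : ℂ}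
    (hE : ∀ i j x y, μ x (E₂ u i j y) = E u i j (μ x y)) (i j : Fin n)
    (x : (κ₁ → Fin n) → H₁) (y : (κ₂ → Fin n) → H₂) :
    pairWords n e₁ e₂ μ x (siteMonodromy q E₂ (fun a => τ (e₂ a)) l u i j y)
      = siteMonodromy q E τ (l.map e₂) u i j (pairWords n e₁ e₂ μ x y) := by
  refine pullWords_siteMonodromy (E := E) q he (η := fun c => μ (x fun a => c (e₁ a))) ?_ τ l
    (fun c i j y => hE i j _ y) i j y
  intro c a z
  simp only [Function.update_of_ne (hd _ _)]

theorem list_prod_bilinear {κ : Type*} {μ : H₁ →ₗ[ℂ] H₂ →ₗ[ℂ] H} (l : List κ)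
    {A : κ → Module.End ℂ H} {A₁ : κ → Module.End ℂ H₁} {A₂ : κ → Module.End ℂ H₂} :
    ((∀ a ∈ l, ∀ x y, A a (μ x y) = μ (A₁ a x) y) →
      ∀ x y, (l.map A).prod (μ x y) = μ ((l.map A₁).prod x) y) ∧
    ((∀ a ∈ l, ∀ x y, A a (μ x y) = μ x (A₂ a y)) →
      ∀ x y, (l.map A).prod (μ x y) = μ x ((l.map A₂).prod y)) := by
  induction l with
  | nil => simp
  | cons a l ih =>
    refine ⟨fun h x y => ?_, fun h x y => ?_⟩
    · simp only [List.map_cons, List.prod_cons, Module.End.mul_apply]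
      rw [ih.1 fun b hb => h b (by simp [hb]), h a (by simp)]
    · simp only [List.map_cons, List.prod_cons, Module.End.mul_apply]
      rw [ih.2 fun b hb => h b (by simp [hb]), h a (by simp)]

/-- A word on the disjoint union is a pair of words, and the two groups of operators act on separate
arguments of `μ`, so the sum factorises. -/
theorem sum_pairWords [Fintype κ₁] [Fintype κ₂] [Fintype ι] {e₁ : κ₁ → ι} {e₂ : κ₂ → ι}
    (he : Function.Bijective (Sum.elim e₁ e₂)) {μ : H₁ →ₗ[ℂ] H₂ →ₗ[ℂ] H}
    {X₁ : κ₁ → Fin n → Module.End ℂ H₁}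
    {X₂ : κ₂ → Fin n → Module.End ℂ H₂} {Y₁ Y₂ : ι → Fin n → Module.End ℂ H}
    (h₁ : ∀ a i x y, Y₁ (e₁ a) i (μ x y) = μ (X₁ a i x) y)
    (h₂ : ∀ a i x y, Y₂ (e₂ a) i (μ x y) = μ x (X₂ a i y)) (l₁ : List κ₁) (l₂ : List κ₂)
    (x : (κ₁ → Fin n) → H₁) (y : (κ₂ → Fin n) → H₂) :
    ∑ k : ι → Fin n, ((l₁.map e₁).map fun a => Y₁ a (k a)).prod
        (((l₂.map e₂).map fun a => Y₂ a (k a)).prod (pairWords n e₁ e₂ μ x y k))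
      = μ (∑ k : κ₁ → Fin n, (l₁.map fun a => X₁ a (k a)).prod (x k))
          (∑ k : κ₂ → Fin n, (l₂.map fun a => X₂ a (k a)).prod (y k)) := by
  simp only [map_sum, LinearMap.sum_apply]
  rw [Finset.sum_comm]
  rw [← Fintype.sum_prod_type' (f := fun k₁ k₂ =>
    μ ((l₁.map fun a => X₁ a (k₁ a)).prod (x k₁)) ((l₂.map fun a => X₂ a (k₂ a)).prod (y k₂)))]
  refine Fintype.sum_equiv ((Equiv.arrowCongr (Equiv.ofBijective _ he).symm (Equiv.refl _)).trans
    (Equiv.sumArrowEquivProdArrow κ₁ κ₂ (Fin n))) _ _ fun k => ?_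
  rw [pairWords_apply, List.map_map, List.map_map]
  have e2 := (list_prod_bilinear (μ := μ) (A := (fun a => Y₂ a (k a)) ∘ e₂)
    (A₁ := fun _ => 1) (A₂ := fun a => X₂ a (k (e₂ a))) l₂).2 fun a _ x y => h₂ a _ x y
  have e1 := (list_prod_bilinear (μ := μ) (A := (fun a => Y₁ a (k a)) ∘ e₁)
    (A₁ := fun a => X₁ a (k (e₁ a))) (A₂ := fun _ => 1) l₁).1 fun a _ x y => h₁ a _ x y
  rw [e2, e1]
  rfl

end PairWords

/-! ### Induction on the rank -/

section Bilinear

theorem isVacuum_siteMonodromy {n : ℕ} {H : Type*} [AddCommGroup H] [Module ℂ H] {ι : Type*}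
    [DecidableEq ι] (q : ℂ) {D : Set ℂ} {S : OpMatrix (n + 2) H} {lam : Fin (n + 2) → ℂ → ℂ} {w : H}
    (hw : IsVacuum D S lam w) (τ : ι → ℂ) {l : List ι} (hl : l.Nodup) :
    IsVacuum D (siteMonodromy q (lowerBlock S) τ l) (nestedEigen q lam (l.map τ))
      (wordVac ι n w) := by
  intro u hu
  obtain ⟨h0, h1⟩ := siteMonodromy_vacuum q (E := lowerBlock S) τ (lam := fun i => lam i.succ u)
    (φ := wordVac ι n w) (u := u) hl (fun c i j hij => by
      rw [wordVac_apply]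
      split_ifs
      · exact (hw u hu).1 _ _ (Fin.succ_lt_succ_iff.2 hij)
      · exact map_zero _) (fun c i => by
      rw [wordVac_apply]
      split_ifs
      · exact (hw u hu).2 _
      · rw [map_zero, smul_zero]) (fun a _ c hc => by
      rw [wordVac_apply, if_neg]
      rintro rfl
      exact hc rfl)
  refine ⟨h0, fun i => (h1 i).trans ?_⟩
  congr 1
  refine Fin.cases ?_ (fun i => ?_) i
  · simp [nestedEigen_zero, prodOver, Function.comp_def]
  · simp [nestedEigen_succ]

theorem nestedVac_eq_wordVac {n : ℕ} {H : Type u} [AddCommGroup H] [Module ℂ H] (r : ℕ) (v : H) :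
    (nestedVac r v : (Fin r → Fin (n + 1)) → H) = wordVac (Fin r) n v :=
  funext fun c => (nestedVac_apply r v c).trans (by rw [wordVac_apply]; congr)

theorem betheVector_succ_smul (q : ℂ) {N : ℕ} {H : Type u} [AddCommGroup H] [Module ℂ H]
    (T : OpMatrix (N + 2) H) (lam : Fin (N + 2) → ℂ → ℂ) (v : H) (t : Fin (N + 1) → List ℂ)
    (h₁ : ∀ u ∈ t 0, lam 1 u ≠ 0)
    (h₂ : ∀ a ∈ headFamily (fun ν : Fin N => t ν.succ), ∀ b ∈ t 0, fFun q a b ≠ 0) :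
    ∑ k : Fin (t 0).length → Fin (N + 1),
        ((List.finRange (t 0).length).map fun a => T ((t 0).get a) 0 (k a).succ).prod
          (betheVector q N (nestedMonodromy q T (t 0)) (nestedEigen q lam (t 0))
            (nestedVac (t 0).length v) (fun ν => t ν.succ) k)
      = (prodOver (lam 1) (t 0) * fProd q (headFamily fun ν : Fin N => t ν.succ) (t 0)) •
          betheVector q (N + 1) T lam v t := by
  simp only [betheVector, List.ofFn_eq_map]
  rw [smul_inv_smul₀ (mul_ne_zero (prodOver_ne_zero h₁) (fProd_ne_zero h₂))]

theorem bijective_sumElim_familyLabel {ι : Type*} (τ : ι → ℂ) {L₁ L₂ : List ι}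
    (h₁ : L₁.Nodup) (h₂ : L₂.Nodup) (hd : ∀ a ∈ L₁, a ∉ L₂) (hcov : ∀ a, a ∈ L₁ ∨ a ∈ L₂) :
    Function.Bijective (Sum.elim (familyLabel τ L₁) (familyLabel τ L₂)) := by
  constructor
  · refine (familyLabel_injective τ h₁).sumElim (familyLabel_injective τ h₂) fun a b hab => ?_
    exact hd _ (familyLabel_mem τ a) (hab ▸ familyLabel_mem τ b)
  · intro a
    rcases hcov a with h | h
    · obtain ⟨b, hb⟩ := exists_familyLabel τ h
      exact ⟨Sum.inl b, hb⟩
    · obtain ⟨b, hb⟩ := exists_familyLabel τ h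
      exact ⟨Sum.inr b, hb⟩

theorem perm_subFamily {N : ℕ} {r : Fin N → ℕ} (s : (ν : Fin N) → Fin (r ν) → ℂ)
    (I : (ν : Fin N) → Finset (Fin (r ν))) (ν : Fin N) :
    (List.ofFn (s ν)).Perm (subFamily s I ν ++ subFamily s (fun ν => (I ν)ᶜ) ν) := by
  rw [List.ofFn_eq_map, subFamily, subFamily, ← List.map_append, ← inside_finRange,
    ← inside_finRange, ← outside_eq_inside_compl]
  exact ((perm_inside_append_outside _ _).map _).symm

/-- The coproduct formula for Bethe vectors, for two families of operators acting on a space with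
a bilinear map from the product of two representation spaces. -/
theorem betheVector_bilinear {q : ℂ} (hq : q ≠ 0) (N : ℕ) {H₁ H₂ H : Type u} [AddCommGroup H₁]
    [Module ℂ H₁] [AddCommGroup H₂] [Module ℂ H₂] [AddCommGroup H] [Module ℂ H]
    (μ : H₁ →ₗ[ℂ] H₂ →ₗ[ℂ] H) {D : Set ℂ} {T₁ : OpMatrix (N + 1) H₁} {T₂ : OpMatrix (N + 1) H₂}
    {S₁ S₂ : OpMatrix (N + 1) H}
    (h₁ : ∀ u ∈ D, ∀ v ∈ D, u ≠ v → ExchRel q u v (S₁ u) (S₁ v))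
    (h₂ : ∀ u ∈ D, ∀ v ∈ D, u ≠ v → ExchRel q u v (S₂ u) (S₂ v))
    (hc : ∀ u ∈ D, ∀ v ∈ D, ∀ i j k l, Commute (S₁ u i j) (S₂ v k l))
    (hμ₁ : ∀ u ∈ D, ∀ i j x y, μ (T₁ u i j x) y = S₁ u i j (μ x y))
    (hμ₂ : ∀ u ∈ D, ∀ i j x y, μ x (T₂ u i j y) = S₂ u i j (μ x y))
    {lam₁ lam₂ : Fin (N + 1) → ℂ → ℂ} {v₁ : H₁} {v₂ : H₂}
    (hv₁ : IsVacuum D S₁ lam₁ (μ v₁ v₂)) (hv₂ : IsVacuum D S₂ lam₂ (μ v₁ v₂))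
    {r : Fin N → ℕ} (s : (ν : Fin N) → Fin (r ν) → ℂ)
    (hsD : ∀ ν a, s ν a ∈ D) (hs0 : ∀ ν a, s ν a ≠ 0)
    (hsinj : Function.Injective fun p : (ν : Fin N) × Fin (r ν) => s p.1 p.2)
    (hlam₁ : ∀ ν a, lam₁ ν.succ (s ν a) ≠ 0) (hlam₂ : ∀ ν a, lam₂ ν.succ (s ν a) ≠ 0)
    (hf : ∀ ν a b, a ≠ b → fFun q (s ν a) (s ν b) ≠ 0)
    (hf' : ∀ μ ν : Fin N, (μ : ℕ) = ν + 1 → ∀ a b, fFun q (s μ a) (s ν b) ≠ 0) :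
    betheVector q N (fun u => S₁ u * S₂ u) (fun i u => lam₁ i u * lam₂ i u) (μ v₁ v₂)
        (fun ν => List.ofFn (s ν))
      = ∑ I : (ν : Fin N) → Finset (Fin (r ν)),
          coproductCoeff q lam₁ (subFamily s I) (subFamily s fun ν => (I ν)ᶜ) •
            μ (betheVector q N T₁ lam₁ v₁ (subFamily s I))
              (betheVector q N T₂ lam₂ v₂ (subFamily s fun ν => (I ν)ᶜ)) := by
  induction N generalizing H₁ H₂ H D with
  | zero => simp [betheVector, coproductCoeff]
  | succ N ih =>
    have hinj0 : Function.Injective (s 0) := fun a b hab => by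
      simpa using hsinj (a₁ := ⟨0, a⟩) (a₂ := ⟨0, b⟩) hab
    have hinj' : Function.Injective fun p : (ν : Fin N) × Fin (r ν.succ) => s p.1.succ p.2 := by
      rintro ⟨ν, a⟩ ⟨κ, b⟩ hab
      have := hsinj (a₁ := ⟨ν.succ, a⟩) (a₂ := ⟨κ.succ, b⟩) hab
      obtain rfl : ν = κ := Fin.succ_injective _ (congrArg Sigma.fst this)
      simpa using this
    have hne : ∀ (ν : Fin N) (a : Fin (r ν.succ)) (b : Fin (r 0)), s ν.succ a ≠ s 0 b := by
      intro ν a b hab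
      have := hsinj (a₁ := ⟨ν.succ, a⟩) (a₂ := ⟨0, b⟩) hab
      exact Fin.succ_ne_zero ν (congrArg Sigma.fst this)
    have htD : ∀ u ∈ (List.ofFn fun ν : Fin N => List.ofFn (s ν.succ)).flatten,
        u ∈ D ∧ ∀ a, u ≠ s 0 a := by
      intro u hu
      obtain ⟨ν, a, rfl⟩ := mem_flatten_ofFn.1 hu
      exact ⟨hsD _ _, hne ν a⟩
    have hnd := nodup_flatten_ofFn (s := fun ν : Fin N => s ν.succ) hinj'
    rw [betheVector_succ_labelled q _ _ _ (fun ν => List.ofFn (s ν)) (s 0)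
      (finCongr List.length_ofFn) (fun a => by simp; rfl) hnd (l := List.finRange (r 0))
      (List.ext_getElem (by simp) fun i h1 h2 => by simp),
      betheVector_composite_succ hq h₁ h₂ hc hv₁ hv₂ hinj0 (hs0 0) (hsD 0) (hf 0) hnd htD
        (List.nodup_finRange _) (List.mem_finRange), Finset.smul_sum]
    -- A partition of all families is one of the first family together with one of the remaining
    -- families.
    refine Eq.trans ?_ (Fintype.sum_equiv (Fin.consEquiv fun ν => Finset (Fin (r ν))) _ _
      fun _ => rfl)
    rw [Fintype.sum_prod_type]
    refine Finset.sum_congr rfl fun I _ => ?_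
    rw [outside_eq_inside_compl, inside_finRange, inside_finRange]
    set L₁ := I.sort (· ≤ ·) with hL₁
    set L₂ := Iᶜ.sort (· ≤ ·) with hL₂
    have hn₁ : L₁.Nodup := I.sort_nodup _
    have hn₂ : L₂.Nodup := Iᶜ.sort_nodup _
    have hdis : ∀ a ∈ L₁, a ∉ L₂ := fun a => by simp [hL₁, hL₂]
    have hcov : ∀ a, a ∈ L₁ ∨ a ∈ L₂ := fun a => by simp [hL₁, hL₂, em]
    have hbij := bijective_sumElim_familyLabel (s 0) hn₁ hn₂ hdis hcov
    have hdis' : ∀ a b, familyLabel (s 0) L₁ a ≠ familyLabel (s 0) L₂ b := fun a b hab =>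
      hdis _ (familyLabel_mem _ a) (hab ▸ familyLabel_mem _ b)
    have hcov' : ∀ a, (∃ b, familyLabel (s 0) L₁ b = a) ∨ ∃ b, familyLabel (s 0) L₂ b = a :=
      fun a => (hcov a).imp (exists_familyLabel _) (exists_familyLabel _)
    have hperm : (List.ofFn (s 0)).Perm (L₁.map (s 0) ++ L₂.map (s 0)) :=
      perm_subFamily s (Fin.cons I fun _ => ∅) 0
    have hget₁ : (L₁.map (s 0)).get = fun a => s 0 (familyLabel (s 0) L₁ a) :=
      funext fun a => (apply_familyLabel _ _ a).symm
    have hget₂ : (L₂.map (s 0)).get = fun a => s 0 (familyLabel (s 0) L₂ a) :=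
      funext fun a => (apply_familyLabel _ _ a).symm
    have hvac : pairWords (N + 1) (familyLabel (s 0) L₁) (familyLabel (s 0) L₂) μ
        (nestedVac _ v₁) (nestedVac _ v₂) = wordVac (Fin (r 0)) N (μ v₁ v₂) := by
      rw [nestedVac_eq_wordVac, nestedVac_eq_wordVac, pairWords_wordVac hcov']
    -- The spectral set loses the first family, because the nested exchange relation is available
    -- only away from the poles of its `R`-factors; the remaining parameters lie in the smaller set
    -- as all are distinct.
    have hIH := ih (pairWords (N + 1) (familyLabel (s 0) L₁) (familyLabel (s 0) L₂) μ)
      (D := {u ∈ D | ∀ a, u ≠ s 0 a})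
      (T₁ := nestedMonodromy q T₁ (L₁.map (s 0))) (T₂ := nestedMonodromy q T₂ (L₂.map (s 0)))
      (S₁ := siteMonodromy q (lowerBlock S₁) (s 0) L₁)
      (S₂ := siteMonodromy q (lowerBlock S₂) (s 0) L₂)
      (lam₁ := nestedEigen q lam₁ (L₁.map (s 0))) (lam₂ := nestedEigen q lam₂ (L₂.map (s 0)))
      (v₁ := nestedVac _ v₁) (v₂ := nestedVac _ v₂)
      (fun u hu v hv huv => exchRel_siteMonodromy hq huv hu.2 hv.2
        (h₁ u hu.1 v hv.1 huv).lowerBlock hn₁)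
      (fun u hu v hv huv => exchRel_siteMonodromy hq huv hu.2 hv.2
        (h₂ u hu.1 v hv.1 huv).lowerBlock hn₂)
      (fun u hu v hv i j k l => commute_siteMonodromy
        (E₁ := lowerBlock S₁) (E₂ := lowerBlock S₂) (fun i j k l => hc u hu.1 v hv.1 _ _ _ _) (fun a ha h => hdis a h ha) _ _ _ _)
      (fun u hu i j x y => by
        rw [nestedMonodromy_eq, hget₁, pairWords_siteMonodromy_left q (E := lowerBlock S₁)
          (familyLabel_injective _ hn₁) hdis' (s 0) _ fun i j x y => hμ₁ u hu.1 _ _ x y,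
          map_familyLabel])
      (fun u hu i j x y => by
        rw [nestedMonodromy_eq, hget₂, pairWords_siteMonodromy_right q (E := lowerBlock S₂)
          (familyLabel_injective _ hn₂) hdis' (s 0) _ fun i j x y => hμ₂ u hu.1 _ _ x y,
          map_familyLabel])
      (by
        rw [hvac]
        exact fun u hu => isVacuum_siteMonodromy q hv₁ (s 0) hn₁ u hu.1)
      (by
        rw [hvac]
        exact fun u hu => isVacuum_siteMonodromy q hv₂ (s 0) hn₂ u hu.1)
      (fun ν => s ν.succ) (fun ν a => ⟨hsD _ _, hne ν a⟩) (fun ν => hs0 ν.succ) hinj'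
      (fun ν a => by
        rw [nestedEigen_succ]
        exact hlam₁ ν.succ a)
      (fun ν a => by
        rw [nestedEigen_succ]
        exact hlam₂ ν.succ a) (fun ν => hf ν.succ) (fun κ ν hκν => hf' κ.succ ν.succ (by simp [hκν]))
    rw [hvac, ← nestedEigen_mul q lam₁ lam₂ hperm] at hIH
    rw [hIH]
    have hsum := fun x y => sum_pairWords (n := N + 1) hbij
      (X₁ := fun a i => T₁ ((L₁.map (s 0)).get a) 0 i.succ)
      (X₂ := fun a i => T₂ ((L₂.map (s 0)).get a) 0 i.succ)
      (Y₁ := fun a i => S₁ (s 0 a) 0 i.succ) (Y₂ := fun a i => S₂ (s 0 a) 0 i.succ) (μ := μ)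
      (fun a i x y => by
        rw [← apply_familyLabel]
        exact (hμ₁ _ (hsD _ _) _ _ _ _).symm)
      (fun a i x y => by
        rw [← apply_familyLabel]
        exact (hμ₂ _ (hsD _ _) _ _ _ _).symm)
      (List.finRange _) (List.finRange _) x y
    simp only [map_familyLabel] at hsum
    simp only [Finset.sum_apply, Pi.smul_apply, map_sum, map_smul]
    rw [Finset.sum_comm, Finset.smul_sum, Finset.smul_sum]
    refine Finset.sum_congr rfl fun I' _ => ?_
    rw [← Finset.smul_sum, hsum]
    set J : (ν : Fin (N + 1)) → Finset (Fin (r ν)) := Fin.cons I I' with hJ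
    have hp := perm_subFamily s J
    have hhead : ∀ a ∈ headFamily (fun ν : Fin N => List.ofFn (s ν.succ)), ∀ b ∈ List.ofFn (s 0),
        fFun q a b ≠ 0 := by
      intro a ha b hb
      obtain ⟨b, rfl⟩ := List.mem_ofFn.1 hb
      cases N with
      | zero => simp [headFamily] at ha
      | succ N =>
        obtain ⟨a, rfl⟩ := List.mem_ofFn.1 ha
        exact hf' _ 0 rfl a b
    have hsub₁ : ∀ ν, ∀ u ∈ subFamily s J ν, u ∈ List.ofFn (s ν) := fun ν u hu =>
      (hp ν).mem_iff.2 (by simp [hu])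
    have hsub₂ : ∀ ν, ∀ u ∈ subFamily s (fun ν => (J ν)ᶜ) ν, u ∈ List.ofFn (s ν) := fun ν u hu =>
      (hp ν).mem_iff.2 (by simp [hu])
    have hhead' : ∀ t : Fin (N + 1) → List ℂ, (∀ ν, ∀ u ∈ t ν, u ∈ List.ofFn (s ν)) →
        ∀ a ∈ headFamily (fun ν : Fin N => t ν.succ), ∀ b ∈ t 0, fFun q a b ≠ 0 := by
      intro t ht a ha b hb
      refine hhead a ?_ b (ht 0 b hb)
      cases N with
      | zero => simp [headFamily] at ha
      | succ N => exact ht _ a ha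
    have hl₁ : ∀ u ∈ List.ofFn (s 0), lam₁ 1 u ≠ 0 := fun u hu => by
      obtain ⟨a, rfl⟩ := List.mem_ofFn.1 hu
      exact hlam₁ 0 a
    have hl₂ : ∀ u ∈ List.ofFn (s 0), lam₂ 1 u ≠ 0 := fun u hu => by
      obtain ⟨a, rfl⟩ := List.mem_ofFn.1 hu
      exact hlam₂ 0 a
    have hB₁ := betheVector_succ_smul q T₁ lam₁ v₁ (subFamily s J)
      (fun u hu => hl₁ u (hsub₁ 0 u hu)) (hhead' _ hsub₁)
    have hB₂ := betheVector_succ_smul q T₂ lam₂ v₂ (subFamily s fun ν => (J ν)ᶜ)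
      (fun u hu => hl₂ u (hsub₂ 0 u hu)) (hhead' _ hsub₂)
    -- Both factors are un-normalised Bethe vectors of the partial models; restoring their
    -- normalisations leaves a purely scalar identity.
    refine (congrArg (fun z => _ • _ • _ • z) (congrArg₂ (fun x y => μ x y) hB₁ hB₂)).trans ?_
    rw [LinearMap.map_smul₂, map_smul, smul_smul, smul_smul, smul_smul, smul_smul]
    refine congrArg (· • _) (Eq.trans ?_ (coproductCoeff_step (t := fun ν => List.ofFn (s ν)) hp
      hl₁ hl₂ hhead))
    simp only [mul_assoc]
    rfl

end Bilinear

/-! ### Transposition and passage to dual Bethe vectors -/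

section Dual

theorem fFun_inv {q u v : ℂ} (hu : u ≠ 0) (hv : v ≠ 0) : fFun q⁻¹ u⁻¹ v⁻¹ = fFun q u v := by
  unfold fFun
  by_cases h : u = v
  · simp [h]
  · have h1 := sub_ne_zero.2 h
    have h2 : v - u ≠ 0 := sub_ne_zero.2 (Ne.symm h)
    have h3 : u⁻¹ - v⁻¹ = (v - u) / (u * v) := by field_simp
    rw [h3, inv_inv, div_div_eq_mul_div, div_eq_div_iff h2 h1]
    field_simp
    ring

theorem swapCoeff_inv {q u v : ℂ} (hu : u ≠ 0) (hv : v ≠ 0) {n : ℕ} {i k : Fin n} (hik : i ≠ k) :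
    swapCoeff q⁻¹ u v i k = swapCoeff q u⁻¹ v⁻¹ k i := by
  unfold swapCoeff gFun
  by_cases h : u = v
  · simp [h]
  · have h1 := sub_ne_zero.2 h
    have h2 : v - u ≠ 0 := sub_ne_zero.2 (Ne.symm h)
    have h3 : u⁻¹ - v⁻¹ = (v - u) / (u * v) := by field_simp
    rw [h3, inv_inv]
    rcases lt_or_gt_of_ne hik with h | h
    · rw [if_pos h, if_neg h.asymm, div_div_eq_mul_div, div_mul_eq_mul_div, div_mul_eq_mul_div,
        div_eq_div_iff h1 h2]
      field_simp
      ring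
    · rw [if_pos h, if_neg h.asymm, div_div_eq_mul_div, div_mul_eq_mul_div, div_mul_eq_mul_div,
        div_eq_div_iff h1 h2]
      field_simp
      ring

/-- Inverting `q` and both spectral parameters fixes `f` and interchanges the two off-diagonal
weights, which amounts to transposing `R`. -/
theorem RMatrix_inv {q u v : ℂ} (hu : u ≠ 0) (hv : v ≠ 0) {n : ℕ} (i k j l : Fin n) :
    RMatrix q⁻¹ n u v (i, k) (j, l) = RMatrix q n u⁻¹ v⁻¹ (j, l) (i, k) := by
  have e : fFun q⁻¹ u v = fFun q u⁻¹ v⁻¹ := by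
    have := fFun_inv (q := q) (inv_ne_zero hu) (inv_ne_zero hv)
    rwa [inv_inv, inv_inv] at this
  rw [RMatrix_apply, RMatrix_apply, e]
  by_cases hik : i = k
  · subst hik
    by_cases hjl : j = l
    · subst hjl
      simp only [if_true, and_self, eq_comm]
    · grind
  · rw [swapCoeff_inv hu hv hik]
    grind

/-- An antihomomorphism turns the exchange relation for `q` into the one for `q⁻¹`. -/
theorem ExchRel.antihom {q u v : ℂ} (hu : u ≠ 0) (hv : v ≠ 0) {n : ℕ} {H H' : Type*}
    [AddCommGroup H] [Module ℂ H] [AddCommGroup H'] [Module ℂ H']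
    {A B : Matrix (Fin n) (Fin n) (Module.End ℂ H)} (h : ExchRel q u⁻¹ v⁻¹ A B)
    (φ : Module.End ℂ H →ₗ[ℂ] Module.End ℂ H') (hφ : ∀ X Y, φ (X * Y) = φ Y * φ X) :
    ExchRel q⁻¹ u v (Matrix.of fun a b => φ (A b a)) (Matrix.of fun a b => φ (B b a)) := by
  rw [exchRel_iff_components] at h ⊢
  intro i k j l
  have key := congrArg φ (h j l i k)
  simp only [map_sum, map_smul, hφ] at key
  simp only [RMatrix_inv hu hv, Matrix.of_apply]
  exact key.symm

theorem coproductCoeff_inv (q : ℂ) {N : ℕ} (lam : Fin (N + 1) → ℂ → ℂ) {si sii : Fin N → List ℂ}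
    (h₁ : ∀ ν, ∀ u ∈ si ν, u ≠ 0) (h₂ : ∀ ν, ∀ u ∈ sii ν, u ≠ 0) :
    coproductCoeff q⁻¹ (fun i u => lam i u⁻¹) (fun ν => (si ν).map fun x => x⁻¹)
        (fun ν => (sii ν).map fun x => x⁻¹)
      = coproductCoeff q lam si sii := by
  have hp : ∀ (h : ℂ → ℂ) (x : List ℂ), prodOver h (x.map fun x => x⁻¹) = prodOver (fun u => h u⁻¹) x :=
    fun h x => by simp [prodOver, Function.comp_def]
  have hf : ∀ x y : List ℂ, (∀ u ∈ x, u ≠ 0) → (∀ u ∈ y, u ≠ 0) →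
      fProd q⁻¹ (x.map fun x => x⁻¹) (y.map fun x => x⁻¹) = fProd q x y := by
    intro x y hx hy
    simp only [fProd_eq_prodOver, hp]
    unfold prodOver
    refine congrArg List.prod (List.map_congr_left fun a ha => ?_)
    exact congrArg List.prod (List.map_congr_left fun b hb => fFun_inv (hx a ha) (hy b hb))
  unfold coproductCoeff
  simp only [hp, inv_inv, hf _ _ (h₁ _) (h₂ _)]

variable {H₁ H₂ : Type u} [AddCommGroup H₁] [Module ℂ H₁] [AddCommGroup H₂] [Module ℂ H₂]

/-- The tensor product of functionals, as a bilinear map. -/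
def dualTensorBilin (H₁ H₂ : Type u) [AddCommGroup H₁] [Module ℂ H₁] [AddCommGroup H₂]
    [Module ℂ H₂] :
    Module.Dual ℂ H₁ →ₗ[ℂ] Module.Dual ℂ H₂ →ₗ[ℂ] Module.Dual ℂ (H₁ ⊗[ℂ] H₂) :=
  (TensorProduct.mk ℂ _ _).compr₂ (TensorProduct.dualDistrib ℂ H₁ H₂)

theorem dualTensorBilin_apply (φ : Module.Dual ℂ H₁) (ψ : Module.Dual ℂ H₂) :
    dualTensorBilin H₁ H₂ φ ψ = dualTensor φ ψ := rfl

/-- The transpose of `A ⊗ 1`. -/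
def transposeLeft (H₁ H₂ : Type u) [AddCommGroup H₁] [Module ℂ H₁] [AddCommGroup H₂]
    [Module ℂ H₂] : Module.End ℂ H₁ →ₗ[ℂ] Module.End ℂ (Module.Dual ℂ (H₁ ⊗[ℂ] H₂)) :=
  Module.Dual.transpose ∘ₗ LinearMap.rTensorHom H₂

/-- The transpose of `1 ⊗ B`. -/
def transposeRight (H₁ H₂ : Type u) [AddCommGroup H₁] [Module ℂ H₁] [AddCommGroup H₂]
    [Module ℂ H₂] : Module.End ℂ H₂ →ₗ[ℂ] Module.End ℂ (Module.Dual ℂ (H₁ ⊗[ℂ] H₂)) :=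
  Module.Dual.transpose ∘ₗ LinearMap.lTensorHom H₁

theorem transposeLeft_mul (X Y : Module.End ℂ H₁) :
    transposeLeft H₁ H₂ (X * Y) = transposeLeft H₁ H₂ Y * transposeLeft H₁ H₂ X := by
  refine LinearMap.ext fun φ => TensorProduct.ext' fun x y => rfl

theorem transposeRight_mul (X Y : Module.End ℂ H₂) :
    transposeRight H₁ H₂ (X * Y) = transposeRight H₁ H₂ Y * transposeRight H₁ H₂ X := by
  refine LinearMap.ext fun φ => TensorProduct.ext' fun x y => rfl

theorem transposeLeft_comm_transposeRight (X : Module.End ℂ H₁) (Y : Module.End ℂ H₂) :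
    Commute (transposeLeft H₁ H₂ X) (transposeRight H₁ H₂ Y) := by
  refine LinearMap.ext fun φ => TensorProduct.ext' fun x y => rfl

theorem transposeLeft_dualTensor (X : Module.End ℂ H₁) (φ : Module.Dual ℂ H₁)
    (ψ : Module.Dual ℂ H₂) :
    transposeLeft H₁ H₂ X (dualTensor φ ψ) = dualTensor (φ ∘ₗ X) ψ := by
  refine TensorProduct.ext' fun x y => rfl

theorem transposeRight_dualTensor (Y : Module.End ℂ H₂) (φ : Module.Dual ℂ H₁)
    (ψ : Module.Dual ℂ H₂) :
    transposeRight H₁ H₂ Y (dualTensor φ ψ) = dualTensor φ (ψ ∘ₗ Y) := by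
  refine TensorProduct.ext' fun x y => rfl

/-- Matrix transposition reverses the product `T⁽²⁾ T⁽¹⁾`, which is why the first model ends up on
the left. -/
theorem psiMonodromy_composite {m : ℕ} (T₁ : OpMatrix m H₁) (T₂ : OpMatrix m H₂) :
    psiMonodromy (compositeMonodromy T₁ T₂)
      = fun u => (Matrix.of fun a b => transposeLeft H₁ H₂ (T₁ u⁻¹ b a))
          * Matrix.of fun a b => transposeRight H₁ H₂ (T₂ u⁻¹ b a) := by
  funext u
  ext1 a b
  change Module.Dual.transpose (R := ℂ) (∑ k, (TensorProduct.map LinearMap.id (T₂ u⁻¹ b k) :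
    Module.End ℂ (H₁ ⊗[ℂ] H₂)) * TensorProduct.map (T₁ u⁻¹ k a) LinearMap.id)
      = ∑ k, transposeLeft H₁ H₂ (T₁ u⁻¹ k a) * transposeRight H₁ H₂ (T₂ u⁻¹ b k)
  rw [map_sum]
  rfl

end Dual

end
end QAffine

theorem mainTheorem11 (q : ℂ) (hq : q ≠ 0) (N : ℕ)
    {H₁ H₂ : Type u} [AddCommGroup H₁] [Module ℂ H₁] [AddCommGroup H₂] [Module ℂ H₂]
    (D : Set ℂ)
    (T₁ : QAffine.OpMatrix (N + 1) H₁) (T₂ : QAffine.OpMatrix (N + 1) H₂)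
    (hT₁ : QAffine.SatisfiesRTT q D T₁) (hT₂ : QAffine.SatisfiesRTT q D T₂)
    (lam₁ lam₂ : Fin (N + 1) → ℂ → ℂ)
    (w₁ : Module.Dual ℂ H₁) (w₂ : Module.Dual ℂ H₂)
    (hw₁ : QAffine.IsDualVacuum D T₁ lam₁ w₁) (hw₂ : QAffine.IsDualVacuum D T₂ lam₂ w₂)
    (r : Fin N → ℕ) (s : (ν : Fin N) → Fin (r ν) → ℂ)
    (hsD : ∀ ν a, s ν a ∈ D) (hs0 : ∀ ν a, s ν a ≠ 0)
    (hsinj : Function.Injective fun p : (ν : Fin N) × Fin (r ν) => s p.1 p.2)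
    (hlam₁ : ∀ ν a, lam₁ ν.succ (s ν a) ≠ 0) (hlam₂ : ∀ ν a, lam₂ ν.succ (s ν a) ≠ 0)
    (hf : ∀ ν a b, a ≠ b → QAffine.fFun q (s ν a) (s ν b) ≠ 0)
    (hf' : ∀ μ ν : Fin N, (μ : ℕ) = ν + 1 → ∀ a b, QAffine.fFun q (s μ a) (s ν b) ≠ 0) :
    QAffine.dualBetheVector q (QAffine.compositeMonodromy T₁ T₂)
        (fun i u => lam₁ i u * lam₂ i u) (QAffine.dualTensor w₁ w₂) (fun ν => List.ofFn (s ν))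
      = ∑ I : (ν : Fin N) → Finset (Fin (r ν)),
          QAffine.coproductCoeff q lam₁
              (QAffine.subFamily s I) (QAffine.subFamily s fun ν => (I ν)ᶜ) •
            QAffine.dualTensor
              (QAffine.dualBetheVector q T₁ lam₁ w₁ (QAffine.subFamily s I))
              (QAffine.dualBetheVector q T₂ lam₂ w₂ (QAffine.subFamily s fun ν => (I ν)ᶜ)) := by
  open QAffine in
  rw [satisfiesRTT_iff] at hT₁ hT₂
  -- The point `0` is removed from the inverted spectral set: with `0⁻¹ = 0`, inversion does not
  -- transpose `R` there.
  have key := betheVector_bilinear (inv_ne_zero hq) N (dualTensorBilin H₁ H₂)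
    (D := {u | u⁻¹ ∈ D ∧ u ≠ 0}) (T₁ := psiMonodromy T₁) (T₂ := psiMonodromy T₂)
    (S₁ := fun u => Matrix.of fun a b => transposeLeft H₁ H₂ (T₁ u⁻¹ b a))
    (S₂ := fun u => Matrix.of fun a b => transposeRight H₁ H₂ (T₂ u⁻¹ b a))
    (lam₁ := fun i u => lam₁ i u⁻¹) (lam₂ := fun i u => lam₂ i u⁻¹) (v₁ := w₁) (v₂ := w₂)
    (fun u hu v hv huv => (hT₁ _ hu.1 _ hv.1 (inv_injective.ne huv)).antihom hu.2 hv.2 _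
      transposeLeft_mul)
    (fun u hu v hv huv => (hT₂ _ hu.1 _ hv.1 (inv_injective.ne huv)).antihom hu.2 hv.2 _
      transposeRight_mul)
    (fun u _ v _ i j k l => transposeLeft_comm_transposeRight _ _)
    (fun u _ i j x y => (transposeLeft_dualTensor _ _ _).symm)
    (fun u _ i j x y => (transposeRight_dualTensor _ _ _).symm)
    (fun u hu => ⟨fun i j hij => by
        change transposeLeft H₁ H₂ (T₁ u⁻¹ j i) (dualTensor w₁ w₂) = 0
        rw [transposeLeft_dualTensor, hw₁.upper _ hu.1 _ _ hij, ← dualTensorBilin_apply, map_zero,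
          LinearMap.zero_apply], fun i => by
        change transposeLeft H₁ H₂ (T₁ u⁻¹ i i) (dualTensor w₁ w₂) = _
        rw [transposeLeft_dualTensor, hw₁.diag _ hu.1, ← dualTensorBilin_apply,
          LinearMap.map_smul₂]⟩)
    (fun u hu => ⟨fun i j hij => by
        change transposeRight H₁ H₂ (T₂ u⁻¹ j i) (dualTensor w₁ w₂) = 0
        rw [transposeRight_dualTensor, hw₂.upper _ hu.1 _ _ hij, ← dualTensorBilin_apply, map_zero],
      fun i => by
        change transposeRight H₁ H₂ (T₂ u⁻¹ i i) (dualTensor w₁ w₂) = _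
        rw [transposeRight_dualTensor, hw₂.diag _ hu.1, ← dualTensorBilin_apply, map_smul]⟩)
    (fun ν a => (s ν a)⁻¹)
    (fun ν a => ⟨by simpa using hsD ν a, inv_ne_zero (hs0 ν a)⟩)
    (fun ν a => inv_ne_zero (hs0 ν a)) (fun p p' h => hsinj (inv_injective h))
    (fun ν a => by simpa using hlam₁ ν a) (fun ν a => by simpa using hlam₂ ν a)
    (fun ν a b hab => by
      rw [fFun_inv (hs0 _ _) (hs0 _ _)]
      exact hf ν a b hab)
    (fun μ ν hμν a b => by
      rw [fFun_inv (hs0 _ _) (hs0 _ _)]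
      exact hf' μ ν hμν a b)
  have hsub : ∀ I : (ν : Fin N) → Finset (Fin (r ν)), subFamily (fun ν a => (s ν a)⁻¹) I
      = fun ν => (subFamily s I ν).map fun x => x⁻¹ := fun I => by
    funext ν
    simp [subFamily, Function.comp_def]
  have hne : ∀ (I : (ν : Fin N) → Finset (Fin (r ν))), ∀ ν, ∀ u ∈ subFamily s I ν, u ≠ 0 := by
    intro I ν u hu
    obtain ⟨a, -, rfl⟩ := List.mem_map.1 hu
    exact hs0 ν a
  simp only [hsub, coproductCoeff_inv q lam₁ (hne _) (hne _)] at key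
  simp only [dualBetheVector, psiMonodromy_composite, List.map_ofFn]
  exact key
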